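/- Let $(X(p))_p$, indexed by the primes $p$, be independent complex random variables, each uniformly distributed on the unit circle $|z|=1$. For $\sigma>1/2$ put $$\zeta(\sigma,X)=\prod_p\Bigl(1-\frac{X(p)}{p^{\sigma}}\Bigr)^{-1},\qquad \log\zeta(\sigma,X)=\sum_p-\log\Bigl(1-\frac{X(p)}{p^{\sigma}}\Bigr),\qquad \psi(\sigma)=\sum_{p}\sum_{k\ge1}\frac{1}{k^{2}p^{2k\sigma}},$$ where the logarithms of the individual factors are principal and the product and the sum in the first two formulas are taken over the primes in increasing order. There are polynomials $c_{m,n}\in\mathbb R[\alpha]$ ($m,n\ge0$, $m+n\le5$) with $c_{0,0}(0)=1/\pi$ and a constant $C$ such that the following holds for every real $\sigma$ with $1/2<\sigma\le3/4$. (0) The product and the sum defining $\zeta(\sigma,X)$ and $\log\zeta(\sigma,X)$ converge almost surely, with $\exp(\log\zeta(\sigma,X))=\zeta(\sigma,X)$ almost surely; the series $\psi(\sigma)$ converges, and $$\Bigl|\psi(\sigma)-\log\frac{1}{\sigma-1/2}\Bigr|\le C.$$ (1) There is a nonnegative, integrable $C^\infty$ function $F_\sigma:\mathbb R^2\to\mathbb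 R$, depending only on $\sigma$, such that for every Borel set $\mathcal B\subseteq\mathbb R^2$ (with $\mathbb C$ identified with $\mathbb R^2$) $$\mathbf P\bigl[\log\zeta(\sigma,X)\in\mathcal B\bigr]=\iint_{\mathcal B}F_\sigma(x,y)\,dx\,dy.$$ (2) For all real $x,y$, $$\Biggl|F_\sigma(x,y)-\sum_{\substack{m,n\ge0\\ m+n\le5}}\frac{c_{m,n}\bigl(1/\sqrt{\psi(\sigma)}\bigr)}{\psi(\sigma)^{m+n+1}}\,x^{m}y^{n}e^{-(x^{2}+y^{2})/\psi(\sigma)}\Biggr|\le\frac{C}{\psi(\sigma)^{4}}.$$ -/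

import Mathlib

open MeasureTheory ProbabilityTheory Filter Topology
open scoped ContDiff

/-- The uniform probability measure on the unit circle: the law of `exp (i t)` when `t` is
uniformly distributed on `(-π, π]`. -/
noncomputable def circleUniform : Measure ℂ :=
  ((ENNReal.ofReal (2 * Real.pi))⁻¹ •
    (volume.restrict (Set.Ioc (-Real.pi) Real.pi) : Measure ℝ)).map
    (fun t : ℝ => Complex.exp (t * Complex.I))

/-- The finite set of primes `p ≤ N`. -/
def primesUpTo (N : ℕ) : Finset Nat.Primes :=
  (Finset.range (N + 1)).subtype Nat.Prime

/-- The partial Euler product `∏_{p ≤ N} (1 - x(p) / p^σ)⁻¹`. -/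
noncomputable def eulerPartial (σ : ℝ) (x : Nat.Primes → ℂ) (N : ℕ) : ℂ :=
  ∏ p ∈ primesUpTo N, (1 - x p / (((p : ℕ) : ℝ) ^ σ : ℝ))⁻¹

/-- The sum `∑_{p ≤ N} -log (1 - x(p) / p^σ)` of the principal logarithms of the Euler factors. -/
noncomputable def logEulerPartial (σ : ℝ) (x : Nat.Primes → ℂ) (N : ℕ) : ℂ :=
  ∑ p ∈ primesUpTo N, -Complex.log (1 - x p / (((p : ℕ) : ℝ) ^ σ : ℝ))

/-- The Euler product `ζ(σ, x) = ∏_p (1 - x(p) / p^σ)⁻¹`, taken over the primes in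
increasing order (for `1/2 < σ ≤ 1` it does not converge absolutely). -/
noncomputable def eulerZeta (σ : ℝ) (x : Nat.Primes → ℂ) : ℂ :=
  limUnder atTop (eulerPartial σ x)

/-- The logarithm `log ζ(σ, x) = ∑_p -log (1 - x(p) / p^σ)`, with the principal branch in each
term and the sum taken over the primes in increasing order. -/
noncomputable def logEulerZeta (σ : ℝ) (x : Nat.Primes → ℂ) : ℂ :=
  limUnder atTop (logEulerPartial σ x)

/-- The terms `1 / (k² p^{2kσ})`, for `p` prime and `k ≥ 1`. -/
noncomputable def psiTerm (σ : ℝ) (q : Nat.Primes × ℕ+) : ℝ :=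
  1 / (((q.2 : ℕ) : ℝ) ^ 2 * ((q.1 : ℕ) : ℝ) ^ (2 * ((q.2 : ℕ) : ℝ) * σ))

/-- `ψ(σ) = ∑_{p, k} 1 / (k² p^{2kσ})`. -/
noncomputable def psi (σ : ℝ) : ℝ :=
  ∑' q : Nat.Primes × ℕ+, psiTerm σ q

/-- The main term
`∑_{m + n ≤ 5} c_{m,n}(ψ^{-1/2}) ψ^{-(m+n+1)} x^m y^n exp (-(x² + y²) / ψ)`. -/
noncomputable def mainTerm (c : ℕ → ℕ → Polynomial ℝ) (ψ x y : ℝ) : ℝ :=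
  ∑ q ∈ (Finset.range 6 ×ˢ Finset.range 6).filter (fun q => q.1 + q.2 ≤ 5),
    (c q.1 q.2).eval (1 / Real.sqrt ψ) / ψ ^ (q.1 + q.2 + 1) * x ^ q.1 * y ^ q.2 *
      Real.exp (-(x ^ 2 + y ^ 2) / ψ)

/-! ### The uniform measure on the unit circle -/

/-! The argument is an Edgeworth expansion carried out on the Fourier side. Write Y_p = `eulerLog
(primeRadius σ p) (X p)`. These are independent, and log ζ(σ, X) is their sum; it converges almost
surely because an L²-bounded martingale does. Its characteristic function is the infinite product of
the factors `eulerChar`, so its law `logZetaLaw σ` depends on σ alone.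

Each Y_p is holomorphic in X(p) and vanishes at 0, so Y_p and Y_p² both have mean zero. The
covariance is therefore isotropic, and by Parseval the second absolute moments sum to exactly ψ(σ).
The Gaussian factor is thus exp(-ψ|w|²/4), and only corrections of order at least three remain.

For |w| ≤ 1 each factor times its inverse Gaussian is 1 + (terms of degree 3 to 5) +
O(p^{-3/2}|w|^6). As p^{-3/2} is summable, the product equals 1 plus the sum of the corrections up
to O(|w|^6). The corrections may be taken at σ = 1/2 at a cost O(σ - 1/2)
(`exists_norm_charFun_mul_exp_sub_le`). This cost is negligible: ψ(σ) agrees with log ζ(2σ), hence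
with log(1/(σ - 1/2)), up to a bounded term, so σ - 1/2 = O(e^{-ψ}). The corrections at σ = 1/2 add
up to one fixed polynomial (`exists_one_add_tsum_eulerCorrection_eq`).

For |w| ≥ 1 every factor has modulus at most 1, and at most exp(-|w|²p^{-2σ}/8) once p^σ ≥ 300|w|.
The total mass of p^{-2σ} gives decay in ψ, and Chebyshev's lower bound for the number of primes
gives decay exp(-c√|w|) uniformly in σ. Together they give O(ψ^{-4}(1+|w|)^{-3})
(`exists_norm_charFun_logZetaLaw_le_div_psi_pow`).

The decay makes Fourier inversion available and the density smooth (`exists_contDiff_density`). In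
the plane the integral of |w|^6 exp(-ψ|w|²/4) is a constant times ψ^{-4}, which is the error term;
the polynomial times the Gaussian inverts to Hermite-type polynomials times exp(-(x²+y²)/ψ), which
is the main term (`re_integral_trianglePoly_mul_gaussian`). -/

theorem measurable_cexp_mul_I : Measurable fun t : ℝ => Complex.exp (t * Complex.I) := by
  fun_prop

instance isProbabilityMeasure_circleUniform : IsProbabilityMeasure circleUniform := by
  refine ⟨?_⟩
  rw [circleUniform, Measure.map_apply measurable_cexp_mul_I MeasurableSet.univ]
  simp only [Set.preimage_univ, Measure.smul_apply, Measure.restrict_apply_univ, Real.volume_Ioc,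
    smul_eq_mul]
  rw [show Real.pi - -Real.pi = 2 * Real.pi by ring]
  exact ENNReal.inv_mul_cancel (by simp [Real.pi_pos]) ENNReal.ofReal_ne_top

theorem ae_norm_eq_one_circleUniform : ∀ᵐ z ∂circleUniform, ‖z‖ = 1 := by
  rw [circleUniform, ae_map_iff measurable_cexp_mul_I.aemeasurable
    (measurableSet_eq_fun measurable_norm measurable_const)]
  exact Eventually.of_forall fun t => Complex.norm_exp_ofReal_mul_I t

theorem integral_circleUniform_eq_circleAverage {f : ℂ → ℂ} (hf : Measurable f) :
    ∫ z, f z ∂circleUniform = Real.circleAverage f 0 1 := by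
  rw [circleUniform, integral_map measurable_cexp_mul_I.aemeasurable
    hf.aestronglyMeasurable, integral_smul_measure,
    ← intervalIntegral.integral_of_le (by linarith [Real.pi_pos]), Real.circleAverage_def]
  have hper : Function.Periodic (fun t : ℝ => f (Complex.exp (t * Complex.I))) (2 * Real.pi) := by
    intro t
    simp only [Complex.ofReal_add, add_mul]
    congr 1
    simpa using Complex.exp_periodic (t * Complex.I)
  have h := hper.intervalIntegral_add_eq (-Real.pi) 0
  rw [show -Real.pi + 2 * Real.pi = Real.pi by ring, zero_add] at h
  rw [h, ENNReal.toReal_inv, ENNReal.toReal_ofReal (by positivity)]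
  simp [circleMap]

/-- The mean value property. All vanishing moments below come from it. -/
theorem integral_circleUniform_of_diffContOnCl {f : ℂ → ℂ} (hm : Measurable f)
    (hf : DiffContOnCl ℂ f (Metric.ball 0 1)) : ∫ z, f z ∂circleUniform = f 0 := by
  rw [integral_circleUniform_eq_circleAverage hm]
  exact DiffContOnCl.circleAverage (by simpa using hf)

theorem integral_pow_circleUniform (n : ℕ) :
    ∫ z, z ^ n ∂circleUniform = if n = 0 then 1 else 0 := by
  rw [integral_circleUniform_of_diffContOnCl (by fun_prop)
    (Differentiable.diffContOnCl (by fun_prop))]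
  simp [zero_pow_eq]

theorem integral_conj_pow_mul_pow_circleUniform (m n : ℕ) :
    ∫ z, (starRingEnd ℂ z) ^ m * z ^ n ∂circleUniform = if n = m then 1 else 0 := by
  have key : ∀ m n : ℕ, m ≤ n →
      ∫ z, (starRingEnd ℂ z) ^ m * z ^ n ∂circleUniform = if n = m then 1 else 0 := by
    intro m n hmn
    obtain ⟨k, rfl⟩ := Nat.exists_eq_add_of_le hmn
    have h : ∫ z, (starRingEnd ℂ z) ^ m * z ^ (m + k) ∂circleUniform
        = ∫ z, z ^ k ∂circleUniform := by
      refine integral_congr_ae ?_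
      filter_upwards [ae_norm_eq_one_circleUniform] with z hz
      rw [pow_add, ← mul_assoc, ← mul_pow, mul_comm (starRingEnd ℂ z), Complex.mul_conj,
        Complex.normSq_eq_norm_sq, hz]
      simp
    rw [h, integral_pow_circleUniform]
    simp
  rcases le_total m n with h | h
  · exact key m n h
  · have := congrArg (starRingEnd ℂ) (key n m h)
    rw [← integral_conj] at this
    simp only [map_mul, map_pow, Complex.conj_conj] at this
    rw [show (fun z : ℂ => (starRingEnd ℂ z) ^ m * z ^ n)
      = fun z : ℂ => z ^ n * (starRingEnd ℂ z) ^ m from funext fun z => mul_comm _ _, this]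
    by_cases hmn : n = m
    · simp [hmn]
    · simp [hmn, Ne.symm hmn]

/-! ### The logarithm of an Euler factor -/

/-- The logarithm `-log (1 - r z)` of an Euler factor. -/
noncomputable def eulerLog (r : ℝ) (z : ℂ) : ℂ := -Complex.log (1 - z * r)

theorem measurable_eulerLog (r : ℝ) : Measurable (eulerLog r) := by
  unfold eulerLog; fun_prop

theorem norm_mul_ofReal_le {r : ℝ} {z : ℂ} (hz : ‖z‖ ≤ 1) (hr : 0 ≤ r) : ‖z * r‖ ≤ r := by
  rw [norm_mul, Complex.norm_real, Real.norm_of_nonneg hr]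
  exact mul_le_of_le_one_left hr hz

/-- The range r ≤ 3/4 contains every radius p^{-σ} with σ ≥ 1/2, since 2^{-1/2} < 3/4, and stays
away from the singularity at r = 1. -/
theorem norm_eulerLog_le {r : ℝ} {z : ℂ} (hz : ‖z‖ ≤ 1) (hr : 0 ≤ r) (hr' : r ≤ 3 / 4) :
    ‖eulerLog r z‖ ≤ 3 * r := by
  have h1 := norm_mul_ofReal_le hz hr
  have h2 := Complex.norm_log_one_add_sub_self_le (z := -(z * r)) (by rw [norm_neg]; linarith)
  rw [norm_neg] at h2
  have h3 : ‖eulerLog r z‖ ≤ ‖Complex.log (1 + -(z * r)) - -(z * r)‖ + ‖-(z * r)‖ := by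
    rw [eulerLog, norm_neg, sub_eq_add_neg]
    simpa using norm_add_le (Complex.log (1 + -(z * r)) - -(z * r)) (-(z * r))
  rw [norm_neg] at h3
  have h4 : ‖z * r‖ ^ 2 * (1 - ‖z * r‖)⁻¹ / 2 ≤ 2 * r := by
    have : (1 - ‖z * r‖)⁻¹ ≤ 4 := by
      rw [inv_le_comm₀ (by linarith) (by norm_num)]; linarith
    have h5 : ‖z * r‖ ^ 2 ≤ r * (3 / 4) := by nlinarith [norm_nonneg (z * r)]
    have h6 : 0 ≤ (1 - ‖z * r‖)⁻¹ := by rw [inv_nonneg]; linarith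
    nlinarith
  linarith

theorem one_sub_mem_slitPlane {u : ℂ} (hu : ‖u‖ < 1) : 1 - u ∈ Complex.slitPlane := by
  left
  have := (Complex.abs_re_le_norm u).trans_lt hu
  have := (abs_lt.1 this).2
  simp; linarith

theorem norm_eulerLog_sub_le {r s : ℝ} {z : ℂ} (hz : ‖z‖ ≤ 1) (hr : 0 ≤ r) (hr' : r ≤ 3 / 4)
    (hs : 0 ≤ s) (hs' : s ≤ 3 / 4) : ‖eulerLog r z - eulerLog s z‖ ≤ 4 * |r - s| := by
  have hder : ∀ t ∈ Set.Icc (0 : ℝ) (3 / 4), HasDerivWithinAt (fun t : ℝ => eulerLog t z)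
      (z / (1 - z * t)) (Set.Icc 0 (3 / 4)) t := by
    intro t ht
    have hb : ‖z * (t : ℂ)‖ < 1 := (norm_mul_ofReal_le hz ht.1).trans_lt (by linarith [ht.2])
    have h1 : HasDerivAt (fun t : ℝ => 1 - z * (t : ℂ)) (-z) t := by
      have := ((hasDerivAt_id t).ofReal_comp.const_mul z).const_sub 1
      simpa using this
    have := (h1.clog_real (one_sub_mem_slitPlane hb)).neg
    rw [neg_div, neg_neg] at this
    exact this.hasDerivWithinAt
  have hbd : ∀ t ∈ Set.Icc (0 : ℝ) (3 / 4), ‖z / (1 - z * t)‖ ≤ 4 := by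
    intro t ht
    have hb : ‖z * (t : ℂ)‖ ≤ 3 / 4 := (norm_mul_ofReal_le hz ht.1).trans ht.2
    have h2 : 1 / 4 ≤ ‖1 - z * (t : ℂ)‖ := by
      have := norm_sub_norm_le (1 : ℂ) (z * t)
      rw [norm_one] at this; linarith
    rw [norm_div, div_le_iff₀ (by linarith)]
    linarith
  simpa [Real.norm_eq_abs] using (convex_Icc (0 : ℝ) (3 / 4)).norm_image_sub_le_of_norm_hasDerivWithin_le
    hder hbd ⟨hs, hs'⟩ ⟨hr, hr'⟩

theorem diffContOnCl_eulerLog {r : ℝ} (hr : 0 ≤ r) (hr' : r ≤ 3 / 4) :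
    DiffContOnCl ℂ (eulerLog r) (Metric.ball 0 1) := by
  refine DifferentiableOn.diffContOnCl fun z hz => ?_
  rw [closure_ball (0 : ℂ) one_ne_zero, mem_closedBall_zero_iff] at hz
  have hb : ‖z * (r : ℂ)‖ < 1 := (norm_mul_ofReal_le hz hr).trans_lt (by linarith)
  refine DifferentiableAt.differentiableWithinAt ?_
  have h : DifferentiableAt ℂ (fun z : ℂ => 1 - z * (r : ℂ)) z := by fun_prop
  exact (h.clog (one_sub_mem_slitPlane hb)).neg

theorem integral_eulerLog {r : ℝ} (hr : 0 ≤ r) (hr' : r ≤ 3 / 4) :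
    ∫ z, eulerLog r z ∂circleUniform = 0 := by
  rw [integral_circleUniform_of_diffContOnCl (measurable_eulerLog r)
    (diffContOnCl_eulerLog hr hr')]
  simp [eulerLog]

/-- The square without absolute values is still holomorphic and zero at the origin. This is what
makes the covariance matrix a multiple of the identity. -/
theorem integral_eulerLog_sq {r : ℝ} (hr : 0 ≤ r) (hr' : r ≤ 3 / 4) :
    ∫ z, eulerLog r z ^ 2 ∂circleUniform = 0 := by
  rw [integral_circleUniform_of_diffContOnCl ((measurable_eulerLog r).pow_const 2)]
  · simp [eulerLog]
  · have := diffContOnCl_eulerLog hr hr'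
    simpa [pow_two, smul_eq_mul] using this.smul this

theorem ae_norm_eulerLog_le {r : ℝ} (hr : 0 ≤ r) (hr' : r ≤ 3 / 4) :
    ∀ᵐ z ∂circleUniform, ‖eulerLog r z‖ ≤ 3 * r := by
  filter_upwards [ae_norm_eq_one_circleUniform] with z hz
  exact norm_eulerLog_le hz.le hr hr'

theorem hasSum_eulerLog {r : ℝ} (hr : 0 ≤ r) (hr' : r ≤ 3 / 4) {z : ℂ} (hz : ‖z‖ ≤ 1) :
    HasSum (fun n : ℕ => ((r ^ n / n : ℝ) : ℂ) * z ^ n) (eulerLog r z) := by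
  have hb : ‖z * (r : ℂ)‖ < 1 := (norm_mul_ofReal_le hz hr).trans_lt (by linarith)
  refine (Complex.hasSum_taylorSeries_neg_log hb).congr_fun fun n => ?_
  push_cast
  rw [mul_pow]; ring

theorem summable_pow_div {r : ℝ} (hr : 0 ≤ r) (hr' : r ≤ 3 / 4) :
    Summable fun n : ℕ => r ^ n / n := by
  refine Summable.of_nonneg_of_le (fun n => by positivity) (fun n => ?_)
    (summable_geometric_of_lt_one hr (by linarith))
  rcases Nat.eq_zero_or_pos n with rfl | hn
  · simp
  · exact div_le_self (by positivity) (by exact_mod_cast hn)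

theorem hasSum_integral_mul_eulerLog {r : ℝ} (hr : 0 ≤ r) (hr' : r ≤ 3 / 4) {g : ℂ → ℂ}
    (hg : Measurable g) {B : ℝ} (hB : ∀ z, ‖z‖ = 1 → ‖g z‖ ≤ B) :
    HasSum (fun n : ℕ => ((r ^ n / n : ℝ) : ℂ) * ∫ z, g z * z ^ n ∂circleUniform)
      (∫ z, g z * eulerLog r z ∂circleUniform) := by
  have hbd : ∀ n : ℕ, ∀ᵐ z ∂circleUniform,
      ‖((r ^ n / n : ℝ) : ℂ) * (g z * z ^ n)‖ ≤ r ^ n / n * B := by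
    intro n
    filter_upwards [ae_norm_eq_one_circleUniform] with z hz
    rw [norm_mul, norm_mul, norm_pow, hz, one_pow, mul_one, Complex.norm_real,
      Real.norm_of_nonneg (by positivity)]
    exact mul_le_mul_of_nonneg_left (hB z hz) (by positivity)
  have hint : ∀ n : ℕ, Integrable (fun z => ((r ^ n / n : ℝ) : ℂ) * (g z * z ^ n))
      circleUniform := fun n =>
    Integrable.of_bound (by fun_prop) _ (hbd n)
  have h := hasSum_integral_of_summable_integral_norm hint
    (Summable.of_nonneg_of_le (fun n => integral_nonneg fun z => norm_nonneg _) (fun n => by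
      calc _ ≤ ∫ z, r ^ n / n * B ∂circleUniform :=
            integral_mono_ae (hint n).norm (integrable_const _) (hbd n)
        _ = r ^ n / n * B := by simp) ((summable_pow_div hr hr').mul_right B))
  simp only [integral_const_mul] at h
  convert! h using 1
  refine integral_congr_ae ?_
  filter_upwards [ae_norm_eq_one_circleUniform] with z hz
  rw [← ((hasSum_eulerLog hr hr' hz.le).mul_left (g z)).tsum_eq]
  exact tsum_congr fun n => by ring

theorem integral_conj_pow_mul_eulerLog {r : ℝ} (hr : 0 ≤ r) (hr' : r ≤ 3 / 4) (m : ℕ) :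
    ∫ z, (starRingEnd ℂ z) ^ m * eulerLog r z ∂circleUniform = ((r ^ m / m : ℝ) : ℂ) := by
  have h := hasSum_integral_mul_eulerLog hr hr' (g := fun z => (starRingEnd ℂ z) ^ m) (B := 1)
    ((Complex.continuous_conj.pow m).measurable) (fun z hz => by simp [hz])
  simp only [integral_conj_pow_mul_pow_circleUniform] at h
  refine h.unique ?_
  convert! hasSum_ite_eq m ((r ^ m / m : ℝ) : ℂ) using 2 with n
  by_cases hn : n = m <;> simp [hn]

/-- The second absolute moment of `eulerLog r`. -/
noncomputable def eulerVar (r : ℝ) : ℝ := ∫ z, ‖eulerLog r z‖ ^ 2 ∂circleUniform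

/-- Parseval's identity for the Taylor series of the logarithm, whose coefficients are r^n / n.
Summed over primes these are the terms of ψ. -/
theorem hasSum_eulerVar {r : ℝ} (hr : 0 ≤ r) (hr' : r ≤ 3 / 4) :
    HasSum (fun n : ℕ => (r ^ n / n) ^ 2) (eulerVar r) := by
  have h := hasSum_integral_mul_eulerLog hr hr' (g := fun z => starRingEnd ℂ (eulerLog r z))
    (B := 3 * r) (Complex.continuous_conj.measurable.comp (measurable_eulerLog r))
    (fun z hz => by simpa using norm_eulerLog_le hz.le hr hr')
  have h2 : ∀ n : ℕ, ∫ z, starRingEnd ℂ (eulerLog r z) * z ^ n ∂circleUniform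
      = ((r ^ n / n : ℝ) : ℂ) := by
    intro n
    have := congrArg (starRingEnd ℂ) (integral_conj_pow_mul_eulerLog hr hr' n)
    rw [← integral_conj, Complex.conj_ofReal] at this
    simp only [map_mul, map_pow, Complex.conj_conj] at this
    rw [← this]
    exact integral_congr_ae (Eventually.of_forall fun z => mul_comm _ _)
  have h3 : ∫ z, starRingEnd ℂ (eulerLog r z) * eulerLog r z ∂circleUniform = (eulerVar r : ℂ) := by
    rw [eulerVar, ← integral_complex_ofReal]
    refine integral_congr_ae (Eventually.of_forall fun z => ?_)
    simp [mul_comm, Complex.mul_conj, Complex.normSq_eq_norm_sq]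
  simp only [h2, h3] at h
  rw [← Complex.hasSum_ofReal]
  convert! h using 2 with n
  push_cast; ring

theorem sq_le_eulerVar {r : ℝ} (hr : 0 ≤ r) (hr' : r ≤ 3 / 4) : r ^ 2 ≤ eulerVar r := by
  have := (hasSum_eulerVar hr hr').summable.le_tsum 1 (fun _ _ => by positivity)
  rw [(hasSum_eulerVar hr hr').tsum_eq] at this
  simpa using this

theorem eulerVar_le {r : ℝ} (hr : 0 ≤ r) (hr' : r ≤ 3 / 4) : eulerVar r ≤ 9 * r ^ 2 := by
  calc eulerVar r ≤ ∫ z, 9 * r ^ 2 ∂circleUniform := by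
        refine integral_mono_of_nonneg (Eventually.of_forall fun z => by positivity)
          (integrable_const _) ?_
        filter_upwards [ae_norm_eulerLog_le hr hr'] with z hz
        nlinarith [norm_nonneg (eulerLog r z)]
    _ = 9 * r ^ 2 := by simp

theorem eulerVar_nonneg (r : ℝ) : 0 ≤ eulerVar r := integral_nonneg fun z => by positivity

/-! ### The characteristic function of the logarithm of an Euler factor -/

open scoped RealInnerProductSpace in
/-- The `j`-th moment of `⟪eulerLog r z, w⟫` for `z` uniformly distributed on the circle. -/
noncomputable def eulerMoment (r : ℝ) (w : ℂ) (j : ℕ) : ℝ :=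
  ∫ z, ⟪eulerLog r z, w⟫ ^ j ∂circleUniform

open scoped RealInnerProductSpace in
/-- The characteristic function of `eulerLog r z` for `z` uniformly distributed on the circle. -/
noncomputable def eulerChar (r : ℝ) (w : ℂ) : ℂ :=
  ∫ z, Complex.exp (⟪eulerLog r z, w⟫ * Complex.I) ∂circleUniform

/-- The homogeneous terms of the Taylor expansion of `eulerChar r`. -/
noncomputable def eulerTaylor (r : ℝ) (w : ℂ) (j : ℕ) : ℂ :=
  Complex.I ^ j * eulerMoment r w j / j.factorial

open scoped RealInnerProductSpace

theorem measurable_inner_eulerLog (r : ℝ) (w : ℂ) : Measurable fun z => ⟪eulerLog r z, w⟫ :=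
  (measurable_eulerLog r).inner_const

theorem ae_abs_inner_eulerLog_le {r : ℝ} (hr : 0 ≤ r) (hr' : r ≤ 3 / 4) (w : ℂ) :
    ∀ᵐ z ∂circleUniform, |⟪eulerLog r z, w⟫| ≤ 3 * r * ‖w‖ := by
  filter_upwards [ae_norm_eulerLog_le hr hr'] with z hz
  exact (abs_real_inner_le_norm _ _).trans (by gcongr)

theorem integrable_inner_eulerLog_pow {r : ℝ} (hr : 0 ≤ r) (hr' : r ≤ 3 / 4) (w : ℂ) (j : ℕ) :
    Integrable (fun z => ⟪eulerLog r z, w⟫ ^ j) circleUniform := by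
  refine Integrable.of_bound ((measurable_inner_eulerLog r w).pow_const j).aestronglyMeasurable
    ((3 * r * ‖w‖) ^ j) ?_
  filter_upwards [ae_abs_inner_eulerLog_le hr hr' w] with z hz
  rw [norm_pow, Real.norm_eq_abs]
  gcongr

theorem abs_eulerMoment_le {r : ℝ} (hr : 0 ≤ r) (hr' : r ≤ 3 / 4) (w : ℂ) (j : ℕ) :
    |eulerMoment r w j| ≤ (3 * r * ‖w‖) ^ j := by
  have h : ∀ᵐ z ∂circleUniform, ‖⟪eulerLog r z, w⟫ ^ j‖ ≤ (3 * r * ‖w‖) ^ j := by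
    filter_upwards [ae_abs_inner_eulerLog_le hr hr' w] with z hz
    rw [norm_pow, Real.norm_eq_abs]
    gcongr
  simpa [eulerMoment] using norm_integral_le_of_norm_le_const h

theorem abs_pow_sub_pow_le_mul {a b M : ℝ} (ha : |a| ≤ M) (hb : |b| ≤ M) (j : ℕ) :
    |a ^ (j + 1) - b ^ (j + 1)| ≤ (j + 1) * M ^ j * |a - b| := by
  have := (abs_pow_sub_pow_le a b (j + 1))
  refine this.trans ?_
  have hM : max |a| |b| ^ j ≤ M ^ j := by
    gcongr
    exact max_le ha hb
  push_cast
  calc |a - b| * (j + 1) * max |a| |b| ^ j ≤ |a - b| * (j + 1) * M ^ j := by gcongr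
    _ = _ := by ring

theorem abs_eulerMoment_sub_le {r s R : ℝ} (hr : 0 ≤ r) (hs : 0 ≤ s) (hrR : r ≤ R) (hsR : s ≤ R)
    (hR : R ≤ 3 / 4) {w : ℂ} (hw : ‖w‖ ≤ 1) (j : ℕ) :
    |eulerMoment r w (j + 1) - eulerMoment s w (j + 1)|
      ≤ (j + 1) * (3 * R) ^ j * (4 * |r - s|) := by
  rw [eulerMoment, eulerMoment, ← integral_sub
    (integrable_inner_eulerLog_pow hr (hrR.trans hR) w _)
    (integrable_inner_eulerLog_pow hs (hsR.trans hR) w _)]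
  have h : ∀ᵐ z ∂circleUniform, ‖⟪eulerLog r z, w⟫ ^ (j + 1) - ⟪eulerLog s z, w⟫ ^ (j + 1)‖
      ≤ (j + 1) * (3 * R) ^ j * (4 * |r - s|) := by
    filter_upwards [ae_norm_eq_one_circleUniform, ae_abs_inner_eulerLog_le hr (hrR.trans hR) w,
      ae_abs_inner_eulerLog_le hs (hsR.trans hR) w] with z hz h1 h2
    have hr3 : 3 * r * ‖w‖ ≤ 3 * R := by nlinarith [norm_nonneg w]
    have hs3 : 3 * s * ‖w‖ ≤ 3 * R := by nlinarith [norm_nonneg w]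
    refine (abs_pow_sub_pow_le_mul (h1.trans hr3) (h2.trans hs3) j).trans ?_
    have hR0 : 0 ≤ R := hr.trans hrR
    gcongr
    rw [← inner_sub_left]
    refine (abs_real_inner_le_norm _ _).trans ?_
    have := norm_eulerLog_sub_le hz.le hr (hrR.trans hR) hs (hsR.trans hR)
    nlinarith [norm_nonneg w, norm_nonneg (eulerLog r z - eulerLog s z)]
  simpa using norm_integral_le_of_norm_le_const h

theorem integrable_eulerLog {r : ℝ} (hr : 0 ≤ r) (hr' : r ≤ 3 / 4) :
    Integrable (eulerLog r) circleUniform :=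
  Integrable.of_bound (measurable_eulerLog r).aestronglyMeasurable _ (ae_norm_eulerLog_le hr hr')

theorem integrable_eulerLog_sq {r : ℝ} (hr : 0 ≤ r) (hr' : r ≤ 3 / 4) :
    Integrable (fun z => eulerLog r z ^ 2) circleUniform := by
  refine Integrable.of_bound ((measurable_eulerLog r).pow_const 2).aestronglyMeasurable
    ((3 * r) ^ 2) ?_
  filter_upwards [ae_norm_eulerLog_le hr hr'] with z hz
  rw [norm_pow]; gcongr

theorem integrable_norm_eulerLog_sq {r : ℝ} (hr : 0 ≤ r) (hr' : r ≤ 3 / 4) :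
    Integrable (fun z => ‖eulerLog r z‖ ^ 2) circleUniform := by
  simpa using (integrable_eulerLog_sq hr hr').norm

theorem eulerMoment_zero (r : ℝ) (w : ℂ) : eulerMoment r w 0 = 1 := by simp [eulerMoment]

theorem eulerMoment_one {r : ℝ} (hr : 0 ≤ r) (hr' : r ≤ 3 / 4) (w : ℂ) :
    eulerMoment r w 1 = 0 := by
  simp only [eulerMoment, pow_one]
  rw [show (fun z => ⟪eulerLog r z, w⟫) = fun z => ⟪w, eulerLog r z⟫ from
    funext fun z => real_inner_comm _ _, integral_inner (integrable_eulerLog hr hr'),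
    integral_eulerLog hr hr', inner_zero_right]

/-- By ⟪Y, w⟫² = |w|²|Y|²/2 + ⟪Y², w²⟫/2, where the last term has mean zero. -/
theorem eulerMoment_two {r : ℝ} (hr : 0 ≤ r) (hr' : r ≤ 3 / 4) (w : ℂ) :
    eulerMoment r w 2 = ‖w‖ ^ 2 * eulerVar r / 2 := by
  have h : ∀ z, ⟪eulerLog r z, w⟫ ^ 2 = (1 / 2) * (‖w‖ ^ 2 * ‖eulerLog r z‖ ^ 2)
      + (1 / 2) * ⟪eulerLog r z ^ 2, w ^ 2⟫ := by
    intro z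
    rw [Complex.sq_norm, Complex.sq_norm]
    simp only [Complex.inner, Complex.normSq_apply, pow_two, Complex.mul_re,
      Complex.conj_re, Complex.conj_im, Complex.mul_im]
    ring
  have hi : Integrable (fun z => ⟪w ^ 2, eulerLog r z ^ 2⟫) circleUniform :=
    (integrable_eulerLog_sq hr hr').const_inner _
  simp only [eulerMoment, h]
  simp only [real_inner_comm (w ^ 2)]
  rw [integral_add (((integrable_norm_eulerLog_sq hr hr').const_mul _).const_mul _)
    (hi.const_mul _), integral_const_mul, integral_const_mul, integral_const_mul,
    integral_inner (integrable_eulerLog_sq hr hr'), integral_eulerLog_sq hr hr', inner_zero_right,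
    ← eulerVar]
  ring

theorem eulerTaylor_zero (r : ℝ) (w : ℂ) : eulerTaylor r w 0 = 1 := by
  simp [eulerTaylor, eulerMoment_zero]

theorem eulerTaylor_one {r : ℝ} (hr : 0 ≤ r) (hr' : r ≤ 3 / 4) (w : ℂ) :
    eulerTaylor r w 1 = 0 := by
  simp [eulerTaylor, eulerMoment_one hr hr']

theorem eulerTaylor_two {r : ℝ} (hr : 0 ≤ r) (hr' : r ≤ 3 / 4) (w : ℂ) :
    eulerTaylor r w 2 = ((-(eulerVar r * ‖w‖ ^ 2 / 4) : ℝ) : ℂ) := by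
  simp only [eulerTaylor, eulerMoment_two hr hr', Complex.I_sq, Nat.factorial]
  push_cast; ring

theorem norm_eulerTaylor_le_abs (r : ℝ) (w : ℂ) (j : ℕ) :
    ‖eulerTaylor r w j‖ ≤ |eulerMoment r w j| := by
  rw [eulerTaylor, norm_div, norm_mul, norm_pow, Complex.norm_I, one_pow, one_mul,
    Complex.norm_real, Real.norm_eq_abs, Complex.norm_natCast]
  exact div_le_self (abs_nonneg _) (by exact_mod_cast Nat.one_le_iff_ne_zero.2 j.factorial_ne_zero)

theorem norm_eulerTaylor_le {r : ℝ} (hr : 0 ≤ r) (hr' : r ≤ 3 / 4) (w : ℂ) (j : ℕ) :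
    ‖eulerTaylor r w j‖ ≤ (3 * r * ‖w‖) ^ j :=
  (norm_eulerTaylor_le_abs r w j).trans (abs_eulerMoment_le hr hr' w j)

theorem norm_eulerTaylor_sub_le {r s R : ℝ} (hr : 0 ≤ r) (hs : 0 ≤ s) (hrR : r ≤ R)
    (hsR : s ≤ R) (hR : R ≤ 3 / 4) {w : ℂ} (hw : ‖w‖ ≤ 1) (j : ℕ) :
    ‖eulerTaylor r w (j + 1) - eulerTaylor s w (j + 1)‖ ≤ (3 * R) ^ j * (4 * |r - s|) := by
  have h := abs_eulerMoment_sub_le hr hs hrR hsR hR hw j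
  have hR0 : 0 ≤ R := hr.trans hrR
  rw [eulerTaylor, eulerTaylor, ← sub_div, ← mul_sub, norm_div, norm_mul, norm_pow,
    Complex.norm_I, one_pow, one_mul, ← Complex.ofReal_sub, Complex.norm_real, Real.norm_eq_abs,
    Complex.norm_natCast, div_le_iff₀ (by exact_mod_cast Nat.factorial_pos _)]
  refine h.trans ?_
  have : ((j : ℝ) + 1) ≤ ((j + 1).factorial : ℝ) := by exact_mod_cast Nat.self_le_factorial _
  calc _ = (3 * R) ^ j * (4 * |r - s|) * ((j : ℝ) + 1) := by ring
    _ ≤ _ := by gcongr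

theorem norm_eulerChar_sub_sum_le {r : ℝ} (hr : 0 ≤ r) (hr' : r ≤ 3 / 4) (w : ℂ) (n : ℕ) :
    ‖eulerChar r w - ∑ j ∈ Finset.range n, eulerTaylor r w j‖
      ≤ (3 * r * ‖w‖) ^ n * Real.exp (3 * r * ‖w‖) := by
  have hexp : Integrable (fun z => Complex.exp (⟪eulerLog r z, w⟫ * Complex.I)) circleUniform := by
    refine Integrable.of_bound (C := 1) ?_ (Eventually.of_forall fun z => ?_)
    · have := measurable_inner_eulerLog r w
      exact Measurable.aestronglyMeasurable (by fun_prop)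
    · rw [Complex.norm_exp_ofReal_mul_I]
  have hpow : ∀ j : ℕ, Integrable (fun z => (⟪eulerLog r z, w⟫ * Complex.I) ^ j / j.factorial)
      circleUniform := by
    intro j
    have : Integrable (fun z => ((⟪eulerLog r z, w⟫ ^ j : ℝ) : ℂ)
        * (Complex.I ^ j / j.factorial)) circleUniform :=
      (integrable_inner_eulerLog_pow hr hr' w j).ofReal.mul_const _
    convert this using 2 with z
    push_cast; ring
  have hsum : ∑ j ∈ Finset.range n, eulerTaylor r w j
      = ∫ z, ∑ j ∈ Finset.range n, (⟪eulerLog r z, w⟫ * Complex.I) ^ j / j.factorial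
        ∂circleUniform := by
    rw [integral_finsetSum _ fun j _ => hpow j]
    refine Finset.sum_congr rfl fun j _ => ?_
    rw [eulerTaylor, eulerMoment, ← integral_complex_ofReal, integral_div]
    congr 1
    rw [← integral_const_mul]
    refine integral_congr_ae (Eventually.of_forall fun z => ?_)
    push_cast; ring
  rw [hsum, eulerChar, ← integral_sub hexp (integrable_finsetSum _ fun j _ => hpow j)]
  have h : ∀ᵐ z ∂circleUniform, ‖Complex.exp (⟪eulerLog r z, w⟫ * Complex.I)
      - ∑ j ∈ Finset.range n, (⟪eulerLog r z, w⟫ * Complex.I) ^ j / j.factorial‖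
      ≤ (3 * r * ‖w‖) ^ n * Real.exp (3 * r * ‖w‖) := by
    filter_upwards [ae_abs_inner_eulerLog_le hr hr' w] with z hz
    refine (Complex.norm_exp_sub_sum_le_norm_mul_exp _ n).trans ?_
    have : ‖(⟪eulerLog r z, w⟫ * Complex.I : ℂ)‖ ≤ 3 * r * ‖w‖ := by
      rwa [norm_mul, Complex.norm_I, mul_one, Complex.norm_real]
    gcongr
  simpa using norm_integral_le_of_norm_le_const h

/-- With x = r|w| the second-order Taylor polynomial is at most 1 - x²/4, and the cubic remainder is
at most 27 · 1.1 · x³. The threshold 1/300 keeps that below x²/8, so half of the quadratic gain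
survives. -/
theorem norm_eulerChar_le_exp {r : ℝ} (hr : 0 ≤ r) (hr' : r ≤ 3 / 4) {w : ℂ}
    (hw : ‖w‖ * r ≤ 1 / 300) : ‖eulerChar r w‖ ≤ Real.exp (-(‖w‖ ^ 2 * r ^ 2 / 8)) := by
  have h := norm_eulerChar_sub_sum_le hr hr' w 3
  simp only [Finset.sum_range_succ, Finset.sum_range_zero, zero_add, eulerTaylor_zero,
    eulerTaylor_one hr hr', eulerTaylor_two hr hr', add_zero] at h
  have hx0 : 0 ≤ ‖w‖ * r := by positivity
  have hV1 : (‖w‖ * r) ^ 2 ≤ eulerVar r * ‖w‖ ^ 2 := by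
    have := sq_le_eulerVar hr hr'
    rw [mul_pow, mul_comm]; gcongr
  have hV2 : eulerVar r * ‖w‖ ^ 2 ≤ 1 := by
    calc eulerVar r * ‖w‖ ^ 2 ≤ 9 * r ^ 2 * ‖w‖ ^ 2 := by gcongr; exact eulerVar_le hr hr'
      _ = 9 * (‖w‖ * r) ^ 2 := by ring
      _ ≤ 9 * (1 / 300) ^ 2 := by gcongr
      _ ≤ 1 := by norm_num
  have hexp : Real.exp (3 * r * ‖w‖) ≤ 1.1 := by
    have h1 : 3 * r * ‖w‖ ≤ 1 / 100 := by linarith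
    have := Real.exp_bound_div_one_sub_of_interval (x := 3 * r * ‖w‖) (by positivity) (by linarith)
    refine this.trans ?_
    rw [div_le_iff₀ (by linarith)]
    linarith
  have herr : (3 * r * ‖w‖) ^ 3 * Real.exp (3 * r * ‖w‖) ≤ (‖w‖ * r) ^ 2 / 8 := by
    calc (3 * r * ‖w‖) ^ 3 * Real.exp (3 * r * ‖w‖)
        ≤ (3 * r * ‖w‖) ^ 3 * 1.1 := by gcongr
      _ = 29.7 * (‖w‖ * r) * (‖w‖ * r) ^ 2 := by ring
      _ ≤ 29.7 * (1 / 300) * (‖w‖ * r) ^ 2 := by gcongr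
      _ ≤ _ := by nlinarith [sq_nonneg (‖w‖ * r)]
  have hmain : ‖(1 : ℂ) + ((-(eulerVar r * ‖w‖ ^ 2 / 4) : ℝ) : ℂ)‖ ≤ 1 - (‖w‖ * r) ^ 2 / 4 := by
    rw [← Complex.ofReal_one, ← Complex.ofReal_add, Complex.norm_real, Real.norm_eq_abs,
      abs_of_nonneg (by linarith)]
    linarith
  calc ‖eulerChar r w‖ ≤ (1 - (‖w‖ * r) ^ 2 / 4) + (‖w‖ * r) ^ 2 / 8 := by
        rw [← sub_add_cancel (eulerChar r w) (1 + ((-(eulerVar r * ‖w‖ ^ 2 / 4) : ℝ) : ℂ)), add_comm]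
        exact (norm_add_le _ _).trans (add_le_add hmain (h.trans herr))
    _ = -(‖w‖ ^ 2 * r ^ 2 / 8) + 1 := by ring
    _ ≤ _ := Real.add_one_le_exp _

theorem norm_eulerChar_le_one (r : ℝ) (w : ℂ) : ‖eulerChar r w‖ ≤ 1 := by
  have h : ∀ᵐ z ∂circleUniform, ‖Complex.exp (⟪eulerLog r z, w⟫ * Complex.I)‖ ≤ 1 :=
    Eventually.of_forall fun z => by rw [Complex.norm_exp_ofReal_mul_I]
  simpa [eulerChar] using norm_integral_le_of_norm_le_const h

/-- The terms of order three to five in the expansion of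
`eulerChar r w * exp (eulerVar r * ‖w‖ ^ 2 / 4)` at `w = 0`. -/
noncomputable def eulerCorrection (r : ℝ) (w : ℂ) : ℂ :=
  eulerTaylor r w 3 + eulerTaylor r w 4 + eulerTaylor r w 5 - eulerTaylor r w 2 ^ 2 / 2
    - eulerTaylor r w 2 * eulerTaylor r w 3

/-- These are the terms of order at least six left over when (1 + m₂ + m₃ + m₄ + m₅ + e₁) is
multiplied by E = 1 - m₂ + m₂²/2 + e₂. Here e₁ and e₂ stand for the Taylor remainders of the
characteristic function and of the inverse Gaussian. -/
theorem norm_expansion_remainder_le {x K₁ K₂ K₃ : ℝ} (hx : 0 ≤ x) (hx3 : x ≤ 3)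
    {m₂ m₃ m₄ m₅ e₁ e₂ E : ℂ} (h2 : ‖m₂‖ ≤ x ^ 2) (h3 : ‖m₃‖ ≤ x ^ 3) (h4 : ‖m₄‖ ≤ x ^ 4)
    (h5 : ‖m₅‖ ≤ x ^ 5) (he1 : ‖e₁‖ ≤ K₁ * x ^ 6) (he2 : ‖e₂‖ ≤ K₂ * x ^ 6) (hE : ‖E‖ ≤ K₃) :
    ‖m₂ ^ 3 / 2 - (m₄ + m₅) * m₂ + (m₃ + m₄ + m₅) * m₂ ^ 2 / 2 + e₁ * E
        + (1 + m₂ + (m₃ + m₄ + m₅)) * e₂‖ ≤ (30 + K₁ * K₃ + 400 * K₂) * x ^ 6 := by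
  have p3 : x ^ 3 ≤ 27 := by calc x ^ 3 ≤ 3 ^ 3 := by gcongr
    _ = 27 := by norm_num
  have p2 : x ^ 2 ≤ 9 := by calc x ^ 2 ≤ 3 ^ 2 := by gcongr
    _ = 9 := by norm_num
  have p4 : x ^ 4 ≤ 81 := by calc x ^ 4 ≤ 3 ^ 4 := by gcongr
    _ = 81 := by norm_num
  have p5 : x ^ 5 ≤ 243 := by calc x ^ 5 ≤ 3 ^ 5 := by gcongr
    _ = 243 := by norm_num
  have x6 : 0 ≤ x ^ 6 := by positivity
  have a1 : ‖m₂ ^ 3 / 2‖ ≤ x ^ 6 := by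
    rw [norm_div, norm_pow, Complex.norm_ofNat]
    calc ‖m₂‖ ^ 3 / 2 ≤ (x ^ 2) ^ 3 / 2 := by gcongr
      _ ≤ x ^ 6 := by rw [← pow_mul]; norm_num; linarith
  have a2 : ‖(m₄ + m₅) * m₂‖ ≤ 4 * x ^ 6 := by
    rw [norm_mul]
    calc ‖m₄ + m₅‖ * ‖m₂‖ ≤ (x ^ 4 + x ^ 5) * x ^ 2 := by
          gcongr; exact (norm_add_le _ _).trans (add_le_add h4 h5)
      _ = (1 + x) * x ^ 6 := by ring
      _ ≤ 4 * x ^ 6 := by gcongr; linarith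
  have hS : ‖m₃ + m₄ + m₅‖ ≤ x ^ 3 + x ^ 4 + x ^ 5 :=
    norm_add₃_le.trans (add_le_add (add_le_add h3 h4) h5)
  have a3 : ‖(m₃ + m₄ + m₅) * m₂ ^ 2 / 2‖ ≤ 20 * x ^ 6 := by
    rw [norm_div, norm_mul, norm_pow, Complex.norm_ofNat]
    calc ‖m₃ + m₄ + m₅‖ * ‖m₂‖ ^ 2 / 2 ≤ (x ^ 3 + x ^ 4 + x ^ 5) * (x ^ 2) ^ 2 / 2 := by gcongr
      _ = (x + x ^ 2 + x ^ 3) / 2 * x ^ 6 := by ring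
      _ ≤ 20 * x ^ 6 := by gcongr; linarith
  have a4 : ‖e₁ * E‖ ≤ K₁ * K₃ * x ^ 6 := by
    rw [norm_mul]
    calc ‖e₁‖ * ‖E‖ ≤ K₁ * x ^ 6 * K₃ := by
          have := norm_nonneg e₁
          gcongr; linarith
      _ = _ := by ring
  have a5 : ‖(1 + m₂ + (m₃ + m₄ + m₅)) * e₂‖ ≤ 400 * K₂ * x ^ 6 := by
    rw [norm_mul]
    have hS' : ‖1 + m₂ + (m₃ + m₄ + m₅)‖ ≤ 400 := by
      have := norm_add₃_le (a := (1 : ℂ)) (b := m₂) (c := m₃ + m₄ + m₅)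
      rw [norm_one] at this
      linarith
    calc ‖1 + m₂ + (m₃ + m₄ + m₅)‖ * ‖e₂‖ ≤ 400 * (K₂ * x ^ 6) := by
          gcongr
      _ = _ := by ring
  have b1 := norm_sub_le (m₂ ^ 3 / 2) ((m₄ + m₅) * m₂)
  have b2 := norm_add_le (m₂ ^ 3 / 2 - (m₄ + m₅) * m₂) ((m₃ + m₄ + m₅) * m₂ ^ 2 / 2)
  have b3 := norm_add_le (m₂ ^ 3 / 2 - (m₄ + m₅) * m₂ + (m₃ + m₄ + m₅) * m₂ ^ 2 / 2) (e₁ * E)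
  have b4 := norm_add_le (m₂ ^ 3 / 2 - (m₄ + m₅) * m₂ + (m₃ + m₄ + m₅) * m₂ ^ 2 / 2 + e₁ * E)
    ((1 + m₂ + (m₃ + m₄ + m₅)) * e₂)
  linarith

theorem exists_norm_eulerChar_mul_exp_sub_le :
    ∃ C : ℝ, 0 ≤ C ∧ ∀ (r : ℝ), 0 ≤ r → r ≤ 3 / 4 → ∀ w : ℂ, ‖w‖ ≤ 1 →
      ‖eulerChar r w * Real.exp (eulerVar r * ‖w‖ ^ 2 / 4) - 1 - eulerCorrection r w‖
        ≤ C * (r ^ 3 * ‖w‖ ^ 6) := by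
  refine ⟨(30 + Real.exp 3 * Real.exp 9 + 400 * Real.exp 9) * 3 ^ 6, by positivity, ?_⟩
  intro r hr hr' w hw
  set x := 3 * r * ‖w‖ with hxdef
  have hx0 : 0 ≤ x := by positivity
  have hx3 : x ≤ 3 := by rw [hxdef]; nlinarith [norm_nonneg w]
  have h2 := norm_eulerTaylor_le hr hr' w 2
  have h2' : ‖eulerTaylor r w 2‖ ≤ 9 := h2.trans (by nlinarith)
  set e₁ := eulerChar r w - ∑ j ∈ Finset.range 6, eulerTaylor r w j with he₁
  have he1 : ‖e₁‖ ≤ Real.exp 3 * x ^ 6 := by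
    refine (norm_eulerChar_sub_sum_le hr hr' w 6).trans ?_
    rw [mul_comm]; gcongr
  set E := Complex.exp (-eulerTaylor r w 2) with hE
  set e₂ := E - ∑ j ∈ Finset.range 3, (-eulerTaylor r w 2) ^ j / j.factorial with he₂
  have he2 : ‖e₂‖ ≤ Real.exp 9 * x ^ 6 := by
    refine (Complex.norm_exp_sub_sum_le_norm_mul_exp _ 3).trans ?_
    rw [norm_neg, mul_comm, show x ^ 6 = (x ^ 2) ^ 3 by ring]; gcongr
  have hEn : ‖E‖ ≤ Real.exp 9 := by
    rw [hE, Complex.norm_exp]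
    gcongr
    exact (Complex.re_le_norm _).trans (by rwa [norm_neg])
  have hEr : ((Real.exp (eulerVar r * ‖w‖ ^ 2 / 4) : ℝ) : ℂ) = E := by
    rw [hE, eulerTaylor_two hr hr']; push_cast; congr 1; ring
  have hE' : E = 1 - eulerTaylor r w 2 + eulerTaylor r w 2 ^ 2 / 2 + e₂ := by
    rw [he₂]
    simp only [Finset.sum_range_succ, Finset.sum_range_zero, Nat.factorial]
    push_cast; ring
  have hφ : eulerChar r w = 1 + eulerTaylor r w 2 + (eulerTaylor r w 3 + eulerTaylor r w 4
      + eulerTaylor r w 5) + e₁ := by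
    rw [he₁]
    simp only [Finset.sum_range_succ, Finset.sum_range_zero, eulerTaylor_zero,
      eulerTaylor_one hr hr']
    ring
  have key := norm_expansion_remainder_le hx0 hx3 h2 (norm_eulerTaylor_le hr hr' w 3)
    (norm_eulerTaylor_le hr hr' w 4) (norm_eulerTaylor_le hr hr' w 5) he1 he2 hEn
  have hid : eulerChar r w * E - 1 - eulerCorrection r w = eulerTaylor r w 2 ^ 3 / 2
      - (eulerTaylor r w 4 + eulerTaylor r w 5) * eulerTaylor r w 2
      + (eulerTaylor r w 3 + eulerTaylor r w 4 + eulerTaylor r w 5) * eulerTaylor r w 2 ^ 2 / 2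
      + e₁ * E + (1 + eulerTaylor r w 2 + (eulerTaylor r w 3 + eulerTaylor r w 4
        + eulerTaylor r w 5)) * e₂ := by
    have : eulerChar r w * E = (1 + eulerTaylor r w 2 + (eulerTaylor r w 3 + eulerTaylor r w 4
      + eulerTaylor r w 5)) * (1 - eulerTaylor r w 2 + eulerTaylor r w 2 ^ 2 / 2 + e₂)
        + e₁ * E := by
      rw [← hE', hφ]; ring
    rw [this, eulerCorrection]
    ring
  rw [hEr, hid]
  refine key.trans ?_
  rw [hxdef, show (3 * r * ‖w‖) ^ 6 = 3 ^ 6 * (r ^ 6 * ‖w‖ ^ 6) by ring, ← mul_assoc]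
  -- The exponent 6 is more than needed: r³ is already summable over primes at σ = 1/2.
  have : r ^ 6 ≤ r ^ 3 := pow_le_pow_of_le_one hr (by linarith) (by norm_num)
  gcongr

theorem norm_eulerCorrection_le {r : ℝ} (hr : 0 ≤ r) (hr' : r ≤ 3 / 4) {w : ℂ} (hw : ‖w‖ ≤ 1) :
    ‖eulerCorrection r w‖ ≤ 729 * (r ^ 3 * ‖w‖ ^ 3) := by
  have hx0 : 0 ≤ 3 * r * ‖w‖ := by positivity
  have hx3 : 3 * r * ‖w‖ ≤ 3 := by nlinarith [norm_nonneg w]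
  have h2 := norm_eulerTaylor_le hr hr' w 2
  have h3 := norm_eulerTaylor_le hr hr' w 3
  have h4 := norm_eulerTaylor_le hr hr' w 4
  have h5 := norm_eulerTaylor_le hr hr' w 5
  have hx : 729 * (r ^ 3 * ‖w‖ ^ 3) = 27 * (3 * r * ‖w‖) ^ 3 := by ring
  rw [hx]
  set x := 3 * r * ‖w‖
  have x3 : 0 ≤ x ^ 3 := by positivity
  have h4' : x ^ 4 ≤ 3 * x ^ 3 := by rw [pow_succ, mul_comm]; gcongr
  have h5' : x ^ 5 ≤ 9 * x ^ 3 := by nlinarith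
  have a1 : ‖eulerTaylor r w 2 ^ 2 / 2‖ ≤ x ^ 4 := by
    rw [norm_div, norm_pow, Complex.norm_ofNat]
    calc ‖eulerTaylor r w 2‖ ^ 2 / 2 ≤ (x ^ 2) ^ 2 / 2 := by gcongr
      _ ≤ x ^ 4 := by rw [← pow_mul]; norm_num; nlinarith [pow_nonneg hx0 4]
  have a2 : ‖eulerTaylor r w 2 * eulerTaylor r w 3‖ ≤ x ^ 5 := by
    rw [norm_mul, show x ^ 5 = x ^ 2 * x ^ 3 by ring]
    gcongr
  have b1 := norm_add₃_le (a := eulerTaylor r w 3) (b := eulerTaylor r w 4)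
    (c := eulerTaylor r w 5)
  have b2 := norm_sub_le (eulerTaylor r w 3 + eulerTaylor r w 4 + eulerTaylor r w 5)
    (eulerTaylor r w 2 ^ 2 / 2)
  have b3 := norm_sub_le (eulerTaylor r w 3 + eulerTaylor r w 4 + eulerTaylor r w 5
    - eulerTaylor r w 2 ^ 2 / 2) (eulerTaylor r w 2 * eulerTaylor r w 3)
  rw [eulerCorrection]
  linarith

theorem norm_mul_sub_mul_le' {a b a' b' : ℂ} {A B da db : ℝ} (ha : ‖a‖ ≤ A) (hb' : ‖b'‖ ≤ B)
    (hda : ‖a - a'‖ ≤ da) (hdb : ‖b - b'‖ ≤ db) : ‖a * b - a' * b'‖ ≤ A * db + da * B := by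
  have h : a * b - a' * b' = a * (b - b') + (a - a') * b' := by ring
  rw [h]
  refine (norm_add_le _ _).trans ?_
  rw [norm_mul, norm_mul]
  have := norm_nonneg (a - a')
  have := norm_nonneg a
  gcongr <;> linarith

/-- Lipschitz dependence on the radius, used to move the corrections from σ to 1/2 so that the
limiting polynomial is independent of σ. The factor R² is needed for summability over primes. -/
theorem norm_eulerCorrection_sub_le {r s R : ℝ} (hr : 0 ≤ r) (hs : 0 ≤ s) (hrR : r ≤ R)
    (hsR : s ≤ R) (hR : R ≤ 3 / 4) {w : ℂ} (hw : ‖w‖ ≤ 1) :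
    ‖eulerCorrection r w - eulerCorrection s w‖ ≤ 2000 * (R ^ 2 * |r - s|) := by
  have hR0 : 0 ≤ R := hr.trans hrR
  have d2 := norm_eulerTaylor_sub_le hr hs hrR hsR hR hw 1
  have d3 := norm_eulerTaylor_sub_le hr hs hrR hsR hR hw 2
  have d4 := norm_eulerTaylor_sub_le hr hs hrR hsR hR hw 3
  have d5 := norm_eulerTaylor_sub_le hr hs hrR hsR hR hw 4
  simp only [Nat.reduceAdd] at d2 d3 d4 d5
  have hb : ∀ t : ℝ, 0 ≤ t → t ≤ R → ∀ j, ‖eulerTaylor t w j‖ ≤ (3 * R) ^ j := by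
    intro t ht htR j
    refine (norm_eulerTaylor_le ht (htR.trans hR) w j).trans ?_
    have : 3 * t * ‖w‖ ≤ 3 * R := by nlinarith [norm_nonneg w]
    gcongr
  have e1 := norm_mul_sub_mul_le' (hb r hr hrR 2) (hb s hs hsR 2) d2 d2
  have e2 := norm_mul_sub_mul_le' (hb r hr hrR 2) (hb s hs hsR 3) d2 d3
  set D := 4 * |r - s| with hD
  have hD0 : 0 ≤ D := by positivity
  have hx : 2000 * (R ^ 2 * |r - s|) = (500 / 9) * ((3 * R) ^ 2 * D) := by rw [hD]; ring
  rw [hx]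
  have hM0 : 0 ≤ 3 * R := by positivity
  have hM3 : 3 * R ≤ 3 := by linarith
  set M := 3 * R
  have q : 0 ≤ M ^ 2 * D := by positivity
  have q3 : M ^ 3 * D ≤ 3 * (M ^ 2 * D) := by
    rw [show M ^ 3 * D = M * (M ^ 2 * D) by ring]; gcongr
  have q4 : M ^ 4 * D ≤ 9 * (M ^ 2 * D) := by
    rw [show M ^ 4 * D = M * (M ^ 3 * D) by ring]; nlinarith
  have hid : eulerCorrection r w - eulerCorrection s w
      = (eulerTaylor r w 3 - eulerTaylor s w 3) + (eulerTaylor r w 4 - eulerTaylor s w 4)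
        + (eulerTaylor r w 5 - eulerTaylor s w 5)
        - (eulerTaylor r w 2 * eulerTaylor r w 2 - eulerTaylor s w 2 * eulerTaylor s w 2) / 2
        - (eulerTaylor r w 2 * eulerTaylor r w 3 - eulerTaylor s w 2 * eulerTaylor s w 3) := by
    simp only [eulerCorrection]; ring
  rw [hid]
  refine (norm_sub_le _ _).trans ?_
  have n1 := norm_sub_le ((eulerTaylor r w 3 - eulerTaylor s w 3)
    + (eulerTaylor r w 4 - eulerTaylor s w 4) + (eulerTaylor r w 5 - eulerTaylor s w 5))
    ((eulerTaylor r w 2 * eulerTaylor r w 2 - eulerTaylor s w 2 * eulerTaylor s w 2) / 2)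
  rw [norm_div, Complex.norm_ofNat] at n1
  have n2 := norm_add₃_le (a := eulerTaylor r w 3 - eulerTaylor s w 3)
    (b := eulerTaylor r w 4 - eulerTaylor s w 4) (c := eulerTaylor r w 5 - eulerTaylor s w 5)
  have e1' : M ^ 2 * (M ^ 1 * D) + M ^ 1 * D * M ^ 2 = 2 * (M ^ 3 * D) := by ring
  have e2' : M ^ 2 * (M ^ 2 * D) + M ^ 1 * D * M ^ 3 = 2 * (M ^ 4 * D) := by ring
  rw [e1'] at e1
  rw [e2'] at e2
  linarith

/-! ### Densities from integrable characteristic functions -/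

section Density

open scoped FourierTransform

variable {V : Type*} [NormedAddCommGroup V] [InnerProductSpace ℝ V] [MeasurableSpace V]

/-- The Fourier transform of a measure, with the normalisation of `𝓕`. -/
noncomputable def fourierMeasure (μ : Measure V) : V → ℂ :=
  VectorFourier.fourierIntegral Real.fourierChar μ (innerₗ V) 1

theorem fourierMeasure_eq_charFun (μ : Measure V) (v : V) :
    fourierMeasure μ v = charFun μ ((-(2 * Real.pi)) • v) := by
  rw [charFun_eq_fourierIntegral', fourierMeasure, smul_smul]
  congr 1
  rw [neg_mul_neg, inv_mul_cancel₀ (by positivity), one_smul]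

theorem charFun_eq_fourierMeasure (μ : Measure V) (v : V) :
    charFun μ v = fourierMeasure μ ((-(2 * Real.pi)⁻¹) • v) := by
  rw [charFun_eq_fourierIntegral', fourierMeasure]

theorem norm_fourierMeasure_le_one {μ : Measure V} [IsProbabilityMeasure μ] (v : V) : ‖fourierMeasure μ v‖ ≤ 1 := by
  rw [fourierMeasure_eq_charFun]
  exact norm_charFun_le_one _

variable [BorelSpace V] [FiniteDimensional ℝ V]

theorem integrable_rexp_neg_mul_sq_norm {b : ℝ} (hb : 0 < b) :
    Integrable fun v : V => Real.exp (-b * ‖v‖ ^ 2) := by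
  have := GaussianFourier.integrable_cexp_neg_mul_sq_norm_add (V := V) (b := (b : ℂ))
    (by simpa) 0 0
  refine this.norm.congr (Eventually.of_forall fun z => ?_)
  simp only [Complex.norm_exp]
  congr 1
  norm_cast
  simp

theorem integrable_pow_mul_norm_fourierMeasure {μ : Measure V} {n : ℕ}
    (h : Integrable fun w => ‖w‖ ^ n * ‖charFun μ w‖) :
    Integrable fun v => ‖v‖ ^ n * ‖fourierMeasure μ v‖ := by
  have h1 := (h.comp_smul (R := -(2 * Real.pi)) (by simp [Real.pi_ne_zero])).const_mul
    (((2 * Real.pi) ^ n)⁻¹)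
  refine h1.congr (Eventually.of_forall fun v => ?_)
  simp only [← fourierMeasure_eq_charFun, norm_smul, norm_neg, mul_pow]
  rw [Real.norm_of_nonneg (by positivity), ← mul_pow]
  field_simp

variable {μ : Measure V} [IsProbabilityMeasure μ]

theorem continuous_fourierMeasure : Continuous (fourierMeasure μ) := by
  simp_rw [funext (fourierMeasure_eq_charFun μ)]
  have := continuous_charFun (μ := μ)
  fun_prop

/-- The multiplication formula moves the Fourier transform from μ to the Gaussian. The right side is
μ convolved with a Gaussian, visibly nonnegative. -/
theorem integral_cexp_smul_fourierMeasure {c : ℝ} (hc : 0 < c) (z : V) :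
    ∫ v, Complex.exp (-(c⁻¹ : ℝ) * ‖v‖ ^ 2 + 2 * Real.pi * Complex.I * ⟪z, v⟫)
      * fourierMeasure μ v
      = ((∫ x, (Real.pi * c) ^ (Module.finrank ℝ V / 2 : ℝ)
        * Real.exp (-Real.pi ^ 2 * c * ‖z - x‖ ^ 2) ∂μ : ℝ) : ℂ) := by
  have J : Integrable (fun v : V =>
      Complex.exp (-(c⁻¹ : ℝ) * ‖v‖ ^ 2 + 2 * Real.pi * Complex.I * ⟪z, v⟫)) :=
    GaussianFourier.integrable_cexp_neg_mul_sq_norm_add (by simpa) _ _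
  have h := VectorFourier.integral_fourierIntegral_smul_eq_flip (L := innerₗ V)
    (μ := μ) (ν := volume) (f := fun _ => 1)
    Real.continuous_fourierChar continuous_inner (integrable_const _) J
  have h2 : ∫ v, Complex.exp (-(c⁻¹ : ℝ) * ‖v‖ ^ 2 + 2 * Real.pi * Complex.I * ⟪z, v⟫)
      * fourierMeasure μ v = ∫ x, 𝓕 (fun v : V =>
        Complex.exp (-(c⁻¹ : ℝ) * ‖v‖ ^ 2 + 2 * Real.pi * Complex.I * ⟪z, v⟫)) x ∂μ := by
    simp only [smul_eq_mul, one_mul, flip_innerₗ] at h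
    refine Eq.trans ?_ h
    exact integral_congr_ae (Eventually.of_forall fun v => mul_comm _ _)
  rw [h2, ← integral_complex_ofReal]
  refine integral_congr_ae (Eventually.of_forall fun x => ?_)
  simp only
  rw [fourier_gaussian_innerProductSpace' (by simpa)]
  push_cast
  rw [Complex.ofReal_cpow (by positivity)]
  push_cast
  congr 2 <;> field_simp

/-- The inverse transform is the limit, as c → ∞, of the nonnegative Gaussian smoothings of μ. -/
theorem fourierInv_fourierMeasure_eq_ofReal_nonneg (hint : Integrable (fourierMeasure μ)) (z : V) :
    (𝓕⁻ (fourierMeasure μ) z).im = 0 ∧ 0 ≤ (𝓕⁻ (fourierMeasure μ) z).re := by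
  have A : Tendsto (fun c : ℝ => ((∫ x, (Real.pi * c) ^ (Module.finrank ℝ V / 2 : ℝ)
        * Real.exp (-Real.pi ^ 2 * c * ‖z - x‖ ^ 2) ∂μ : ℝ) : ℂ)) atTop
      (𝓝 (𝓕⁻ (fourierMeasure μ) z)) := by
    have hB : Integrable (fun w => Real.fourierChar ⟪w, z⟫ • fourierMeasure μ w) := by
      refine hint.norm.mono' ?_ (Eventually.of_forall fun w => ?_)
      · have := continuous_fourierMeasure (μ := μ)
        have h2 : Continuous fun w : V => (Real.fourierChar ⟪w, z⟫ : Circle) :=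
          Real.continuous_fourierChar.comp (by fun_prop)
        exact (h2.smul this).aestronglyMeasurable
      · rw [Circle.norm_smul]
    rw [Real.fourierInv_eq]
    refine (Real.tendsto_integral_cexp_sq_smul hB).congr' ?_
    filter_upwards [Ioi_mem_atTop 0] with c (hc : 0 < c)
    rw [← integral_cexp_smul_fourierMeasure hc]
    refine integral_congr_ae (Eventually.of_forall fun w => ?_)
    simp only
    rw [Circle.smul_def, Real.fourierChar_apply, smul_smul, ← Complex.exp_add, real_inner_comm,
      smul_eq_mul]
    congr 2
    push_cast
    ring
  refine ⟨?_, ?_⟩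
  · refine tendsto_nhds_unique (Complex.continuous_im.continuousAt.tendsto.comp A) ?_
    simp only [Function.comp_def, Complex.ofReal_im]
    exact tendsto_const_nhds
  · refine ge_of_tendsto (Complex.continuous_re.continuousAt.tendsto.comp A) ?_
    filter_upwards [Ioi_mem_atTop 0] with c (hc : 0 < c)
    simp only [Function.comp_def, Complex.ofReal_re]
    exact integral_nonneg fun x => by positivity

/-- After the multiplication formula, a Gaussian of total mass one is integrated against a transform
bounded by one. -/
theorem integral_gaussian_mul_fourier_le_one (hint : Integrable (fourierMeasure μ)) {c : ℝ}
    (hc : 0 < c) :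
    ‖∫ z, 𝓕 (fourierMeasure μ) z * Complex.exp (-(c⁻¹ : ℝ) * ‖z‖ ^ 2)‖ ≤ 1 := by
  have J : Integrable (fun v : V => Complex.exp (-(c⁻¹ : ℝ) * ‖v‖ ^ 2)) := by
    simpa using GaussianFourier.integrable_cexp_neg_mul_sq_norm_add (V := V) (b := (c⁻¹ : ℝ))
      (by simpa) 0 0
  have h : ∫ z, 𝓕 (fourierMeasure μ) z * Complex.exp (-(c⁻¹ : ℝ) * ‖z‖ ^ 2)
      = ∫ z, fourierMeasure μ z * 𝓕 (fun v : V => Complex.exp (-(c⁻¹ : ℝ) * ‖v‖ ^ 2)) z := by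
    have := VectorFourier.integral_fourierIntegral_smul_eq_flip (L := innerₗ V)
      (μ := volume) (ν := volume) Real.continuous_fourierChar continuous_inner hint J
    simp only [smul_eq_mul, flip_innerₗ] at this
    exact this
  have hγ : ∀ z : V, 𝓕 (fun v : V => Complex.exp (-(c⁻¹ : ℝ) * ‖v‖ ^ 2)) z
      = (((Real.pi * c) ^ (Module.finrank ℝ V / 2 : ℝ)
        * Real.exp (-(Real.pi ^ 2 * c) * ‖z‖ ^ 2) : ℝ) : ℂ) := by
    intro z
    rw [fourier_gaussian_innerProductSpace (by simpa)]
    push_cast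
    rw [Complex.ofReal_cpow (by positivity)]
    push_cast
    congr 2 <;> field_simp
  have hgi : Integrable fun z : V => (Real.pi * c) ^ (Module.finrank ℝ V / 2 : ℝ)
      * Real.exp (-(Real.pi ^ 2 * c) * ‖z‖ ^ 2) :=
    (integrable_rexp_neg_mul_sq_norm (by positivity)).const_mul _
  rw [h]
  calc _ ≤ ∫ z : V, (Real.pi * c) ^ (Module.finrank ℝ V / 2 : ℝ)
        * Real.exp (-(Real.pi ^ 2 * c) * ‖z‖ ^ 2) := by
        refine norm_integral_le_of_norm_le hgi (Eventually.of_forall fun z => ?_)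
        rw [hγ, norm_mul, Complex.norm_real, Real.norm_of_nonneg (by positivity)]
        exact mul_le_of_le_one_left (by positivity) (norm_fourierMeasure_le_one z)
    _ = 1 := by
        rw [integral_const_mul, GaussianFourier.integral_rexp_neg_mul_sq_norm (by positivity),
          ← Real.mul_rpow (by positivity) (by positivity)]
        rw [show Real.pi * c * (Real.pi / (Real.pi ^ 2 * c)) = 1 by field_simp, Real.one_rpow]

theorem fourier_eq_fourierInv_neg' (f : V → ℂ) (z : V) : 𝓕 f z = 𝓕⁻ f (-z) := by
  rw [Real.fourierInv_eq_fourier_neg, neg_neg]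

/-- The transform is nonnegative, and the Gaussian exp(-|z|²/R²) is at least 1/e on the ball of
radius R. The preceding bound therefore controls the integral over every ball by e. -/
theorem integrable_fourier_fourierMeasure (hint : Integrable (fourierMeasure μ)) :
    Integrable (𝓕 (fourierMeasure μ)) := by
  have hcont : Continuous (𝓕 (fourierMeasure μ)) :=
    VectorFourier.fourierIntegral_continuous Real.continuous_fourierChar continuous_inner hint
  have hre : ∀ z, 𝓕 (fourierMeasure μ) z = (((𝓕 (fourierMeasure μ) z).re : ℝ) : ℂ)
      ∧ 0 ≤ (𝓕 (fourierMeasure μ) z).re := by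
    intro z
    have := fourierInv_fourierMeasure_eq_ofReal_nonneg hint (-z)
    rw [← fourier_eq_fourierInv_neg'] at this
    exact ⟨Complex.ext (by simp) (by simp [this.1]), this.2⟩
  refine (aecover_closedBall (x := (0 : V)) (l := atTop) tendsto_id).integrable_of_integral_norm_bounded
    (Real.exp 1) (fun R : ℝ => hcont.continuousOn.integrableOn_compact
      (isCompact_closedBall _ _)) ?_
  filter_upwards [Ioi_mem_atTop 0] with R (hR : 0 < R)
  set h := fun z => (𝓕 (fourierMeasure μ) z).re with hh
  have hhc : Continuous h := Complex.continuous_re.comp hcont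
  have h0 : ∀ z, 0 ≤ h z := fun z => (hre z).2
  have hc : 0 < R ^ 2 := by positivity
  have hbd : ∃ B, ∀ z, ‖𝓕 (fourierMeasure μ) z‖ ≤ B :=
    ⟨_, fun z => VectorFourier.norm_fourierIntegral_le_integral_norm _ _ _ _ z⟩
  obtain ⟨B, hB⟩ := hbd
  have J : Integrable (fun v : V => Real.exp (-((R ^ 2)⁻¹) * ‖v‖ ^ 2)) :=
    integrable_rexp_neg_mul_sq_norm (by positivity)
  have hJ : Integrable (fun v : V => h v * Real.exp (-((R ^ 2)⁻¹) * ‖v‖ ^ 2)) := by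
    refine J.bdd_mul hhc.aestronglyMeasurable (c := B) (Eventually.of_forall fun z => ?_)
    exact (Complex.abs_re_le_norm _).trans (hB z)
  have key := integral_gaussian_mul_fourier_le_one hint hc
  have hkey : ∫ v : V, h v * Real.exp (-((R ^ 2)⁻¹) * ‖v‖ ^ 2) ≤ 1 := by
    refine le_trans ?_ key
    have : ∫ z, 𝓕 (fourierMeasure μ) z * Complex.exp (-(((R ^ 2)⁻¹ : ℝ) : ℂ) * ‖z‖ ^ 2)
        = ((∫ v : V, h v * Real.exp (-((R ^ 2)⁻¹) * ‖v‖ ^ 2) : ℝ) : ℂ) := by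
      rw [← integral_complex_ofReal]
      refine integral_congr_ae (Eventually.of_forall fun z => ?_)
      simp only
      rw [(hre z).1]
      push_cast
      rfl
    rw [this, Complex.norm_real]
    exact Real.le_norm_self _
  calc ∫ z in Metric.closedBall 0 (id R), ‖𝓕 (fourierMeasure μ) z‖
      ≤ ∫ z in Metric.closedBall 0 (id R), Real.exp 1 *
          (h z * Real.exp (-((R ^ 2)⁻¹) * ‖z‖ ^ 2)) := by
        refine setIntegral_mono_on ?_ (hJ.const_mul _).integrableOn
          Metric.isClosed_closedBall.measurableSet fun z hz => ?_
        · exact hcont.norm.continuousOn.integrableOn_compact (isCompact_closedBall _ _)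
        · rw [(hre z).1, Complex.norm_real, Real.norm_of_nonneg (hre z).2, mul_left_comm,
            ← Real.exp_add]
          refine le_mul_of_one_le_right (h0 z) (Real.one_le_exp ?_)
          rw [mem_closedBall_zero_iff, id] at hz
          have : (R ^ 2)⁻¹ * ‖z‖ ^ 2 ≤ 1 := by
            rw [inv_mul_le_iff₀ hc, mul_one]; gcongr
          linarith
    _ ≤ ∫ z, Real.exp 1 * (h z * Real.exp (-((R ^ 2)⁻¹) * ‖z‖ ^ 2)) :=
        setIntegral_le_integral (hJ.const_mul _) (Eventually.of_forall fun z =>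
          mul_nonneg (Real.exp_pos _).le (mul_nonneg (h0 z) (Real.exp_pos _).le))
    _ ≤ Real.exp 1 := by
        rw [integral_const_mul]
        exact mul_le_of_le_one_right (Real.exp_pos _).le hkey

theorem fourierInv_fourierMeasure_eq_integral_charFun (μ : Measure V) (z : V) :
    𝓕⁻ (fourierMeasure μ) z = ((((2 * Real.pi) ^ Module.finrank ℝ V)⁻¹ : ℝ) : ℂ) *
      ∫ w, charFun μ w * Complex.exp (-(⟪w, z⟫ * Complex.I)) := by
  have h := Measure.integral_comp_smul (volume : Measure V)
    (fun w => charFun μ w * Complex.exp (-(⟪w, z⟫ * Complex.I))) (-(2 * Real.pi))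
  have habs : |((-(2 * Real.pi)) ^ Module.finrank ℝ V)⁻¹|
      = ((2 * Real.pi) ^ Module.finrank ℝ V)⁻¹ := by
    rw [abs_inv, abs_pow, abs_neg, abs_of_pos (by positivity)]
  rw [habs, Complex.real_smul] at h
  rw [← h, Real.fourierInv_eq']
  refine integral_congr_ae (Eventually.of_forall fun w => ?_)
  simp only
  rw [← fourierMeasure_eq_charFun, smul_eq_mul, mul_comm]
  congr 2
  rw [real_inner_smul_left]
  push_cast
  ring

/-- A probability measure whose characteristic function is rapidly decreasing has a smooth
density, given by Fourier inversion. -/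
theorem exists_contDiff_density (hint : ∀ n : ℕ, Integrable fun w => ‖w‖ ^ n * ‖charFun μ w‖) :
    ∃ f : V → ℝ, ContDiff ℝ ∞ f ∧ (∀ z, 0 ≤ f z) ∧ Integrable f ∧
      (∀ B, MeasurableSet B → μ.real B = ∫ z in B, f z) ∧
      ∀ z, (f z : ℂ) = ((((2 * Real.pi) ^ Module.finrank ℝ V)⁻¹ : ℝ) : ℂ) *
        ∫ w, charFun μ w * Complex.exp (-(⟪w, z⟫ * Complex.I)) := by
  have hint' := fun n => integrable_pow_mul_norm_fourierMeasure (hint n)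
  have hG : Integrable (fourierMeasure μ) := by
    have h0 := hint' 0
    simp only [pow_zero, one_mul] at h0
    exact (integrable_norm_iff continuous_fourierMeasure.aestronglyMeasurable).1 h0
  set f : V → ℝ := fun z => (𝓕⁻ (fourierMeasure μ) z).re with hf
  have hfc : ∀ z, (f z : ℂ) = 𝓕⁻ (fourierMeasure μ) z := fun z =>
    Complex.ext (by simp [hf])
      (by simp [(fourierInv_fourierMeasure_eq_ofReal_nonneg hG z).1])
  have hf0 : ∀ z, 0 ≤ f z := fun z => (fourierInv_fourierMeasure_eq_ofReal_nonneg hG z).2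
  have hfint : Integrable f := by
    have h1 := (integrable_fourier_fourierMeasure hG).comp_neg.re
    refine h1.congr (Eventually.of_forall fun z => ?_)
    simp only [hf]
    rw [fourier_eq_fourierInv_neg', neg_neg]
    rfl
  refine ⟨f, ?_, hf0, hfint, ?_, fun z => ?_⟩
  · have h1 : ContDiff ℝ ∞ (𝓕 (fourierMeasure μ)) :=
      Real.contDiff_fourier (N := ⊤) fun n _ => hint' n
    have h2 : f = fun z => (𝓕 (fourierMeasure μ) (-z)).re := by
      funext z
      rw [fourier_eq_fourierInv_neg', neg_neg]
    rw [h2]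
    exact Complex.reCLM.contDiff.comp (h1.comp contDiff_neg)
  -- By Fourier inversion, the measure with density f has the same transform as μ, so it is μ.
  · set ν := (volume : Measure V).withDensity fun z => ENNReal.ofReal (f z) with hν
    have : IsFiniteMeasure ν := isFiniteMeasure_withDensity_ofReal hfint.2
    have hinv : 𝓕 (𝓕⁻ (fourierMeasure μ)) = fourierMeasure μ :=
      continuous_fourierMeasure.fourier_fourierInv_eq hG (integrable_fourier_fourierMeasure hG)
    have hFν : fourierMeasure ν = fourierMeasure μ := by
      rw [← hinv]
      funext ξ
      rw [Real.fourier_eq, fourierMeasure, VectorFourier.fourierIntegral, hν,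
        integral_withDensity_eq_integral_toReal_smul₀ (by fun_prop)
          (Eventually.of_forall fun _ => ENNReal.ofReal_lt_top)]
      refine integral_congr_ae (Eventually.of_forall fun x => ?_)
      simp only [ENNReal.toReal_ofReal (hf0 x), Pi.one_apply, innerₗ_apply_apply, ← hfc]
      rw [Complex.real_smul, Circle.smul_def, Circle.smul_def, smul_eq_mul, smul_eq_mul]
      ring
    have hμν : μ = ν := Measure.ext_of_charFun (by
      funext t
      rw [charFun_eq_fourierMeasure, charFun_eq_fourierMeasure, hFν])
    intro B hB
    rw [integral_eq_lintegral_of_nonneg_ae (Eventually.of_forall hf0)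
      hfint.aestronglyMeasurable.restrict, Measure.real, hμν, hν, withDensity_apply _ hB]
  · rw [hfc, fourierInv_fourierMeasure_eq_integral_charFun]

end Density

/-! ### Sums over primes -/

theorem mem_primesUpTo {N : ℕ} {p : Nat.Primes} : p ∈ primesUpTo N ↔ (p : ℕ) ≤ N :=
  Finset.mem_subtype.trans (by rw [Finset.mem_range, Nat.lt_succ_iff])

theorem card_primesUpTo (N : ℕ) : (primesUpTo N).card = Nat.primeCounting N := by
  rw [Nat.primeCounting, Nat.primeCounting', Nat.count_eq_card_filter_range]
  exact Finset.card_subtype _ _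

theorem tendsto_primesUpTo : Tendsto primesUpTo atTop atTop := by
  refine tendsto_atTop_finset_of_monotone (fun a b hab p hp => ?_) fun p => ⟨p, ?_⟩
  · exact mem_primesUpTo.2 ((mem_primesUpTo.1 hp).trans hab)
  · exact mem_primesUpTo.2 le_rfl

/-- The radius `p ^ (-σ)`. -/
noncomputable def primeRadius (σ : ℝ) (p : Nat.Primes) : ℝ := ((p : ℕ) : ℝ) ^ (-σ)

theorem two_le_prime (p : Nat.Primes) : (2 : ℝ) ≤ ((p : ℕ) : ℝ) := by
  exact_mod_cast p.2.two_le

theorem primeRadius_pos (σ : ℝ) (p : Nat.Primes) : 0 < primeRadius σ p :=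
  Real.rpow_pos_of_pos (by linarith [two_le_prime p]) _

theorem primeRadius_anti {σ τ : ℝ} (h : σ ≤ τ) (p : Nat.Primes) :
    primeRadius τ p ≤ primeRadius σ p :=
  Real.rpow_le_rpow_of_exponent_le (by linarith [two_le_prime p]) (by linarith)

theorem primeRadius_pow (σ : ℝ) (p : Nat.Primes) (n : ℕ) :
    primeRadius σ p ^ n = ((p : ℕ) : ℝ) ^ (-(n * σ)) := by
  rw [primeRadius, ← Real.rpow_natCast, ← Real.rpow_mul (by positivity)]
  congr 1; ring

theorem primeRadius_le {σ : ℝ} (hσ : 1 / 2 ≤ σ) (p : Nat.Primes) : primeRadius σ p ≤ 3 / 4 := by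
  have h1 : primeRadius σ p ^ 2 ≤ 1 / 2 := by
    rw [primeRadius_pow]
    calc ((p : ℕ) : ℝ) ^ (-((2 : ℕ) * σ)) ≤ ((p : ℕ) : ℝ) ^ (-1 : ℝ) := by
          apply Real.rpow_le_rpow_of_exponent_le (by linarith [two_le_prime p])
          push_cast; linarith
      _ ≤ 1 / 2 := by
          rw [Real.rpow_neg_one, one_div]
          exact inv_anti₀ (by norm_num) (two_le_prime p)
  nlinarith [primeRadius_pos σ p]

theorem summable_primeRadius_pow {σ : ℝ} {n : ℕ} (h : 1 < n * σ) :
    Summable fun p => primeRadius σ p ^ n := by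
  simp_rw [primeRadius_pow]
  exact Nat.Primes.summable_rpow.2 (by linarith)

/-- From 1 - p^{-(σ-1/2)} ≤ (σ - 1/2) log p and log p ≤ 4 p^{1/4}. The three radii contribute
p^{-3/2}, so the exponent -5/4 remains, which is summable. -/
theorem primeRadius_half_sub_le {σ : ℝ} (hσ : 1 / 2 ≤ σ) (p : Nat.Primes) :
    primeRadius (1 / 2) p ^ 2 * |primeRadius σ p - primeRadius (1 / 2) p|
      ≤ 4 * (σ - 1 / 2) * ((p : ℕ) : ℝ) ^ (-(5 / 4) : ℝ) := by
  have hp := two_le_prime p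
  have hp0 : (0 : ℝ) < ((p : ℕ) : ℝ) := by linarith
  have h1 : primeRadius σ p = primeRadius (1 / 2) p * ((p : ℕ) : ℝ) ^ (-(σ - 1 / 2)) := by
    rw [primeRadius, primeRadius, ← Real.rpow_add hp0]; congr 1; ring
  have h2 : 1 - ((p : ℕ) : ℝ) ^ (-(σ - 1 / 2)) ≤ (σ - 1 / 2) * Real.log (p : ℕ) := by
    rw [Real.rpow_def_of_pos hp0]
    linarith [Real.add_one_le_exp (Real.log (p : ℕ) * -(σ - 1 / 2))]
  have h3 : Real.log (p : ℕ) ≤ 4 * ((p : ℕ) : ℝ) ^ (1 / 4 : ℝ) := by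
    have := Real.log_le_rpow_div hp0.le (show (0 : ℝ) < 1 / 4 by norm_num)
    linarith
  have h4 : primeRadius (1 / 2) p ^ 3 * ((p : ℕ) : ℝ) ^ (1 / 4 : ℝ)
      = ((p : ℕ) : ℝ) ^ (-(5 / 4) : ℝ) := by
    rw [primeRadius_pow, ← Real.rpow_add hp0]; norm_num
  have h5 : ((p : ℕ) : ℝ) ^ (-(σ - 1 / 2)) ≤ 1 :=
    Real.rpow_le_one_of_one_le_of_nonpos (by linarith) (by linarith)
  have h6 := primeRadius_pos (1 / 2) p
  rw [h1, abs_sub_comm, ← mul_one_sub, abs_of_nonneg (mul_nonneg h6.le (by linarith)), ← h4]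
  calc _ = primeRadius (1 / 2) p ^ 3 * (1 - ((p : ℕ) : ℝ) ^ (-(σ - 1 / 2))) := by ring
    _ ≤ primeRadius (1 / 2) p ^ 3 * ((σ - 1 / 2) * (4 * ((p : ℕ) : ℝ) ^ (1 / 4 : ℝ))) := by
        gcongr
        refine h2.trans ?_
        have : 0 ≤ σ - 1 / 2 := by linarith
        gcongr
    _ = _ := by ring

theorem hasSum_psiTerm {σ : ℝ} (hσ : 1 / 2 ≤ σ) (p : Nat.Primes) :
    HasSum (fun k : ℕ+ => psiTerm σ (p, k)) (eulerVar (primeRadius σ p)) := by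
  have h := hasSum_eulerVar (primeRadius_pos σ p).le (primeRadius_le hσ p)
  rw [← PNat.coe_injective.hasSum_iff] at h
  · refine h.congr_fun fun k => ?_
    rw [psiTerm, Function.comp_apply, div_pow, ← pow_mul, primeRadius_pow, Real.rpow_neg (by positivity)]
    rw [one_div, mul_inv, div_eq_mul_inv, mul_comm]
    congr 3
    push_cast; ring
  -- Only the index 0 lies outside the positive integers, and its term is zero because division by
  -- zero gives 0.
  · intro n hn
    rcases Nat.eq_zero_or_pos n with rfl | hn'
    · simp
    · exact absurd ⟨⟨n, hn'⟩, rfl⟩ hn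

theorem summable_eulerVar {σ : ℝ} (hσ : 1 / 2 < σ) :
    Summable fun p => eulerVar (primeRadius σ p) :=
  Summable.of_nonneg_of_le (fun p => eulerVar_nonneg _)
    (fun p => eulerVar_le (primeRadius_pos σ p).le (primeRadius_le hσ.le p))
    ((summable_primeRadius_pow (n := 2) (by push_cast; linarith)).mul_left 9)

theorem summable_psiTerm {σ : ℝ} (hσ : 1 / 2 < σ) : Summable (psiTerm σ) := by
  rw [summable_prod_of_nonneg (fun q => by simp only [psiTerm, Pi.zero_apply]; positivity)]
  refine ⟨fun p => (hasSum_psiTerm hσ.le p).summable, ?_⟩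
  simp_rw [fun p => (hasSum_psiTerm hσ.le p).tsum_eq]
  exact summable_eulerVar hσ

theorem hasSum_eulerVar_psi {σ : ℝ} (hσ : 1 / 2 < σ) :
    HasSum (fun p => eulerVar (primeRadius σ p)) (psi σ) :=
  (summable_psiTerm hσ).hasSum.prod_fiberwise fun p => hasSum_psiTerm hσ.le p

theorem one_fourth_le_psi {σ : ℝ} (hσ : 1 / 2 < σ) (hσ' : σ ≤ 3 / 4) : 1 / 4 ≤ psi σ := by
  obtain ⟨p, hp⟩ : ∃ p : Nat.Primes, (p : ℕ) = 2 := ⟨⟨2, Nat.prime_two⟩, rfl⟩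
  have h1 := (hasSum_eulerVar_psi hσ).summable.le_tsum p
    (fun p _ => eulerVar_nonneg _)
  rw [(hasSum_eulerVar_psi hσ).tsum_eq] at h1
  refine le_trans ?_ ((sq_le_eulerVar (primeRadius_pos σ _).le (primeRadius_le hσ.le _)).trans h1)
  rw [primeRadius_pow, hp]
  calc (1 / 4 : ℝ) = (2 : ℝ) ^ (-2 : ℝ) := by
        rw [Real.rpow_neg (by norm_num)]; norm_num
    _ ≤ _ := by
        push_cast
        exact Real.rpow_le_rpow_of_exponent_le (by norm_num) (by linarith)

theorem neg_log_one_sub_le {q : ℝ} (hq : 0 ≤ q) (hq' : q ≤ 3 / 4) :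
    -Real.log (1 - q) ≤ q + 4 * q ^ 2 := by
  have h := Real.abs_log_sub_add_sum_range_le (x := q) (by rw [abs_of_nonneg hq]; linarith) 1
  rw [abs_of_nonneg hq] at h
  have h1 := (abs_le.1 h).1
  have h2 : q ^ (1 + 1) / (1 - q) ≤ 4 * q ^ 2 := by
    rw [div_le_iff₀ (by linarith)]
    simp only [Nat.reduceAdd]
    nlinarith [mul_nonneg (sq_nonneg q) (sub_nonneg.2 hq')]
  simp at h1
  linarith

theorem eulerVar_le_neg_log {r : ℝ} (hr : 0 ≤ r) (hr' : r ≤ 3 / 4) :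
    eulerVar r ≤ -Real.log (1 - r ^ 2) := by
  have h2 : r ^ 2 < 1 := by nlinarith
  have h := Real.hasSum_pow_div_log_of_abs_lt_one (x := r ^ 2) (by rwa [abs_of_nonneg (sq_nonneg r)])
  have h3 := (hasSum_nat_add_iff' 1).2 (hasSum_eulerVar hr hr')
  simp only [Finset.range_one, Finset.sum_singleton, CharP.cast_eq_zero, div_zero, ne_eq,
    OfNat.ofNat_ne_zero, not_false_eq_true, zero_pow, sub_zero] at h3
  refine hasSum_le (fun n => ?_) h3 h
  rw [div_pow, ← pow_mul, ← pow_mul, mul_comm (n + 1) 2]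
  have : ((n : ℝ) + 1) ≤ ((n + 1 : ℕ) : ℝ) ^ 2 := by
    push_cast; nlinarith [Nat.cast_nonneg (α := ℝ) n]
  gcongr

/-- Both sides equal r² + O(r⁴), and p^{-4σ} is summable up to σ = 1/2. Hence ψ(σ) may be replaced
by log ζ(2σ) with bounded error. -/
theorem abs_eulerVar_sub_neg_log_le {r : ℝ} (hr : 0 ≤ r) (hr' : r ≤ 3 / 4) :
    |eulerVar r - -Real.log (1 - r ^ 2)| ≤ 4 * r ^ 4 := by
  have h1 := sq_le_eulerVar hr hr'
  have h2 := eulerVar_le_neg_log hr hr'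
  have h3 := neg_log_one_sub_le (sq_nonneg r) (by nlinarith)
  rw [abs_le]
  constructor
  · nlinarith
  · have : 0 ≤ r ^ 4 := by positivity
    linarith

theorem summable_neg_log_primeRadius {σ : ℝ} (hσ : 1 / 2 < σ) :
    Summable fun p => -Real.log (1 - primeRadius σ p ^ 2) := by
  refine Summable.of_nonneg_of_le (fun p => ?_) (fun p => ?_)
    ((summable_primeRadius_pow (σ := σ) (n := 2) (by push_cast; linarith)).mul_left 5)
  · exact (eulerVar_nonneg _).trans
      (eulerVar_le_neg_log (primeRadius_pos σ p).le (primeRadius_le hσ.le p))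
  · have h1 := primeRadius_pos σ p
    have h2 := primeRadius_le hσ.le p
    have h3 : primeRadius σ p ^ 2 ≤ 3 / 4 := by nlinarith
    have := neg_log_one_sub_le (sq_nonneg (primeRadius σ p)) h3
    nlinarith [sq_nonneg (primeRadius σ p)]

theorem tsum_neg_log_primeRadius {σ : ℝ} (hσ : 1 / 2 < σ) :
    ∑' p, -Real.log (1 - primeRadius σ p ^ 2) = Real.log ‖riemannZeta ((2 * σ : ℝ) : ℂ)‖ := by
  have h := riemannZeta_eulerProduct_exp_log (s := ((2 * σ : ℝ) : ℂ))
    (by rw [Complex.ofReal_re]; linarith)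
  have h1 : ∀ p : Nat.Primes, -Complex.log (1 - ((p : ℕ) : ℂ) ^ (-((2 * σ : ℝ) : ℂ)))
      = ((-Real.log (1 - primeRadius σ p ^ 2) : ℝ) : ℂ) := by
    intro p
    have h2 := primeRadius_pos σ p
    have h3 := primeRadius_le hσ.le p
    have : ((p : ℕ) : ℂ) ^ (-((2 * σ : ℝ) : ℂ)) = ((primeRadius σ p ^ 2 : ℝ) : ℂ) := by
      rw [primeRadius_pow, Complex.ofReal_cpow (by positivity)]
      push_cast
      rfl
    rw [this, ← Complex.ofReal_one, ← Complex.ofReal_sub, ← Complex.ofReal_log (by nlinarith)]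
    push_cast; rfl
  rw [tsum_congr h1, ← Complex.ofReal_tsum] at h
  rw [← h, Complex.norm_exp, Complex.ofReal_re, Real.log_exp]

/-- The function (s - 1)ζ(s), given the value 1 at s = 1, is continuous and nonvanishing on the
compact interval [1, 3/2], so the logarithm of its modulus is bounded there. -/
theorem exists_abs_log_norm_riemannZeta_le :
    ∃ C : ℝ, ∀ s : ℝ, 1 < s → s ≤ 3 / 2 →
      |Real.log ‖riemannZeta (s : ℂ)‖ - Real.log (1 / (s - 1))| ≤ C := by
  set G : ℂ → ℂ := Function.update (fun s => (s - 1) * riemannZeta s) 1 1 with hG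
  have hGne : ∀ s : ℂ, s ≠ 1 → G s = (s - 1) * riemannZeta s := fun s hs =>
    Function.update_of_ne hs _ _
  have hG1 : G 1 = 1 := Function.update_self _ _ _
  have hGc : Continuous G := by
    rw [continuous_iff_continuousAt]
    intro s
    rcases eq_or_ne s 1 with rfl | hs
    · exact continuousAt_update_same.2 riemannZeta_residue_one
    · have h : ContinuousAt (fun s => (s - 1) * riemannZeta s) s :=
        (continuousAt_id.sub continuousAt_const).mul
          (differentiableAt_riemannZeta hs).continuousAt
      refine h.congr ?_
      filter_upwards [isOpen_ne.mem_nhds hs] with t ht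
      exact (hGne t ht).symm
  have hne : ∀ s : ℝ, 1 ≤ s → G s ≠ 0 := by
    intro s hs
    rcases eq_or_ne s 1 with rfl | hs1
    · simp [hG1]
    · have : (s : ℂ) ≠ 1 := by exact_mod_cast hs1
      rw [hGne _ this]
      exact mul_ne_zero (sub_ne_zero.2 this) (riemannZeta_ne_zero_of_one_le_re (by simpa))
  have hc : ContinuousOn (fun s : ℝ => Real.log ‖G s‖) (Set.Icc 1 (3 / 2)) := by
    refine ContinuousOn.log (Continuous.continuousOn (by fun_prop)) fun s hs => ?_
    exact norm_ne_zero_iff.2 (hne s hs.1)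
  obtain ⟨C, hC⟩ := isCompact_Icc.exists_bound_of_continuousOn hc
  refine ⟨C, fun s hs hs' => ?_⟩
  have h := hC s ⟨hs.le, hs'⟩
  have hs1 : (s : ℂ) ≠ 1 := by exact_mod_cast hs.ne'
  have hζ : ‖riemannZeta (s : ℂ)‖ ≠ 0 :=
    norm_ne_zero_iff.2 (riemannZeta_ne_zero_of_one_le_re (by simpa using hs.le))
  have hn : ‖((s : ℂ) - 1)‖ = s - 1 := by
    rw [← Complex.ofReal_one, ← Complex.ofReal_sub, Complex.norm_real,
      Real.norm_of_nonneg (by linarith)]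
  rw [hGne _ hs1, norm_mul, hn, Real.log_mul (by linarith) hζ, Real.norm_eq_abs] at h
  rw [one_div, Real.log_inv]
  convert h using 2
  ring

theorem exists_abs_psi_sub_log_le :
    ∃ C : ℝ, ∀ σ : ℝ, 1 / 2 < σ → σ ≤ 3 / 4 → |psi σ - Real.log (1 / (σ - 1 / 2))| ≤ C := by
  obtain ⟨C, hC⟩ := exists_abs_log_norm_riemannZeta_le
  refine ⟨∑' p, 4 * primeRadius (1 / 2) p ^ 4 + C + Real.log 2, fun σ hσ hσ' => ?_⟩
  have h1 : |psi σ - Real.log ‖riemannZeta ((2 * σ : ℝ) : ℂ)‖|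
      ≤ ∑' p, 4 * primeRadius (1 / 2) p ^ 4 := by
    rw [← tsum_neg_log_primeRadius hσ, ← (hasSum_eulerVar_psi hσ).tsum_eq,
      ← (summable_eulerVar hσ).tsum_sub (summable_neg_log_primeRadius hσ), ← Real.norm_eq_abs]
    refine tsum_of_norm_bounded
      ((summable_primeRadius_pow (n := 4) (by norm_num)).mul_left 4).hasSum fun p => ?_
    rw [Real.norm_eq_abs]
    refine (abs_eulerVar_sub_neg_log_le (primeRadius_pos σ p).le (primeRadius_le hσ.le p)).trans ?_
    have := primeRadius_anti hσ.le p
    have := (primeRadius_pos σ p).le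
    gcongr
  have h2 := hC (2 * σ) (by linarith) (by linarith)
  -- The pole is approached at 2σ - 1 = 2(σ - 1/2), which accounts for the log 2.
  have h3 : Real.log (1 / (σ - 1 / 2)) = Real.log (1 / (2 * σ - 1)) + Real.log 2 := by
    rw [← Real.log_mul (one_div_pos.2 (by linarith)).ne' (by norm_num)]
    congr 1
    have : (2 * σ - 1) ≠ 0 := by linarith
    have : (σ - 1 / 2) ≠ 0 := by linarith
    field_simp
  have h4 : 0 ≤ Real.log 2 := Real.log_nonneg (by norm_num)
  rw [h3]
  rw [abs_le] at *
  constructor <;> linarith [h1.1, h1.2, h2.1, h2.2]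

/-- Since ψ ≤ log(1/(σ - 1/2)) + C, the distance σ - 1/2 is at most e^{C - ψ}, smaller than any
fixed power of 1/ψ. -/
theorem exists_sub_half_le_div_psi_pow :
    ∃ C : ℝ, 0 ≤ C ∧ ∀ σ : ℝ, 1 / 2 < σ → σ ≤ 3 / 4 → σ - 1 / 2 ≤ C / psi σ ^ 4 := by
  obtain ⟨C, hC⟩ := exists_abs_psi_sub_log_le
  refine ⟨24 * Real.exp C, by positivity, fun σ hσ hσ' => ?_⟩
  have h := (abs_le.1 (hC σ hσ hσ')).2
  have hψ := one_fourth_le_psi hσ hσ'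
  rw [one_div, Real.log_inv] at h
  have hpos : 0 < σ - 1 / 2 := by linarith
  have h1 : σ - 1 / 2 ≤ Real.exp C * Real.exp (-psi σ) := by
    rw [← Real.exp_add, ← Real.log_le_iff_le_exp hpos]; linarith
  have h2 := Real.pow_div_factorial_le_exp (x := psi σ) (by linarith) 4
  have h3 : psi σ ^ 4 ≤ 24 * Real.exp (psi σ) := by
    rw [div_le_iff₀ (by positivity)] at h2
    simp only [Nat.factorial] at h2
    push_cast at h2
    linarith
  rw [le_div_iff₀ (by positivity)]
  calc (σ - 1 / 2) * psi σ ^ 4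
      ≤ Real.exp C * Real.exp (-psi σ) * (24 * Real.exp (psi σ)) := by gcongr
    _ = 24 * Real.exp C * (Real.exp (-psi σ) * Real.exp (psi σ)) := by ring
    _ = 24 * Real.exp C := by rw [← Real.exp_add, neg_add_cancel, Real.exp_zero, mul_one]

/-- A crude comparison with the harmonic sum. A logarithmic loss is harmless where it is used. -/
theorem sum_primeRadius_sq_le {σ y : ℝ} (hσ : 1 / 2 ≤ σ) (hy : 1 ≤ y) (N : ℕ) :
    ∑ p ∈ (primesUpTo N).filter (fun p : Nat.Primes => ((p : ℕ) : ℝ) ≤ y), primeRadius σ p ^ 2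
      ≤ 1 + Real.log y := by
  refine le_trans ?_ (harmonic_floor_le_one_add_log y hy)
  rw [harmonic_eq_sum_Icc]
  push_cast
  calc ∑ p ∈ (primesUpTo N).filter (fun p : Nat.Primes => ((p : ℕ) : ℝ) ≤ y), primeRadius σ p ^ 2
      ≤ ∑ p ∈ (primesUpTo N).filter (fun p : Nat.Primes => ((p : ℕ) : ℝ) ≤ y), (((p : ℕ) : ℝ))⁻¹ := by
        refine Finset.sum_le_sum fun p _ => ?_
        rw [primeRadius_pow, ← Real.rpow_neg_one]
        apply Real.rpow_le_rpow_of_exponent_le (by linarith [two_le_prime p])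
        push_cast; linarith
    _ = ∑ n ∈ ((primesUpTo N).filter (fun p : Nat.Primes => ((p : ℕ) : ℝ) ≤ y)).map
          ⟨fun p : Nat.Primes => (p : ℕ), Subtype.val_injective⟩, ((n : ℝ))⁻¹ := by
        rw [Finset.sum_map]; rfl
    _ ≤ _ := by
        refine Finset.sum_le_sum_of_subset_of_nonneg (fun n hn => ?_) fun _ _ _ => by positivity
        rw [Finset.mem_map] at hn
        obtain ⟨p, hp, rfl⟩ := hn
        rw [Finset.mem_Icc]
        exact ⟨p.2.one_le, Nat.le_floor (Finset.mem_filter.1 hp).2⟩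

/-- Chebyshev's lower bound gives at least 2 x^{4/5} primes up to x. With x = y^{5/4} this is 2y,
and at most y of these primes are not larger than y. -/
theorem eventually_le_card_primes :
    ∀ᶠ y : ℝ in atTop, y ≤ (((primesUpTo ⌊y ^ (5 / 4 : ℝ)⌋₊).filter
      (fun p : Nat.Primes => y < ((p : ℕ) : ℝ))).card : ℝ) := by
  have h1 : ∀ᶠ x : ℝ in atTop, 2 * x ^ (4 / 5 : ℝ) ≤ Nat.primeCounting ⌊x⌋₊ := by
    have hl := (isLittleO_log_rpow_atTop (show (0 : ℝ) < 1 / 5 by norm_num)).bound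
      (show (0 : ℝ) < 1 / 8 by norm_num)
    filter_upwards [hl, eventually_ge_atTop 10] with x hx hx10
    have hx0 : 0 < x := by linarith
    have hlog : 0 < Real.log x := Real.log_pos (by linarith)
    rw [Real.norm_of_nonneg hlog.le, Real.norm_of_nonneg (by positivity)] at hx
    refine le_trans ?_ (Chebyshev.pi_ge' (x := x) (by linarith))
    rw [le_div_iff₀ hlog]
    have e1 : x ^ (4 / 5 : ℝ) * x ^ (1 / 5 : ℝ) = x := by
      rw [← Real.rpow_add hx0]; norm_num
    have e2 : 2 * x ^ (4 / 5 : ℝ) * Real.log x ≤ x / 4 := by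
      calc 2 * x ^ (4 / 5 : ℝ) * Real.log x
          ≤ 2 * x ^ (4 / 5 : ℝ) * (1 / 8 * x ^ (1 / 5 : ℝ)) := by gcongr
        _ = (x ^ (4 / 5 : ℝ) * x ^ (1 / 5 : ℝ)) / 4 := by ring
        _ = x / 4 := by rw [e1]
    -- The tangent line of the logarithm at 8.
    have e3 : Real.log (x + 2) ≤ x / 8 + 4 / 3 := by
      have h9 := Real.log_le_sub_one_of_pos (show 0 < (x + 2) / 8 by linarith)
      rw [Real.log_div (by linarith) (by norm_num)] at h9
      have : Real.log 8 = 3 * Real.log 2 := by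
        rw [show (8 : ℝ) = 2 ^ 3 by norm_num, Real.log_pow]; norm_num
      rw [this] at h9
      linarith [Real.log_two_lt_d9]
    nlinarith [Real.log_two_gt_d9]
  have h2 : Tendsto (fun y : ℝ => y ^ (5 / 4 : ℝ)) atTop atTop := tendsto_rpow_atTop (by norm_num)
  filter_upwards [h2.eventually h1, eventually_ge_atTop 0] with y hy hy0
  rw [← Real.rpow_mul hy0] at hy
  norm_num at hy
  have hle : ((primesUpTo ⌊y ^ (5 / 4 : ℝ)⌋₊).filter (fun p : Nat.Primes => ¬ y < ((p : ℕ) : ℝ))).card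
      ≤ ⌊y⌋₊ := by
    calc _ ≤ (Finset.Icc 1 ⌊y⌋₊).card := by
          refine Finset.card_le_card_of_injOn (fun p : Nat.Primes => (p : ℕ)) (fun p hp => ?_)
            (Subtype.val_injective.injOn)
          rw [Finset.mem_coe, Finset.mem_filter] at hp
          rw [Finset.mem_coe, Finset.mem_Icc]
          exact ⟨p.2.one_le, Nat.le_floor (not_lt.1 hp.2)⟩
      _ = ⌊y⌋₊ := by simp
  have hsum := Finset.card_filter_add_card_filter_not (s := primesUpTo ⌊y ^ (5 / 4 : ℝ)⌋₊)
    (fun p : Nat.Primes => y < ((p : ℕ) : ℝ))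
  rw [card_primesUpTo] at hsum
  have hsum' : (((primesUpTo ⌊y ^ (5 / 4 : ℝ)⌋₊).filter (fun p : Nat.Primes => y < ((p : ℕ) : ℝ))).card : ℝ)
      + (((primesUpTo ⌊y ^ (5 / 4 : ℝ)⌋₊).filter (fun p : Nat.Primes => ¬ y < ((p : ℕ) : ℝ))).card : ℝ)
      = Nat.primeCounting ⌊y ^ (5 / 4 : ℝ)⌋₊ := by exact_mod_cast hsum
  have hle' : (((primesUpTo ⌊y ^ (5 / 4 : ℝ)⌋₊).filter (fun p : Nat.Primes => ¬ y < ((p : ℕ) : ℝ))).card : ℝ)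
      ≤ y := (by exact_mod_cast hle : _ ≤ ((⌊y⌋₊ : ℕ) : ℝ)).trans (Nat.floor_le hy0)
  linarith

/-! ### Series of independent random variables -/

theorem martingale_sum_range {Ω : Type*} [MeasurableSpace Ω] {P : Measure Ω}
    [IsProbabilityMeasure P] {Z : ℕ → Ω → ℝ} (hm : ∀ n, Measurable (Z n)) (hind : iIndepFun Z P)
    (hint : ∀ n, Integrable (Z n) P) (hmean : ∀ n, ∫ w, Z n w ∂P = 0) :
    Martingale (fun n w => ∑ k ∈ Finset.range (n + 1), Z k w)
      (Filtration.natural Z fun n => (hm n).stronglyMeasurable) P := by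
  set ℱ := Filtration.natural Z fun n => (hm n).stronglyMeasurable with hℱ
  have hadp : ∀ n, StronglyMeasurable[ℱ n] fun w => ∑ k ∈ Finset.range (n + 1), Z k w := by
    intro n
    refine Finset.stronglyMeasurable_fun_sum _ fun k hk => ?_
    exact (Filtration.stronglyAdapted_natural fun n => (hm n).stronglyMeasurable) k |>.mono
      (ℱ.mono (by simpa [Nat.lt_succ_iff] using hk))
  refine martingale_nat hadp (fun n => integrable_finsetSum _ fun k _ => hint k) fun n => ?_
  have h1 : (fun w => ∑ k ∈ Finset.range (n + 1 + 1), Z k w)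
      = (fun w => ∑ k ∈ Finset.range (n + 1), Z k w) + Z (n + 1) := by
    funext w; simp [Finset.sum_range_succ _ (n + 1)]
  rw [h1]
  have h2 := hind.condExp_natural_ae_eq_of_lt (fun n => (hm n).stronglyMeasurable)
    (Nat.lt_succ_self n)
  have h3 := condExp_add (m := ℱ n) (μ := P) (integrable_finsetSum _ fun k _ => hint k :
    Integrable (fun w => ∑ k ∈ Finset.range (n + 1), Z k w) P) (hint (n + 1))
  have h4 := condExp_of_stronglyMeasurable (ℱ.le n) (hadp n)
    (integrable_finsetSum _ fun k _ => hint k)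
  filter_upwards [h2, h3] with w hw2 hw3
  rw [hw3, Pi.add_apply, h4, hw2, hmean, add_zero]

/-- The partial sums form a martingale. Orthogonality bounds their second moments by the sum of the
variances, and |S| ≤ 1 + S² turns this into the L¹ bound required by the convergence theorem. -/
theorem ae_exists_tendsto_sum_of_iIndepFun {Ω : Type*} [MeasurableSpace Ω] {P : Measure Ω}
    [IsProbabilityMeasure P] {Z : ℕ → Ω → ℝ} (hm : ∀ n, Measurable (Z n)) (hind : iIndepFun Z P)
    (hL2 : ∀ n, MemLp (Z n) 2 P) (hmean : ∀ n, ∫ w, Z n w ∂P = 0)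
    (hvar : Summable fun n => ∫ w, Z n w ^ 2 ∂P) :
    ∀ᵐ w ∂P, ∃ c, Tendsto (fun n => ∑ k ∈ Finset.range n, Z k w) atTop (𝓝 c) := by
  have hint : ∀ n, Integrable (Z n) P := fun n => (hL2 n).integrable (by norm_num)
  have hmart := martingale_sum_range hm hind hint hmean
  have hbd : ∀ n, eLpNorm (fun w => ∑ k ∈ Finset.range (n + 1), Z k w) 1 P
      ≤ (Real.toNNReal (1 + ∑' n, ∫ w, Z n w ^ 2 ∂P) : ENNReal) := by
    intro n
    have hS2 : MemLp (fun w => ∑ k ∈ Finset.range (n + 1), Z k w) 2 P :=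
      memLp_finsetSum _ fun k _ => hL2 k
    have hSint : Integrable (fun w => ∑ k ∈ Finset.range (n + 1), Z k w) P :=
      integrable_finsetSum _ fun k _ => hint k
    rw [eLpNorm_one_eq_lintegral_enorm, ← ofReal_integral_norm_eq_lintegral_enorm hSint]
    refine ENNReal.ofReal_le_ofReal ?_
    have hmean0 : ∫ w, ∑ k ∈ Finset.range (n + 1), Z k w ∂P = 0 := by
      rw [integral_finsetSum _ fun k _ => hint k]; simp [hmean]
    have hv : ∫ w, (∑ k ∈ Finset.range (n + 1), Z k w) ^ 2 ∂P
        = ∑ k ∈ Finset.range (n + 1), ∫ w, Z k w ^ 2 ∂P := by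
      have h1 := IndepFun.variance_sum (X := Z) (s := Finset.range (n + 1)) (fun k _ => hL2 k)
        (fun i _ j _ hij => hind.indepFun hij)
      simp_rw [fun k => variance_of_integral_eq_zero (hm k).aemeasurable (hmean k)] at h1
      have h2 : (∑ k ∈ Finset.range (n + 1), Z k)
          = fun w => ∑ k ∈ Finset.range (n + 1), Z k w := by funext w; simp
      rw [h2, variance_of_integral_eq_zero hSint.aemeasurable hmean0] at h1
      exact h1
    calc ∫ w, ‖∑ k ∈ Finset.range (n + 1), Z k w‖ ∂P
        ≤ ∫ w, (1 + (∑ k ∈ Finset.range (n + 1), Z k w) ^ 2) ∂P := by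
          refine integral_mono hSint.norm ((integrable_const _).add hS2.integrable_sq) fun w => ?_
          simp only [Real.norm_eq_abs]
          rw [← sq_abs]
          nlinarith [sq_nonneg (|∑ k ∈ Finset.range (n + 1), Z k w| - 1)]
      _ = 1 + ∑ k ∈ Finset.range (n + 1), ∫ w, Z k w ^ 2 ∂P := by
          rw [integral_add (integrable_const _) hS2.integrable_sq, hv]; simp
      _ ≤ 1 + ∑' n, ∫ w, Z n w ^ 2 ∂P := by
          gcongr
          exact hvar.sum_le_tsum _ fun k _ => integral_nonneg fun w => sq_nonneg _
  filter_upwards [hmart.submartingale.exists_ae_tendsto_of_bdd hbd] with w ⟨c, hc⟩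
  -- The martingale at time n sums n + 1 terms, hence the shift by one.
  exact ⟨c, (tendsto_add_atTop_iff_nat 1).1 hc⟩

/-- The increasing enumeration of the primes. -/
noncomputable def nthPrime (n : ℕ) : Nat.Primes :=
  ⟨Nat.nth Nat.Prime n, Nat.nth_mem_of_infinite Nat.infinite_setOfPred_prime n⟩

theorem nthPrime_injective : Function.Injective nthPrime := fun _ _ h =>
  Nat.nth_injective Nat.infinite_setOfPred_prime (congrArg Subtype.val h)

/-- The sums over p ≤ N are the partial sums along the enumeration at index π(N), so convergence
along the enumeration gives convergence in N. -/
theorem sum_primesUpTo_eq_sum_range {M : Type*} [AddCommMonoid M] (f : Nat.Primes → M) (N : ℕ) :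
    ∑ p ∈ primesUpTo N, f p = ∑ n ∈ Finset.range (Nat.primeCounting N), f (nthPrime n) := by
  symm
  refine Finset.sum_nbij' (fun n => nthPrime n) (fun p => Nat.count Nat.Prime p) (fun n hn => ?_)
    (fun p hp => ?_) (fun n _ => ?_) (fun p _ => ?_) fun _ _ => rfl
  · exact mem_primesUpTo.2 (Nat.lt_succ_iff.1 (Nat.nth_lt_of_lt_count (Finset.mem_range.1 hn)))
  · exact Finset.mem_range.2 (Nat.count_strict_mono p.2 (Nat.lt_succ_iff.2 (mem_primesUpTo.1 hp)))
  · exact Nat.count_nth_of_infinite Nat.infinite_setOfPred_prime n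
  · exact Subtype.ext (Nat.nth_count p.2)

/-! ### The random Euler product -/

theorem logEulerPartial_eq (σ : ℝ) (x : Nat.Primes → ℂ) (N : ℕ) :
    logEulerPartial σ x N = ∑ p ∈ primesUpTo N, eulerLog (primeRadius σ p) (x p) := by
  refine Finset.sum_congr rfl fun p _ => ?_
  rw [eulerLog, primeRadius, Real.rpow_neg (by positivity), div_eq_mul_inv, Complex.ofReal_inv]

theorem exp_logEulerPartial {σ : ℝ} (hσ : 1 / 2 ≤ σ) {x : Nat.Primes → ℂ} (hx : ∀ p, ‖x p‖ = 1)
    (N : ℕ) : Complex.exp (logEulerPartial σ x N) = eulerPartial σ x N := by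
  rw [logEulerPartial, eulerPartial, Complex.exp_sum]
  refine Finset.prod_congr rfl fun p _ => ?_
  rw [Complex.exp_neg, Complex.exp_log]
  have h1 : x p / (((p : ℕ) : ℝ) ^ σ : ℝ) = x p * (primeRadius σ p : ℂ) := by
    rw [primeRadius, Real.rpow_neg (by positivity), div_eq_mul_inv, Complex.ofReal_inv]
  rw [h1]
  refine Complex.slitPlane_ne_zero (one_sub_mem_slitPlane ?_)
  refine (norm_mul_ofReal_le (hx p).le (primeRadius_pos σ p).le).trans_lt ?_
  linarith [primeRadius_le hσ p]

section RandomModel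

variable {Ω : Type*} [MeasurableSpace Ω] {P : Measure Ω} {X : Nat.Primes → Ω → ℂ}

theorem ae_forall_norm_eq_one (hX : ∀ p, Measurable (X p))
    (hlaw : ∀ p, P.map (X p) = circleUniform) : ∀ᵐ w ∂P, ∀ p, ‖X p w‖ = 1 := by
  rw [ae_all_iff]
  intro p
  have h := ae_norm_eq_one_circleUniform
  rw [← hlaw p] at h
  exact ae_of_ae_map (hX p).aemeasurable h

theorem measurable_logEulerPartial (hX : ∀ p, Measurable (X p)) (σ : ℝ) (N : ℕ) :
    Measurable fun w => logEulerPartial σ (fun p => X p w) N := by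
  simp_rw [logEulerPartial_eq]
  exact Finset.measurable_fun_sum _ fun p _ => (measurable_eulerLog _).comp (hX p)

theorem charFun_map_logEulerPartial (hX : ∀ p, Measurable (X p))
    (hlaw : ∀ p, P.map (X p) = circleUniform) (hind : iIndepFun X P) (σ : ℝ) (N : ℕ) (t : ℂ) :
    charFun (P.map fun w => logEulerPartial σ (fun p => X p w) N) t
      = ∏ p ∈ primesUpTo N, eulerChar (primeRadius σ p) t := by
  simp_rw [logEulerPartial_eq]
  have hY : iIndepFun (fun p w => eulerLog (primeRadius σ p) (X p w)) P :=
    hind.comp (fun p z => eulerLog (primeRadius σ p) z) fun p => measurable_eulerLog _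
  have h := iIndepFun.charFun_map_fun_finsetSum_eq_prod
    (X := fun p w => eulerLog (primeRadius σ p) (X p w)) (s := primesUpTo N) (P := P)
    (fun p _ => ((measurable_eulerLog _).comp (hX p)).aemeasurable) (hY.restrict _)
  rw [h, Finset.prod_apply]
  refine Finset.prod_congr rfl fun p _ => ?_
  have hm : Measurable fun z : ℂ =>
      Complex.exp (⟪eulerLog (primeRadius σ p) z, t⟫ * Complex.I) := by
    have := measurable_inner_eulerLog (primeRadius σ p) t
    fun_prop
  have hm' : Measurable fun w => eulerLog (primeRadius σ p) (X p w) :=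
    (measurable_eulerLog _).comp (hX p)
  rw [charFun_apply, integral_map hm'.aemeasurable (Continuous.aestronglyMeasurable (by fun_prop)), eulerChar, ← hlaw p,
    integral_map (hX p).aemeasurable hm.aestronglyMeasurable]

variable [IsProbabilityMeasure P]

theorem ae_exists_tendsto_inner (hX : ∀ p, Measurable (X p))
    (hlaw : ∀ p, P.map (X p) = circleUniform) (hind : iIndepFun X P) {σ : ℝ} (hσ : 1 / 2 < σ)
    (v : ℂ) : ∀ᵐ w ∂P, ∃ c, Tendsto
      (fun N => ⟪logEulerPartial σ (fun p => X p w) N, v⟫) atTop (𝓝 c) := by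
  set Z : ℕ → Ω → ℝ := fun n w => ⟪eulerLog (primeRadius σ (nthPrime n)) (X (nthPrime n) w), v⟫
    with hZ
  have hr0 := fun n => (primeRadius_pos σ (nthPrime n)).le
  have hr1 := fun n => primeRadius_le hσ.le (nthPrime n)
  have hmeas : ∀ n, Measurable (Z n) := fun n =>
    (measurable_inner_eulerLog _ v).comp (hX _)
  have hindZ : iIndepFun Z P :=
    (hind.precomp nthPrime_injective).comp
      (fun n z => ⟪eulerLog (primeRadius σ (nthPrime n)) z, v⟫)
      fun n => measurable_inner_eulerLog _ v
  have hmom : ∀ n j, ∫ w, Z n w ^ j ∂P = eulerMoment (primeRadius σ (nthPrime n)) v j := by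
    intro n j
    rw [eulerMoment, ← hlaw (nthPrime n), integral_map (hX _).aemeasurable]
    exact ((measurable_inner_eulerLog _ v).pow_const j).aestronglyMeasurable
  have hL2 : ∀ n, MemLp (Z n) 2 P := by
    intro n
    refine MemLp.of_bound (hmeas n).aestronglyMeasurable
      (3 * primeRadius σ (nthPrime n) * ‖v‖) ?_
    filter_upwards [ae_forall_norm_eq_one hX hlaw] with w hw
    refine (abs_real_inner_le_norm _ _).trans ?_
    gcongr
    exact norm_eulerLog_le (hw _).le (hr0 n) (hr1 n)
  have hmean : ∀ n, ∫ w, Z n w ∂P = 0 := by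
    intro n
    have := hmom n 1
    simpa [eulerMoment_one (hr0 n) (hr1 n)] using this
  have hvar : Summable fun n => ∫ w, Z n w ^ 2 ∂P := by
    simp_rw [fun n => hmom n 2, fun n => eulerMoment_two (hr0 n) (hr1 n) v]
    exact (((summable_eulerVar hσ).comp_injective nthPrime_injective).mul_left _).div_const _
  filter_upwards [ae_exists_tendsto_sum_of_iIndepFun hmeas hindZ hL2 hmean hvar] with w ⟨c, hc⟩
  refine ⟨c, (hc.comp Nat.tendsto_primeCounting).congr fun N => ?_⟩
  rw [logEulerPartial_eq, sum_inner, sum_primesUpTo_eq_sum_range]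
  rfl

theorem ae_tendsto_logEulerPartial (hX : ∀ p, Measurable (X p))
    (hlaw : ∀ p, P.map (X p) = circleUniform) (hind : iIndepFun X P) {σ : ℝ} (hσ : 1 / 2 < σ) :
    ∀ᵐ w ∂P, Tendsto (logEulerPartial σ (fun p => X p w)) atTop
      (𝓝 (logEulerZeta σ (fun p => X p w))) := by
  -- The projections onto 1 and I are the real and imaginary parts.
  filter_upwards [ae_exists_tendsto_inner hX hlaw hind hσ 1,
    ae_exists_tendsto_inner hX hlaw hind hσ Complex.I] with w ⟨a, ha⟩ ⟨b, hb⟩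
  refine tendsto_nhds_limUnder ⟨(a : ℂ) + b * Complex.I, ?_⟩
  have h := ((Complex.continuous_ofReal.tendsto a).comp ha).add
    (((Complex.continuous_ofReal.tendsto b).comp hb).mul_const Complex.I)
  refine h.congr fun N => ?_
  simp only [Function.comp_apply, Complex.inner]
  conv_rhs => rw [← Complex.re_add_im (logEulerPartial σ (fun p => X p w) N)]
  simp

theorem ae_tendsto_eulerPartial (hX : ∀ p, Measurable (X p))
    (hlaw : ∀ p, P.map (X p) = circleUniform) (hind : iIndepFun X P) {σ : ℝ} (hσ : 1 / 2 < σ) :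
    ∀ᵐ w ∂P, Tendsto (logEulerPartial σ (fun p => X p w)) atTop
        (𝓝 (logEulerZeta σ (fun p => X p w))) ∧
      Tendsto (eulerPartial σ (fun p => X p w)) atTop (𝓝 (eulerZeta σ (fun p => X p w))) ∧
      Complex.exp (logEulerZeta σ (fun p => X p w)) = eulerZeta σ (fun p => X p w) := by
  filter_upwards [ae_tendsto_logEulerPartial hX hlaw hind hσ, ae_forall_norm_eq_one hX hlaw]
    with w hw hn
  have h : Tendsto (eulerPartial σ (fun p => X p w)) atTop
      (𝓝 (Complex.exp (logEulerZeta σ (fun p => X p w)))) :=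
    ((Complex.continuous_exp.tendsto _).comp hw).congr fun N => exp_logEulerPartial hσ.le hn N
  have h2 : eulerZeta σ (fun p => X p w) = Complex.exp (logEulerZeta σ (fun p => X p w)) :=
    h.limUnder_eq
  exact ⟨hw, h2 ▸ h, h2.symm⟩

theorem aemeasurable_logEulerZeta (hX : ∀ p, Measurable (X p))
    (hlaw : ∀ p, P.map (X p) = circleUniform) (hind : iIndepFun X P) {σ : ℝ} (hσ : 1 / 2 < σ) :
    AEMeasurable (fun w => logEulerZeta σ (fun p => X p w)) P :=
  aemeasurable_of_tendsto_metrizable_ae atTop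
    (fun N => (measurable_logEulerPartial hX σ N).aemeasurable)
    (ae_tendsto_logEulerPartial hX hlaw hind hσ)

theorem tendsto_prod_eulerChar (hX : ∀ p, Measurable (X p))
    (hlaw : ∀ p, P.map (X p) = circleUniform) (hind : iIndepFun X P) {σ : ℝ} (hσ : 1 / 2 < σ)
    (t : ℂ) : Tendsto (fun N => ∏ p ∈ primesUpTo N, eulerChar (primeRadius σ p) t) atTop
      (𝓝 (charFun (P.map fun w => logEulerZeta σ (fun p => X p w)) t)) := by
  simp_rw [← charFun_map_logEulerPartial hX hlaw hind σ]
  have hc : ∀ {Y : Ω → ℂ}, AEMeasurable Y P →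
      charFun (P.map Y) t = ∫ w, Complex.exp (⟪Y w, t⟫ * Complex.I) ∂P := fun hY => by
    rw [charFun_apply, integral_map hY (Continuous.aestronglyMeasurable (by fun_prop))]
  rw [hc (aemeasurable_logEulerZeta hX hlaw hind hσ)]
  simp_rw [fun N => hc (measurable_logEulerPartial hX σ N).aemeasurable]
  refine tendsto_integral_of_dominated_convergence (fun _ => 1) (fun N => ?_)
    (integrable_const _) (fun N => Eventually.of_forall fun w => ?_) ?_
  · have := measurable_logEulerPartial hX σ N
    exact Measurable.aestronglyMeasurable (by fun_prop)
  · rw [Complex.norm_exp_ofReal_mul_I]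
  · filter_upwards [ae_tendsto_logEulerPartial hX hlaw hind hσ] with w hw
    have hcont : Continuous fun z : ℂ => Complex.exp (⟪z, t⟫ * Complex.I) := by fun_prop
    exact (hcont.tendsto _).comp hw

end RandomModel

/-- The law of `log ζ(σ, X)` for independent `X p` uniformly distributed on the circle. -/
noncomputable def logZetaLaw (σ : ℝ) : Measure ℂ :=
  (Measure.infinitePi fun _ : Nat.Primes => circleUniform).map (logEulerZeta σ)

theorem iIndepFun_eval_infinitePi :
    iIndepFun (fun (p : Nat.Primes) (x : Nat.Primes → ℂ) => x p)
      (Measure.infinitePi fun _ : Nat.Primes => circleUniform) :=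
  iIndepFun_infinitePi (X := fun _ => id) fun _ => measurable_id

theorem tendsto_prod_eulerChar_logZetaLaw {σ : ℝ} (hσ : 1 / 2 < σ) (t : ℂ) :
    Tendsto (fun N => ∏ p ∈ primesUpTo N, eulerChar (primeRadius σ p) t) atTop
      (𝓝 (charFun (logZetaLaw σ) t)) :=
  tendsto_prod_eulerChar (fun p => measurable_pi_apply p)
    (fun p => Measure.infinitePi_map_eval _ p) iIndepFun_eval_infinitePi hσ t

theorem isProbabilityMeasure_logZetaLaw {σ : ℝ} (hσ : 1 / 2 < σ) :
    IsProbabilityMeasure (logZetaLaw σ) :=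
  Measure.isProbabilityMeasure_map (aemeasurable_logEulerZeta (fun p => measurable_pi_apply p)
    (fun p => Measure.infinitePi_map_eval _ p) iIndepFun_eval_infinitePi hσ)

/-- Both characteristic functions are limits of the same partial products. This allows one density
to serve every realisation of the random model. -/
theorem map_logEulerZeta_eq_logZetaLaw {Ω : Type*} [MeasurableSpace Ω] {P : Measure Ω}
    [IsProbabilityMeasure P] {X : Nat.Primes → Ω → ℂ} (hX : ∀ p, Measurable (X p))
    (hlaw : ∀ p, P.map (X p) = circleUniform) (hind : iIndepFun X P) {σ : ℝ} (hσ : 1 / 2 < σ) :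
    P.map (fun w => logEulerZeta σ (fun p => X p w)) = logZetaLaw σ := by
  have := isProbabilityMeasure_logZetaLaw hσ
  have := Measure.isProbabilityMeasure_map (aemeasurable_logEulerZeta hX hlaw hind hσ)
  refine Measure.ext_of_charFun (funext fun t => ?_)
  exact tendsto_nhds_unique (tendsto_prod_eulerChar hX hlaw hind hσ t)
    (tendsto_prod_eulerChar_logZetaLaw hσ t)

/-! ### Decay of the characteristic function -/

/-- Factors outside T are bounded by 1 and discarded. The two decay estimates below differ only in
the choice of T. -/
theorem norm_charFun_logZetaLaw_le_exp_sum {σ : ℝ} (hσ : 1 / 2 < σ) (w : ℂ)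
    (T : Finset Nat.Primes) (hT : ∀ p ∈ T, ‖w‖ * primeRadius σ p ≤ 1 / 300) :
    ‖charFun (logZetaLaw σ) w‖
      ≤ Real.exp (-(‖w‖ ^ 2 / 8 * ∑ p ∈ T, primeRadius σ p ^ 2)) := by
  refine le_of_tendsto (tendsto_prod_eulerChar_logZetaLaw hσ w).norm ?_
  filter_upwards [tendsto_primesUpTo.eventually_ge_atTop T] with N hN
  rw [norm_prod, ← Finset.prod_sdiff hN, Finset.mul_sum, ← Finset.sum_neg_distrib, Real.exp_sum]
  refine (mul_le_of_le_one_left (Finset.prod_nonneg fun p _ => norm_nonneg _)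
    (Finset.prod_le_one (fun p _ => norm_nonneg _) fun p _ => norm_eulerChar_le_one _ _)).trans ?_
  refine Finset.prod_le_prod (fun p _ => norm_nonneg _) fun p hp => ?_
  have := norm_eulerChar_le_exp (primeRadius_pos σ p).le (primeRadius_le hσ.le p) (hT p hp)
  exact this.trans_eq (by congr 1; ring)

theorem norm_mul_primeRadius_le {σ : ℝ} (hσ : 0 < σ) {w : ℂ} {p : Nat.Primes}
    (hp : (300 * ‖w‖) ^ (1 / σ) < ((p : ℕ) : ℝ)) : ‖w‖ * primeRadius σ p ≤ 1 / 300 := by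
  have hp0 : (0 : ℝ) < ((p : ℕ) : ℝ) := by linarith [two_le_prime p]
  have h1 : 300 * ‖w‖ ≤ ((p : ℕ) : ℝ) ^ σ := by
    calc 300 * ‖w‖ = ((300 * ‖w‖) ^ (1 / σ)) ^ σ := by
          rw [← Real.rpow_mul (by positivity), one_div_mul_cancel hσ.ne', Real.rpow_one]
      _ ≤ _ := Real.rpow_le_rpow (by positivity) hp.le hσ.le
  rw [primeRadius, Real.rpow_neg hp0.le, ← div_eq_mul_inv, div_le_iff₀ (by positivity)]
  linarith

/-- All primes with p^σ > 300|w|, up to a large cutoff, are used. The sum of p^{-2σ} over all primes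
is at least ψ/9, and the excluded small primes cost at most 1 + 2 log(300|w|). -/
theorem norm_charFun_logZetaLaw_le_exp_psi {σ : ℝ} (hσ : 1 / 2 < σ) {w : ℂ} (hw : 1 ≤ ‖w‖) :
    ‖charFun (logZetaLaw σ) w‖
      ≤ Real.exp (-(‖w‖ ^ 2 / 8 * (psi σ / 9 - 2 - 2 * Real.log (300 * ‖w‖)))) := by
  have hsum := (summable_primeRadius_pow (σ := σ) (n := 2) (by push_cast; linarith))
  have h9 : psi σ / 9 ≤ ∑' p, primeRadius σ p ^ 2 := by
    rw [div_le_iff₀ (by norm_num), mul_comm, ← tsum_mul_left, ← (hasSum_eulerVar_psi hσ).tsum_eq]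
    exact (summable_eulerVar hσ).tsum_le_tsum
      (fun p => eulerVar_le (primeRadius_pos σ p).le (primeRadius_le hσ.le p)) (hsum.mul_left 9)
  -- Truncation to finitely many primes gives up 1, the other half of the constant 2.
  obtain ⟨N, hN⟩ := ((hsum.hasSum.comp tendsto_primesUpTo).eventually
    (lt_mem_nhds (show psi σ / 9 - 1 < ∑' p, primeRadius σ p ^ 2 by linarith))).exists
  set y := (300 * ‖w‖) ^ (1 / σ) with hy
  have hy1 : 1 ≤ y := Real.one_le_rpow (by linarith) (by positivity)
  refine (norm_charFun_logZetaLaw_le_exp_sum hσ w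
    ((primesUpTo N).filter fun p : Nat.Primes => ¬ ((p : ℕ) : ℝ) ≤ y) fun p hp =>
      norm_mul_primeRadius_le (by linarith) (not_le.1 (Finset.mem_filter.1 hp).2)).trans ?_
  gcongr
  have h1 := Finset.sum_filter_add_sum_filter_not (primesUpTo N)
    (fun p : Nat.Primes => ((p : ℕ) : ℝ) ≤ y) (fun p => primeRadius σ p ^ 2)
  have h2 := sum_primeRadius_sq_le hσ.le hy1 N
  have h3 : Real.log y ≤ 2 * Real.log (300 * ‖w‖) := by
    rw [hy, Real.log_rpow (by linarith)]
    have : 0 ≤ Real.log (300 * ‖w‖) := Real.log_nonneg (by linarith)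
    gcongr
    rw [div_le_iff₀ (by linarith)]; linarith
  simp only [Function.comp_apply] at hN
  linarith

/-- With y = (300|w|)^{1/σ}, at least y primes lie in (y, y^{5/4}], each with p^{-2σ} ≥ y^{-5σ/2}.
Since |w|² is y^{2σ}/90000, the exponent is at least a constant times y^{1-σ/2}, which dominates
√|w|. The constants do not depend on σ. -/
theorem exists_norm_charFun_logZetaLaw_le_exp_sqrt :
    ∃ C c : ℝ, 0 < C ∧ 0 < c ∧ ∀ σ : ℝ, 1 / 2 < σ → σ ≤ 3 / 4 → ∀ w : ℂ,
      ‖charFun (logZetaLaw σ) w‖ ≤ C * Real.exp (-(c * √‖w‖)) := by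
  obtain ⟨y₀, hy₀⟩ := eventually_atTop.1 eventually_le_card_primes
  -- Below W the trivial bound 1 is used, and the constant exp(√W / 720000) absorbs the loss; 720000
  -- = 8 · 90000.
  set W := max y₀ 1 with hW
  refine ⟨Real.exp (1 / 720000 * √W), 1 / 720000, Real.exp_pos _, by norm_num,
    fun σ hσ hσ' w => ?_⟩
  have := isProbabilityMeasure_logZetaLaw hσ
  rw [← Real.exp_add]
  rcases le_total ‖w‖ W with h | h
  · refine (norm_charFun_le_one w).trans (Real.one_le_exp ?_)
    have := Real.sqrt_le_sqrt h
    linarith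
  have hw1 : 1 ≤ ‖w‖ := (le_max_right _ _).trans h
  set y := (300 * ‖w‖) ^ (1 / σ) with hy
  have hyw : ‖w‖ ≤ y := by
    calc ‖w‖ = ‖w‖ ^ (1 : ℝ) := (Real.rpow_one _).symm
      _ ≤ ‖w‖ ^ (1 / σ) := Real.rpow_le_rpow_of_exponent_le hw1 (by
          rw [le_div_iff₀ (by linarith)]; linarith)
      _ ≤ y := Real.rpow_le_rpow (by positivity) (by linarith) (by positivity)
  have hy0 : 0 < y := by linarith
  have hy1 : 1 ≤ y := by linarith
  set T := (primesUpTo ⌊y ^ (5 / 4 : ℝ)⌋₊).filter (fun p : Nat.Primes => y < ((p : ℕ) : ℝ)) with hT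
  have hcard : y ≤ (T.card : ℝ) := hy₀ y ((le_max_left _ _).trans (h.trans hyw))
  refine (norm_charFun_logZetaLaw_le_exp_sum hσ w T fun p hp =>
      norm_mul_primeRadius_le (by linarith) (Finset.mem_filter.1 hp).2).trans ?_
  have hterm : ∀ p ∈ T, y ^ (-(5 / 2 * σ)) ≤ primeRadius σ p ^ 2 := by
    intro p hp
    have hp1 := mem_primesUpTo.1 (Finset.mem_filter.1 hp).1
    have hp2 : ((p : ℕ) : ℝ) ≤ y ^ (5 / 4 : ℝ) :=
      (Nat.cast_le.2 hp1).trans (Nat.floor_le (by positivity))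
    rw [primeRadius_pow]
    calc y ^ (-(5 / 2 * σ)) = (y ^ (5 / 4 : ℝ)) ^ (-((2 : ℕ) * σ)) := by
          rw [← Real.rpow_mul hy0.le]; congr 1; push_cast; ring
      _ ≤ _ := Real.rpow_le_rpow_of_nonpos (by linarith [two_le_prime p]) hp2
          (by push_cast; linarith)
  have hsum : y * y ^ (-(5 / 2 * σ)) ≤ ∑ p ∈ T, primeRadius σ p ^ 2 := by
    calc y * y ^ (-(5 / 2 * σ)) ≤ T.card * y ^ (-(5 / 2 * σ)) := by gcongr
      _ = ∑ p ∈ T, y ^ (-(5 / 2 * σ)) := by rw [Finset.sum_const, nsmul_eq_mul]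
      _ ≤ _ := Finset.sum_le_sum hterm
  have hw2 : ‖w‖ ^ 2 = y ^ (2 * σ) / 90000 := by
    have : y ^ (2 * σ) = (300 * ‖w‖) ^ 2 := by
      rw [hy, ← Real.rpow_mul (by positivity), ← Real.rpow_natCast]
      congr 1
      have : σ ≠ 0 := by linarith
      push_cast
      field_simp
    rw [this]; ring
  have hkey : √‖w‖ ≤ y ^ (2 * σ) * (y * y ^ (-(5 / 2 * σ))) := by
    have e : y ^ (2 * σ) * (y * y ^ (-(5 / 2 * σ))) = y ^ (1 - σ / 2) := by
      nth_rewrite 2 [← Real.rpow_one y]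
      rw [← Real.rpow_add hy0, ← Real.rpow_add hy0]
      congr 1; ring
    rw [e, Real.sqrt_eq_rpow]
    calc ‖w‖ ^ (1 / 2 : ℝ) ≤ y ^ (1 / 2 : ℝ) := Real.rpow_le_rpow (norm_nonneg _) hyw (by norm_num)
      _ ≤ y ^ (1 - σ / 2) := Real.rpow_le_rpow_of_exponent_le hy1 (by linarith)
  apply Real.exp_le_exp.2
  have h5 : 1 / 720000 * √‖w‖ ≤ ‖w‖ ^ 2 / 8 * ∑ p ∈ T, primeRadius σ p ^ 2 := by
    calc 1 / 720000 * √‖w‖ ≤ 1 / 720000 * (y ^ (2 * σ) * (y * y ^ (-(5 / 2 * σ)))) := by gcongr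
      _ = ‖w‖ ^ 2 / 8 * (y * y ^ (-(5 / 2 * σ))) := by rw [hw2]; ring
      _ ≤ _ := by gcongr
  have : 0 ≤ 1 / 720000 * √W := by positivity
  linarith

theorem exists_exp_neg_sqrt_le {c : ℝ} (hc : 0 < c) (n : ℕ) :
    ∃ K : ℝ, 0 < K ∧ ∀ t : ℝ, 0 ≤ t → Real.exp (-(c * √t)) ≤ K / (1 + t) ^ n := by
  refine ⟨Real.exp c * (2 * n).factorial / c ^ (2 * n), by positivity, fun t ht => ?_⟩
  have h1 := Real.pow_div_factorial_le_exp (x := c * (1 + √t)) (by positivity) (2 * n)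
  rw [div_le_iff₀ (by positivity)] at h1
  have h2 : (1 + t) ^ n ≤ (1 + √t) ^ (2 * n) := by
    rw [pow_mul]
    gcongr
    nlinarith [Real.sq_sqrt ht, Real.sqrt_nonneg t]
  rw [le_div_iff₀ (by positivity), le_div_iff₀ (by positivity)]
  calc Real.exp (-(c * √t)) * (1 + t) ^ n * c ^ (2 * n)
      ≤ Real.exp (-(c * √t)) * (1 + √t) ^ (2 * n) * c ^ (2 * n) := by gcongr
    _ = Real.exp (-(c * √t)) * (c * (1 + √t)) ^ (2 * n) := by rw [mul_pow]; ring
    _ ≤ Real.exp (-(c * √t)) * (Real.exp (c * (1 + √t)) * (2 * n).factorial) := by gcongr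
    _ = Real.exp c * (2 * n).factorial := by
        rw [← mul_assoc, ← Real.exp_add]; congr 2; ring

theorem integrable_inv_one_add_norm_pow_three :
    Integrable fun w : ℂ => ((1 + ‖w‖) ^ 3)⁻¹ := by
  have h := integrable_one_add_norm (E := ℂ) (μ := volume) (r := 3)
    (by rw [Complex.finrank_real_complex]; norm_num)
  refine h.congr (Eventually.of_forall fun w => ?_)
  simp only
  rw [Real.rpow_neg (by positivity)]
  congr 1
  exact_mod_cast Real.rpow_natCast (1 + ‖w‖) 3

theorem integrable_pow_mul_norm_charFun_logZetaLaw {σ : ℝ} (hσ : 1 / 2 < σ) (hσ' : σ ≤ 3 / 4)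
    (n : ℕ) : Integrable fun w : ℂ => ‖w‖ ^ n * ‖charFun (logZetaLaw σ) w‖ := by
  have := isProbabilityMeasure_logZetaLaw hσ
  obtain ⟨C, c, hC, hc, h⟩ := exists_norm_charFun_logZetaLaw_le_exp_sqrt
  obtain ⟨K, hK, hK'⟩ := exists_exp_neg_sqrt_le hc (n + 3)
  refine (integrable_inv_one_add_norm_pow_three.const_mul (C * K)).mono' ?_
    (Eventually.of_forall fun w => ?_)
  · exact ((continuous_norm.pow n).mul continuous_charFun.norm).aestronglyMeasurable
  · rw [Real.norm_of_nonneg (by positivity)]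
    calc ‖w‖ ^ n * ‖charFun (logZetaLaw σ) w‖
        ≤ (1 + ‖w‖) ^ n * (C * (K / (1 + ‖w‖) ^ (n + 3))) := by
          gcongr
          · linarith
          · exact (h σ hσ hσ' w).trans (by gcongr; exact hK' _ (norm_nonneg w))
      _ = C * K * ((1 + ‖w‖) ^ 3)⁻¹ := by
          have : 1 + ‖w‖ ≠ 0 := by positivity
          field_simp
          ring

/-- If ψ dominates log|w|, the bound in terms of ψ gives exp(-|w|²ψ/144), more than enough.
Otherwise ψ is itself bounded by a logarithm of |w|, so powers of ψ are absorbed by the decay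
exp(-c√|w|). -/
theorem exists_norm_charFun_logZetaLaw_le_div_psi_pow :
    ∃ C : ℝ, 0 ≤ C ∧ ∀ σ : ℝ, 1 / 2 < σ → σ ≤ 3 / 4 → ∀ w : ℂ, 1 ≤ ‖w‖ →
      ‖charFun (logZetaLaw σ) w‖ ≤ C / psi σ ^ 4 * ((1 + ‖w‖) ^ 3)⁻¹ := by
  obtain ⟨C, c, hC, hc, h⟩ := exists_norm_charFun_logZetaLaw_le_exp_sqrt
  obtain ⟨K, hK, hK'⟩ := exists_exp_neg_sqrt_le hc 4
  refine ⟨max (24 * 144 ^ 4 * 8) (C * K * (144 ^ 4 * 300)), by positivity,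
    fun σ hσ hσ' w hw => ?_⟩
  have hψ := one_fourth_le_psi hσ hσ'
  have hψ0 : 0 < psi σ := by linarith
  have hw0 : 0 < ‖w‖ := by linarith
  rcases le_total (2 + 2 * Real.log (300 * ‖w‖)) (psi σ / 18) with hc1 | hc1
  · have h1 : ‖charFun (logZetaLaw σ) w‖ ≤ Real.exp (-(‖w‖ ^ 2 * psi σ / 144)) := by
      refine (norm_charFun_logZetaLaw_le_exp_psi hσ hw).trans (Real.exp_le_exp.2 ?_)
      have : ‖w‖ ^ 2 / 8 * (psi σ / 18)
          ≤ ‖w‖ ^ 2 / 8 * (psi σ / 9 - 2 - 2 * Real.log (300 * ‖w‖)) := by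
        gcongr; linarith
      linarith
    have h2 := Real.pow_div_factorial_le_exp (x := ‖w‖ ^ 2 * psi σ / 144) (by positivity) 4
    have h3 : (1 + ‖w‖) ^ 3 ≤ 8 * (‖w‖ ^ 2) ^ 4 := by
      calc (1 + ‖w‖) ^ 3 ≤ (2 * ‖w‖) ^ 3 := by gcongr; linarith
        _ = 8 * ‖w‖ ^ 3 := by ring
        _ ≤ 8 * ‖w‖ ^ 8 := by gcongr; norm_num
        _ = _ := by ring
    rw [div_le_iff₀ (by positivity)] at h2
    have h4 : ((4 : ℕ).factorial : ℝ) = 24 := by norm_num [Nat.factorial]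
    rw [h4] at h2
    refine h1.trans (le_trans ?_ (mul_le_mul_of_nonneg_right
      (div_le_div_of_nonneg_right (le_max_left _ _) (by positivity)) (by positivity)))
    rw [Real.exp_neg, ← div_eq_mul_inv, le_div_iff₀ (by positivity), le_div_iff₀ (by positivity),
      mul_assoc, inv_mul_le_iff₀ (Real.exp_pos _)]
    calc (1 + ‖w‖) ^ 3 * psi σ ^ 4 ≤ 8 * (‖w‖ ^ 2) ^ 4 * psi σ ^ 4 := by gcongr
      _ = 8 * 144 ^ 4 * (‖w‖ ^ 2 * psi σ / 144) ^ 4 := by ring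
      _ ≤ 8 * 144 ^ 4 * (Real.exp (‖w‖ ^ 2 * psi σ / 144) * 24) := by gcongr
      _ = _ := by ring
  -- The fourth root makes ψ⁴ at most linear in |w|, so one extra power of 1 + |w| in the decay
  -- suffices.
  · set x := (300 * ‖w‖) ^ (1 / 4 : ℝ) with hx
    have hx0 : 0 < x := by positivity
    have hx4 : x ^ 4 = 300 * ‖w‖ := by
      rw [hx, ← Real.rpow_natCast, ← Real.rpow_mul (by positivity)]; norm_num
    have h1 : Real.log (300 * ‖w‖) ≤ 4 * (x - 1) := by
      rw [← hx4, Real.log_pow]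
      push_cast
      linarith [Real.log_le_sub_one_of_pos hx0]
    have h2 : psi σ ≤ 144 * x := by linarith
    have h3 : psi σ ^ 4 ≤ 144 ^ 4 * 300 * (1 + ‖w‖) := by
      calc psi σ ^ 4 ≤ (144 * x) ^ 4 := by gcongr
        _ = 144 ^ 4 * x ^ 4 := by ring
        _ = 144 ^ 4 * 300 * ‖w‖ := by rw [hx4]; ring
        _ ≤ _ := by gcongr; linarith
    have h4 : ‖charFun (logZetaLaw σ) w‖ ≤ C * (K / (1 + ‖w‖) ^ 4) :=
      (h σ hσ hσ' w).trans (by gcongr; exact hK' _ (norm_nonneg w))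
    refine h4.trans (le_trans ?_ (mul_le_mul_of_nonneg_right
      (div_le_div_of_nonneg_right (le_max_right _ _) (by positivity)) (by positivity)))
    rw [← div_eq_mul_inv, le_div_iff₀ (by positivity), le_div_iff₀ (by positivity)]
    calc C * (K / (1 + ‖w‖) ^ 4) * (1 + ‖w‖) ^ 3 * psi σ ^ 4
        ≤ C * (K / (1 + ‖w‖) ^ 4) * (1 + ‖w‖) ^ 3 * (144 ^ 4 * 300 * (1 + ‖w‖)) := by gcongr
      _ = C * K * (144 ^ 4 * 300) := by
          have : 1 + ‖w‖ ≠ 0 := by positivity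
          field_simp

/-! ### Expansion of the characteristic function at the origin -/

/-- The error is quadratic in the sum of the norms. Applied to terms of size |w|³, it is of order
|w|^6. -/
theorem norm_prod_one_add_sub_one_sub_sum_le {ι : Type*} (s : Finset ι) (f : ι → ℂ) :
    ‖∏ i ∈ s, (1 + f i) - 1 - ∑ i ∈ s, f i‖
      ≤ (∑ i ∈ s, ‖f i‖) ^ 2 * Real.exp (∑ i ∈ s, ‖f i‖) := by
  classical
  induction s using Finset.induction_on with
  | empty => simp
  | insert a s ha ih =>
    rw [Finset.prod_insert ha, Finset.sum_insert ha, Finset.sum_insert ha]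
    set S := ∑ i ∈ s, ‖f i‖ with hS
    have hS0 : 0 ≤ S := Finset.sum_nonneg fun i _ => norm_nonneg _
    -- From e^S - 1 ≤ S e^S, which is 1 - S ≤ e^{-S} multiplied by e^S.
    have h1 : ‖∏ i ∈ s, (1 + f i) - 1‖ ≤ S * Real.exp S := by
      refine (Finset.norm_prod_one_add_sub_one_le s f).trans ?_
      have := Real.add_one_le_exp (-S)
      rw [Real.exp_neg] at this
      have h := mul_le_mul_of_nonneg_right this (Real.exp_pos S).le
      rw [inv_mul_cancel₀ (Real.exp_pos S).ne'] at h
      rw [← hS]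
      linarith
    have hid : (1 + f a) * ∏ i ∈ s, (1 + f i) - 1 - (f a + ∑ i ∈ s, f i)
        = (∏ i ∈ s, (1 + f i) - 1 - ∑ i ∈ s, f i) + f a * (∏ i ∈ s, (1 + f i) - 1) := by ring
    rw [hid]
    refine (norm_add_le _ _).trans ?_
    rw [norm_mul]
    have ha0 := norm_nonneg (f a)
    calc _ ≤ S ^ 2 * Real.exp S + ‖f a‖ * (S * Real.exp S) := by gcongr
      _ = (S ^ 2 + ‖f a‖ * S) * Real.exp S := by ring
      _ ≤ (‖f a‖ + S) ^ 2 * Real.exp (‖f a‖ + S) := by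
          gcongr
          · nlinarith [mul_nonneg ha0 hS0]
          · linarith

theorem summable_eulerCorrection {w : ℂ} (hw : ‖w‖ ≤ 1) :
    Summable fun p => eulerCorrection (primeRadius (1 / 2) p) w := by
  refine Summable.of_norm_bounded (((summable_primeRadius_pow (σ := 1 / 2) (n := 3)
    (by norm_num)).mul_right (‖w‖ ^ 3)).mul_left 729) fun p => ?_
  exact norm_eulerCorrection_le (primeRadius_pos _ p).le (primeRadius_le le_rfl p) hw

/-- Three errors are bounded on every finite set of primes: replacing the product by a sum,
truncating each factor after degree five, and moving each correction from σ to 1/2. The bounds are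
uniform in the finite set, so they pass to the limit. -/
theorem exists_norm_charFun_mul_exp_sub_le :
    ∃ C : ℝ, 0 ≤ C ∧ ∀ σ : ℝ, 1 / 2 < σ → ∀ w : ℂ, ‖w‖ ≤ 1 →
      ‖charFun (logZetaLaw σ) w * Real.exp (psi σ * ‖w‖ ^ 2 / 4)
          - (1 + ∑' p, eulerCorrection (primeRadius (1 / 2) p) w)‖
        ≤ C * (‖w‖ ^ 6 + (σ - 1 / 2)) := by
  obtain ⟨C, hC, hloc⟩ := exists_norm_eulerChar_mul_exp_sub_le
  set A := ∑' p, primeRadius (1 / 2) p ^ 3 with hA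
  set B := ∑' p : Nat.Primes, ((p : ℕ) : ℝ) ^ (-(5 / 4) : ℝ) with hB
  have hAs : Summable fun p => primeRadius (1 / 2) p ^ 3 := summable_primeRadius_pow (by norm_num)
  have hBs : Summable fun p : Nat.Primes => ((p : ℕ) : ℝ) ^ (-(5 / 4) : ℝ) :=
    Nat.Primes.summable_rpow.2 (by norm_num)
  have hA0 : 0 ≤ A := tsum_nonneg fun p => pow_nonneg (primeRadius_pos _ p).le _
  have hB0 : 0 ≤ B := tsum_nonneg fun p => by positivity
  set D := (729 + C) * A with hD
  have hD0 : 0 ≤ D := by positivity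
  refine ⟨D ^ 2 * Real.exp D + C * A + 8000 * B, by positivity, fun σ hσ w hw => ?_⟩
  have hσ0 : 0 ≤ σ - 1 / 2 := by linarith
  set h : Nat.Primes → ℂ := fun p => eulerChar (primeRadius σ p) w
    * Real.exp (eulerVar (primeRadius σ p) * ‖w‖ ^ 2 / 4) - 1 with hh
  have hr0 := fun p => (primeRadius_pos σ p).le
  have hr1 := fun p => primeRadius_le hσ.le p
  have hrA : ∀ p, primeRadius σ p ^ 3 ≤ primeRadius (1 / 2) p ^ 3 := fun p =>
    pow_le_pow_left₀ (hr0 p) (primeRadius_anti hσ.le p) 3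
  have herr : ∀ p, ‖h p - eulerCorrection (primeRadius σ p) w‖
      ≤ C * ‖w‖ ^ 6 * primeRadius (1 / 2) p ^ 3 := by
    intro p
    refine (hloc _ (hr0 p) (hr1 p) w hw).trans ?_
    calc C * (primeRadius σ p ^ 3 * ‖w‖ ^ 6) ≤ C * (primeRadius (1 / 2) p ^ 3 * ‖w‖ ^ 6) := by
          exact mul_le_mul_of_nonneg_left (mul_le_mul_of_nonneg_right (hrA p) (by positivity)) hC
      _ = _ := by ring
  have hnorm : ∀ p, ‖h p‖ ≤ (729 + C) * ‖w‖ ^ 3 * primeRadius (1 / 2) p ^ 3 := by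
    intro p
    have h1 := herr p
    have h2 := norm_eulerCorrection_le (hr0 p) (hr1 p) hw
    have h3 : ‖w‖ ^ 6 ≤ ‖w‖ ^ 3 := pow_le_pow_of_le_one (norm_nonneg _) hw (by norm_num)
    have h4 : ‖h p‖ ≤ ‖h p - eulerCorrection (primeRadius σ p) w‖
        + ‖eulerCorrection (primeRadius σ p) w‖ := by
      simpa using norm_add_le (h p - eulerCorrection (primeRadius σ p) w)
        (eulerCorrection (primeRadius σ p) w)
    have h5 : 0 ≤ primeRadius (1 / 2) p ^ 3 := pow_nonneg (primeRadius_pos _ p).le _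
    have h6 : C * ‖w‖ ^ 6 * primeRadius (1 / 2) p ^ 3
        ≤ C * ‖w‖ ^ 3 * primeRadius (1 / 2) p ^ 3 := by gcongr
    have h7 : 729 * (primeRadius σ p ^ 3 * ‖w‖ ^ 3)
        ≤ 729 * (primeRadius (1 / 2) p ^ 3 * ‖w‖ ^ 3) :=
      mul_le_mul_of_nonneg_left (mul_le_mul_of_nonneg_right (hrA p) (by positivity)) (by norm_num)
    linarith
  have hlip : ∀ p, ‖eulerCorrection (primeRadius σ p) w
      - eulerCorrection (primeRadius (1 / 2) p) w‖
      ≤ 8000 * (σ - 1 / 2) * ((p : ℕ) : ℝ) ^ (-(5 / 4) : ℝ) := by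
    intro p
    refine (norm_eulerCorrection_sub_le (hr0 p) (primeRadius_pos _ p).le
      (primeRadius_anti hσ.le p) le_rfl (primeRadius_le le_rfl p) hw).trans ?_
    linarith [primeRadius_half_sub_le hσ.le p]
  have hfin : ∀ s : Finset Nat.Primes,
      ‖(∏ p ∈ s, eulerChar (primeRadius σ p) w)
          * Real.exp ((∑ p ∈ s, eulerVar (primeRadius σ p)) * ‖w‖ ^ 2 / 4)
          - (1 + ∑ p ∈ s, eulerCorrection (primeRadius (1 / 2) p) w)‖
        ≤ (D ^ 2 * Real.exp D + C * A + 8000 * B) * (‖w‖ ^ 6 + (σ - 1 / 2)) := by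
    intro s
    have hprod : (∏ p ∈ s, eulerChar (primeRadius σ p) w)
        * Real.exp ((∑ p ∈ s, eulerVar (primeRadius σ p)) * ‖w‖ ^ 2 / 4)
        = ∏ p ∈ s, (1 + h p) := by
      rw [Finset.sum_mul, Finset.sum_div, Real.exp_sum, Complex.ofReal_prod,
        ← Finset.prod_mul_distrib]
      exact Finset.prod_congr rfl fun p _ => by simp [hh]
    have hSA : ∑ p ∈ s, primeRadius (1 / 2) p ^ 3 ≤ A :=
      hAs.sum_le_tsum s fun p _ => pow_nonneg (primeRadius_pos _ p).le _
    have hS : ∑ p ∈ s, ‖h p‖ ≤ D * ‖w‖ ^ 3 := by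
      calc ∑ p ∈ s, ‖h p‖ ≤ ∑ p ∈ s, (729 + C) * ‖w‖ ^ 3 * primeRadius (1 / 2) p ^ 3 :=
            Finset.sum_le_sum fun p _ => hnorm p
        _ = (729 + C) * ‖w‖ ^ 3 * ∑ p ∈ s, primeRadius (1 / 2) p ^ 3 := by rw [Finset.mul_sum]
        _ ≤ (729 + C) * ‖w‖ ^ 3 * A := by gcongr
        _ = D * ‖w‖ ^ 3 := by rw [hD]; ring
    have hS0 : 0 ≤ ∑ p ∈ s, ‖h p‖ := Finset.sum_nonneg fun p _ => norm_nonneg _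
    have hS' : ∑ p ∈ s, ‖h p‖ ≤ D :=
      hS.trans (mul_le_of_le_one_right hD0 (pow_le_one₀ (norm_nonneg _) hw))
    have e1 : ‖∏ p ∈ s, (1 + h p) - 1 - ∑ p ∈ s, h p‖ ≤ D ^ 2 * Real.exp D * ‖w‖ ^ 6 := by
      refine (norm_prod_one_add_sub_one_sub_sum_le s h).trans ?_
      calc _ ≤ (D * ‖w‖ ^ 3) ^ 2 * Real.exp D := by gcongr
        _ = _ := by ring
    have e2 : ‖∑ p ∈ s, (h p - eulerCorrection (primeRadius σ p) w)‖ ≤ C * A * ‖w‖ ^ 6 := by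
      refine (norm_sum_le_of_le s fun p _ => herr p).trans ?_
      rw [← Finset.mul_sum]
      calc C * ‖w‖ ^ 6 * ∑ p ∈ s, primeRadius (1 / 2) p ^ 3 ≤ C * ‖w‖ ^ 6 * A := by gcongr
        _ = _ := by ring
    have e3 : ‖∑ p ∈ s, (eulerCorrection (primeRadius σ p) w
        - eulerCorrection (primeRadius (1 / 2) p) w)‖ ≤ 8000 * B * (σ - 1 / 2) := by
      refine (norm_sum_le_of_le s fun p _ => hlip p).trans ?_
      rw [← Finset.mul_sum]
      calc 8000 * (σ - 1 / 2) * ∑ p ∈ s, ((p : ℕ) : ℝ) ^ (-(5 / 4) : ℝ)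
          ≤ 8000 * (σ - 1 / 2) * B := by
            gcongr
            exact hBs.sum_le_tsum s fun p _ => by positivity
        _ = _ := by ring
    have hid : (∏ p ∈ s, (1 + h p)) - (1 + ∑ p ∈ s, eulerCorrection (primeRadius (1 / 2) p) w)
        = (∏ p ∈ s, (1 + h p) - 1 - ∑ p ∈ s, h p)
          + ∑ p ∈ s, (h p - eulerCorrection (primeRadius σ p) w)
          + ∑ p ∈ s, (eulerCorrection (primeRadius σ p) w
            - eulerCorrection (primeRadius (1 / 2) p) w) := by
      rw [Finset.sum_sub_distrib (f := h), Finset.sum_sub_distrib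
        (f := fun p => eulerCorrection (primeRadius σ p) w)]
      ring
    rw [hprod, hid]
    refine norm_add₃_le.trans ((add_le_add (add_le_add e1 e2) e3).trans ?_)
    have k1 : 0 ≤ D ^ 2 * Real.exp D * (σ - 1 / 2) := by positivity
    have k2 : 0 ≤ C * A * (σ - 1 / 2) := by positivity
    have k3 : 0 ≤ 8000 * B * ‖w‖ ^ 6 := by positivity
    linarith
  have l1 := tendsto_prod_eulerChar_logZetaLaw hσ w
  have l2 : Tendsto (fun N => ((Real.exp ((∑ p ∈ primesUpTo N, eulerVar (primeRadius σ p))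
      * ‖w‖ ^ 2 / 4) : ℝ) : ℂ)) atTop (𝓝 ((Real.exp (psi σ * ‖w‖ ^ 2 / 4) : ℝ) : ℂ)) := by
    have h1 : Tendsto (fun N => ∑ p ∈ primesUpTo N, eulerVar (primeRadius σ p)) atTop
        (𝓝 (psi σ)) := (hasSum_eulerVar_psi hσ).comp tendsto_primesUpTo
    have hcont : Continuous fun x : ℝ => ((Real.exp (x * ‖w‖ ^ 2 / 4) : ℝ) : ℂ) := by fun_prop
    exact (hcont.tendsto _).comp h1
  have l3 : Tendsto (fun N => 1 + ∑ p ∈ primesUpTo N, eulerCorrection (primeRadius (1 / 2) p) w)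
      atTop (𝓝 (1 + ∑' p, eulerCorrection (primeRadius (1 / 2) p) w)) :=
    ((summable_eulerCorrection hw).hasSum.comp tendsto_primesUpTo).const_add 1
  exact le_of_tendsto ((l1.mul l2).sub l3).norm (Eventually.of_forall fun N => hfin _)

/-! ### The correction terms are polynomials -/

/-- The index set `{(m, n) : m + n ≤ 5}`. -/
def triangleFive : Finset (ℕ × ℕ) :=
  (Finset.range 6 ×ˢ Finset.range 6).filter (fun q => q.1 + q.2 ≤ 5)

theorem mem_triangleFive {q : ℕ × ℕ} : q ∈ triangleFive ↔ q.1 + q.2 ≤ 5 := by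
  simp [triangleFive]; omega

/-- The monomial `u ^ m * v ^ n` as a function of `u + i v` in the closed unit disc. -/
noncomputable def discMonomial (q : ℕ × ℕ) (w : {w : ℂ // ‖w‖ ≤ 1}) : ℂ :=
  ((w : ℂ).re : ℂ) ^ q.1 * ((w : ℂ).im : ℂ) ^ q.2

/-- The homogeneous polynomials of degree `n`, as functions on the closed unit disc. -/
noncomputable def discHomogeneous (n : ℕ) : Submodule ℂ ({w : ℂ // ‖w‖ ≤ 1} → ℂ) :=
  Submodule.span ℂ (discMonomial '' {q | q.1 + q.2 = n})

theorem discMonomial_mem {q : ℕ × ℕ} {n : ℕ} (h : q.1 + q.2 = n) :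
    discMonomial q ∈ discHomogeneous n :=
  Submodule.subset_span ⟨q, h, rfl⟩

theorem mul_mem_discHomogeneous {m n : ℕ} {f g : {w : ℂ // ‖w‖ ≤ 1} → ℂ}
    (hf : f ∈ discHomogeneous m) (hg : g ∈ discHomogeneous n) :
    f * g ∈ discHomogeneous (m + n) := by
  have h := Submodule.mul_mem_mul hf hg
  rw [discHomogeneous, discHomogeneous, Submodule.span_mul_span] at h
  refine Submodule.span_mono ?_ h
  rintro _ ⟨_, ⟨q, hq, rfl⟩, _, ⟨q', hq', rfl⟩, rfl⟩
  refine ⟨(q.1 + q'.1, q.2 + q'.2), ?_, ?_⟩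
  · simp only [Set.mem_ofPred_eq] at hq hq' ⊢; omega
  · funext w; simp only [discMonomial, Pi.mul_apply]; ring

theorem integrable_re_pow_mul_im_pow {r : ℝ} (hr : 0 ≤ r) (hr' : r ≤ 3 / 4) (a b : ℕ) :
    Integrable (fun z => (eulerLog r z).re ^ a * (eulerLog r z).im ^ b) circleUniform := by
  have hm := measurable_eulerLog r
  refine Integrable.of_bound (C := (3 * r) ^ a * (3 * r) ^ b)
    (by fun_prop) ?_
  filter_upwards [ae_norm_eulerLog_le hr hr'] with z h
  rw [norm_mul, norm_pow, norm_pow]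
  gcongr
  · exact (Complex.abs_re_le_norm _).trans h
  · exact (Complex.abs_im_le_norm _).trans h

theorem eulerMoment_eq_sum {r : ℝ} (hr : 0 ≤ r) (hr' : r ≤ 3 / 4) (w : ℂ) (j : ℕ) :
    eulerMoment r w j = ∑ i ∈ Finset.range (j + 1),
      (j.choose i * ∫ z, (eulerLog r z).re ^ i * (eulerLog r z).im ^ (j - i) ∂circleUniform)
        * (w.re ^ i * w.im ^ (j - i)) := by
  have h : ∀ z, ⟪eulerLog r z, w⟫ ^ j = ∑ i ∈ Finset.range (j + 1),
      (w.re ^ i * w.im ^ (j - i) * j.choose i)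
        * ((eulerLog r z).re ^ i * (eulerLog r z).im ^ (j - i)) := by
    intro z
    have : ⟪eulerLog r z, w⟫ = (eulerLog r z).re * w.re + (eulerLog r z).im * w.im := by
      rw [Complex.inner]; simp; ring
    rw [this, add_pow]
    refine Finset.sum_congr rfl fun i _ => ?_
    rw [mul_pow, mul_pow]; ring
  simp only [eulerMoment, h]
  rw [integral_finsetSum _ fun i _ => (integrable_re_pow_mul_im_pow hr hr' i (j - i)).const_mul _]
  refine Finset.sum_congr rfl fun i _ => ?_
  rw [integral_const_mul]; ring

theorem eulerTaylor_mem_discHomogeneous {r : ℝ} (hr : 0 ≤ r) (hr' : r ≤ 3 / 4) (j : ℕ) :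
    (fun w : {w : ℂ // ‖w‖ ≤ 1} => eulerTaylor r w j) ∈ discHomogeneous j := by
  have h : (fun w : {w : ℂ // ‖w‖ ≤ 1} => eulerTaylor r w j)
      = ∑ i ∈ Finset.range (j + 1), (Complex.I ^ j / j.factorial
        * ((j.choose i * ∫ z, (eulerLog r z).re ^ i * (eulerLog r z).im ^ (j - i) ∂circleUniform : ℝ)
          : ℂ)) • discMonomial (i, j - i) := by
    funext w
    rw [eulerTaylor, eulerMoment_eq_sum hr hr', Finset.sum_apply, Complex.ofReal_sum,
      Finset.mul_sum, Finset.sum_div]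
    refine Finset.sum_congr rfl fun i _ => ?_
    simp only [Pi.smul_apply, discMonomial, smul_eq_mul, Complex.ofReal_mul, Complex.ofReal_pow]
    ring
  rw [h]
  refine Submodule.sum_mem _ fun i hi => Submodule.smul_mem _ _ (discMonomial_mem ?_)
  have := Finset.mem_range.1 hi
  simp only; omega

/-- The span of the monomials of degree `3`, `4` and `5` on the closed unit disc. -/
noncomputable def discCorrection : Submodule ℂ ({w : ℂ // ‖w‖ ≤ 1} → ℂ) :=
  Submodule.span ℂ (discMonomial '' ((triangleFive.filter fun q => 3 ≤ q.1 + q.2 : Finset _) : Set _))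

theorem discHomogeneous_le {n : ℕ} (h3 : 3 ≤ n) (h5 : n ≤ 5) :
    discHomogeneous n ≤ discCorrection := by
  refine Submodule.span_mono (Set.image_mono fun q hq => ?_)
  simp only [Set.mem_ofPred_eq] at hq
  simp only [Finset.coe_filter, mem_triangleFive, Set.mem_ofPred_eq]
  omega

theorem eulerCorrection_mem_discCorrection {r : ℝ} (hr : 0 ≤ r) (hr' : r ≤ 3 / 4) :
    (fun w : {w : ℂ // ‖w‖ ≤ 1} => eulerCorrection r w) ∈ discCorrection := by
  have hτ := fun j => eulerTaylor_mem_discHomogeneous hr hr' j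
  have h22 := Submodule.smul_mem _ (1 / 2 : ℂ) (mul_mem_discHomogeneous (hτ 2) (hτ 2))
  have h23 := mul_mem_discHomogeneous (hτ 2) (hτ 3)
  have h := sub_mem (sub_mem (add_mem (add_mem
    (discHomogeneous_le le_rfl (by norm_num) (hτ 3))
    (discHomogeneous_le (by norm_num) (by norm_num) (hτ 4)))
    (discHomogeneous_le (by norm_num) (by norm_num) (hτ 5)))
    (discHomogeneous_le (by norm_num) (by norm_num) h22))
    (discHomogeneous_le (by norm_num) (by norm_num) h23)
  convert h using 1
  funext w
  simp only [eulerCorrection, Pi.sub_apply, Pi.add_apply, Pi.smul_apply, Pi.mul_apply, smul_eq_mul]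
  ring

/-- Each correction lies in the span of finitely many monomials. A finite-dimensional subspace is
closed under pointwise convergence, so the infinite sum stays in it and no coefficientwise
convergence is needed. The disc appears because summability has been established only for |w| ≤ 1.
-/
theorem exists_one_add_tsum_eulerCorrection_eq :
    ∃ t : ℕ × ℕ → ℂ, t (0, 0) = 1 ∧
      ∀ w : ℂ, ‖w‖ ≤ 1 → 1 + ∑' p, eulerCorrection (primeRadius (1 / 2) p) w
        = ∑ q ∈ triangleFive, t q * ((w.re : ℂ) ^ q.1 * (w.im : ℂ) ^ q.2) := by
  have hfd : FiniteDimensional ℂ discCorrection :=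
    FiniteDimensional.span_of_finite ℂ ((Finset.finite_toSet _).image _)
  have hcl : IsClosed (discCorrection : Set ({w : ℂ // ‖w‖ ≤ 1} → ℂ)) :=
    discCorrection.closed_of_finiteDimensional
  have hsum : HasSum (fun p (w : {w : ℂ // ‖w‖ ≤ 1}) => eulerCorrection (primeRadius (1 / 2) p) w)
      (fun w => ∑' p, eulerCorrection (primeRadius (1 / 2) p) w) :=
    Pi.hasSum.2 fun w => (summable_eulerCorrection w.2).hasSum
  have hmem : (fun w : {w : ℂ // ‖w‖ ≤ 1} => ∑' p, eulerCorrection (primeRadius (1 / 2) p) w)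
      ∈ discCorrection :=
    hcl.mem_of_tendsto hsum (Eventually.of_forall fun s => Submodule.sum_mem _ fun p _ =>
      eulerCorrection_mem_discCorrection (primeRadius_pos _ p).le (primeRadius_le le_rfl p))
  obtain ⟨U, hU⟩ : ∃ U, U = triangleFive.filter fun q => 3 ≤ q.1 + q.2 := ⟨_, rfl⟩
  rw [discCorrection, ← hU] at hmem
  obtain ⟨c, hc⟩ := (Submodule.mem_span_image_finset_iff_exists_fun ℂ).1 hmem
  refine ⟨fun q => if q = (0, 0) then 1 else if h : q ∈ U then c ⟨q, h⟩ else 0, by simp, ?_⟩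
  intro w hw
  have h0 := congrFun hc ⟨w, hw⟩
  simp only at h0
  rw [← h0, Finset.sum_apply, ← Finset.add_sum_erase _ _ (mem_triangleFive.2 (by simp : (0 : ℕ) + 0 ≤ 5) :
    ((0, 0) : ℕ × ℕ) ∈ triangleFive)]
  congr 1
  · simp
  rw [← Finset.sum_subset (s₁ := U)]
  · rw [← Finset.sum_coe_sort U]
    refine Finset.sum_congr rfl fun q _ => ?_
    have hq0 : (q : ℕ × ℕ) ≠ (0, 0) := by
      intro h
      have h1 : (q : ℕ × ℕ) ∈ triangleFive.filter fun q => 3 ≤ q.1 + q.2 := by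
        rw [← hU]; exact q.2
      have := (Finset.mem_filter.1 h1).2
      simp [h] at this
    simp [hq0, discMonomial]
  · intro q hq
    have := Finset.mem_filter.1 (hU ▸ hq)
    refine Finset.mem_erase.2 ⟨?_, this.1⟩
    rintro rfl
    simp at this
  · intro q hq hqU
    simp [hqU, (Finset.mem_erase.1 hq).1]

/-! ### Gaussian moments with a phase -/

/-- The polynomials `Q_j` with
`∫ u ^ j * exp (-u² / 4 - i u x) du = 2 √π * Q_j(x) * exp (-x²)`. -/
noncomputable def gaussPoly : ℕ → Polynomial ℂ
  | 0 => 1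
  | 1 => Polynomial.C (-2 * Complex.I) * Polynomial.X
  | (j + 2) => Polynomial.C (-2 * Complex.I) * Polynomial.X * gaussPoly (j + 1)
      + Polynomial.C (2 * ((j : ℂ) + 1)) * gaussPoly j

theorem natDegree_gaussPoly_le : ∀ j, (gaussPoly j).natDegree ≤ j
  | 0 => by simp [gaussPoly]
  | 1 => by
    rw [gaussPoly]
    compute_degree
  | (j + 2) => by
    have h1 := natDegree_gaussPoly_le (j + 1)
    have h0 := natDegree_gaussPoly_le j
    rw [gaussPoly]
    refine Polynomial.natDegree_add_le_of_le (m := j + 2) (n := j + 2) ?_ ?_ |>.trans (by simp)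
    · refine Polynomial.natDegree_mul_le.trans ?_
      have : (Polynomial.C (-2 * Complex.I) * Polynomial.X).natDegree ≤ 1 := by compute_degree
      omega
    · refine (Polynomial.natDegree_C_mul_le _ _).trans (by omega)

theorem integrable_pow_mul_cexp {b : ℝ} (hb : 0 < b) (x : ℝ) (j : ℕ) :
    Integrable fun u : ℝ => (u : ℂ) ^ j * Complex.exp (-(b * u ^ 2) - Complex.I * x * u) := by
  have h := (integrable_rpow_mul_exp_neg_mul_sq hb (s := j) (by linarith [j.cast_nonneg (α := ℝ)])).norm
  refine h.mono' (by fun_prop) (Eventually.of_forall fun u => ?_)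
  rw [norm_mul, norm_mul, Real.rpow_natCast, Complex.norm_exp, norm_pow, norm_pow, Complex.norm_real,
    Real.norm_of_nonneg (Real.exp_pos _).le]
  gcongr
  have : ((-(b * u ^ 2) - Complex.I * x * u : ℂ)) = ((-(b * u ^ 2) : ℝ) : ℂ) + ((-(x * u) : ℝ) : ℂ) * Complex.I := by
    push_cast; ring
  rw [this, Complex.add_re, Complex.re_ofReal_mul, Complex.I_re, Complex.ofReal_re]
  linarith

theorem hasDerivAt_pow_mul_cexp (b x : ℝ) (j : ℕ) (u : ℝ) :
    HasDerivAt (fun u : ℝ => (u : ℂ) ^ (j + 1) * Complex.exp (-(b * u ^ 2) - Complex.I * x * u))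
      ((j + 1) * ((u : ℂ) ^ j * Complex.exp (-(b * u ^ 2) - Complex.I * x * u))
        - 2 * b * ((u : ℂ) ^ (j + 2) * Complex.exp (-(b * u ^ 2) - Complex.I * x * u))
        - Complex.I * x * ((u : ℂ) ^ (j + 1) * Complex.exp (-(b * u ^ 2) - Complex.I * x * u))) u := by
  have h0 : HasDerivAt (fun u : ℂ => u ^ (j + 1) * Complex.exp (-(b * u ^ 2) - Complex.I * x * u))
      (((j + 1 : ℕ) * (u : ℂ) ^ j) * Complex.exp (-(b * u ^ 2) - Complex.I * x * u)
        + (u : ℂ) ^ (j + 1) * (Complex.exp (-(b * u ^ 2) - Complex.I * x * u)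
          * (-(b * (2 * u)) - Complex.I * x))) (u : ℂ) := by
    have e1 := hasDerivAt_pow (j + 1) (u : ℂ)
    have e2 : HasDerivAt (fun u : ℂ => -((b : ℂ) * u ^ 2) - Complex.I * x * u)
        (-(b * (2 * u)) - Complex.I * x) (u : ℂ) := by
      have a := ((hasDerivAt_pow 2 (u : ℂ)).const_mul (b : ℂ)).neg
      have b' := (hasDerivAt_id (u : ℂ)).const_mul (Complex.I * x)
      exact (a.sub b').congr_deriv (by simp)
    exact e1.mul e2.cexp
  convert h0.comp_ofReal using 1
  push_cast; ring

theorem hasDerivAt_cexp_phase (b x : ℝ) (u : ℝ) :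
    HasDerivAt (fun u : ℝ => Complex.exp (-(b * u ^ 2) - Complex.I * x * u))
      (- 2 * b * ((u : ℂ) ^ 1 * Complex.exp (-(b * u ^ 2) - Complex.I * x * u))
        - Complex.I * x * ((u : ℂ) ^ 0 * Complex.exp (-(b * u ^ 2) - Complex.I * x * u))) u := by
  have h0 : HasDerivAt (fun u : ℂ => Complex.exp (-(b * u ^ 2) - Complex.I * x * u))
      (Complex.exp (-(b * u ^ 2) - Complex.I * x * u)
          * (-(b * (2 * u)) - Complex.I * x)) (u : ℂ) := by
    have e2 : HasDerivAt (fun u : ℂ => -((b : ℂ) * u ^ 2) - Complex.I * x * u)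
        (-(b * (2 * u)) - Complex.I * x) (u : ℂ) := by
      have a := ((hasDerivAt_pow 2 (u : ℂ)).const_mul (b : ℂ)).neg
      have b' := (hasDerivAt_id (u : ℂ)).const_mul (Complex.I * x)
      exact (a.sub b').congr_deriv (by simp)
    exact e2.cexp
  convert h0.comp_ofReal using 1
  ring

/-- The phased Gaussian moment `∫ u ^ j * exp (-u² / (4 s²) - i x u) du`. -/
noncomputable def gaussMoment (s x : ℝ) (j : ℕ) : ℂ :=
  ∫ u : ℝ, (u : ℂ) ^ j * Complex.exp (-((1 / (4 * s ^ 2) : ℝ) * u ^ 2) - Complex.I * x * u)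

theorem gaussMoment_zero {s : ℝ} (hs : 0 < s) (x : ℝ) :
    gaussMoment s x 0 = ((2 * √Real.pi * s * Real.exp (-(s * x) ^ 2) : ℝ) : ℂ) := by
  have h := fourierIntegral_gaussian (b := ((1 / (4 * s ^ 2) : ℝ) : ℂ))
    (by rw [Complex.ofReal_re]; positivity) (-(x : ℂ))
  have e : gaussMoment s x 0 = ∫ (u : ℝ), Complex.exp (Complex.I * -(x : ℂ) * u)
      * Complex.exp (-((1 / (4 * s ^ 2) : ℝ) : ℂ) * u ^ 2) := by
    rw [gaussMoment]
    refine integral_congr_ae (Eventually.of_forall fun u => ?_)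
    simp only [pow_zero, one_mul]
    rw [← Complex.exp_add]; congr 1; ring
  rw [e, h]
  have h1 : ((Real.pi : ℂ) / ((1 / (4 * s ^ 2) : ℝ) : ℂ)) ^ (1 / 2 : ℂ)
      = ((2 * √Real.pi * s : ℝ) : ℂ) := by
    have : (Real.pi : ℂ) / ((1 / (4 * s ^ 2) : ℝ) : ℂ) = ((Real.pi * (2 * s) ^ 2 : ℝ) : ℂ) := by
      push_cast; field_simp; ring
    rw [this, show (1 / 2 : ℂ) = ((1 / 2 : ℝ) : ℂ) by push_cast; rfl,
      ← Complex.ofReal_cpow (by positivity), ← Real.sqrt_eq_rpow, Real.sqrt_mul Real.pi_pos.le,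
      Real.sqrt_sq (by positivity)]
    congr 1; ring
  rw [h1, Complex.ofReal_mul (2 * √Real.pi * s), Complex.ofReal_exp]
  congr 2
  have : (s : ℂ) ≠ 0 := by exact_mod_cast hs.ne'
  push_cast
  field_simp

theorem gaussMoment_one {s : ℝ} (hs : 0 < s) (x : ℝ) :
    gaussMoment s x 1 = -2 * Complex.I * s ^ 2 * x * gaussMoment s x 0 := by
  have hb : 0 < 1 / (4 * s ^ 2) := by positivity
  have i0 := integrable_pow_mul_cexp hb x 0
  have i1 := integrable_pow_mul_cexp hb x 1
  have h := integral_eq_zero_of_hasDerivAt_of_integrable (hasDerivAt_cexp_phase (1 / (4 * s ^ 2)) x)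
    ((i1.const_mul _).sub (i0.const_mul _)) (by simpa using i0)
  rw [integral_sub (i1.const_mul _) (i0.const_mul _), integral_const_mul, integral_const_mul] at h
  change _ * gaussMoment s x 1 - _ * gaussMoment s x 0 = 0 at h
  have hs0 : (s : ℂ) ≠ 0 := by exact_mod_cast hs.ne'
  push_cast at h
  field_simp at h
  linear_combination (-1 / 2 : ℂ) * h

/-- Integration by parts: the derivative of u^{j+1} times the phased Gaussian has integral zero.
This is the source of the recursion defining `gaussPoly`. -/
theorem gaussMoment_add_two {s : ℝ} (hs : 0 < s) (x : ℝ) (j : ℕ) :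
    gaussMoment s x (j + 2) = -2 * Complex.I * s ^ 2 * x * gaussMoment s x (j + 1)
      + 2 * (j + 1) * s ^ 2 * gaussMoment s x j := by
  have hb : 0 < 1 / (4 * s ^ 2) := by positivity
  have i0 := integrable_pow_mul_cexp hb x j
  have i1 := integrable_pow_mul_cexp hb x (j + 1)
  have i2 := integrable_pow_mul_cexp hb x (j + 2)
  have h := integral_eq_zero_of_hasDerivAt_of_integrable
    (hasDerivAt_pow_mul_cexp (1 / (4 * s ^ 2)) x j)
    (((i0.const_mul _).sub (i2.const_mul _)).sub (i1.const_mul _)) i1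
  have h' := integral_sub ((i0.const_mul (j + 1 : ℂ)).sub
    (i2.const_mul (2 * ((1 / (4 * s ^ 2) : ℝ) : ℂ)))) (i1.const_mul (Complex.I * x))
  simp only [Pi.sub_apply] at h'
  rw [h', integral_sub (i0.const_mul _) (i2.const_mul _), integral_const_mul, integral_const_mul,
    integral_const_mul] at h
  change _ * gaussMoment s x j - _ * gaussMoment s x (j + 2) - _ * gaussMoment s x (j + 1) = 0 at h
  have hs0 : (s : ℂ) ≠ 0 := by exact_mod_cast hs.ne'
  push_cast at h
  field_simp at h
  linear_combination (-1 / 2 : ℂ) * h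

theorem gaussMoment_eq {s : ℝ} (hs : 0 < s) (x : ℝ) : ∀ j, gaussMoment s x j
    = (2 * √Real.pi * Real.exp (-(s * x) ^ 2) : ℝ) * s ^ (j + 1)
      * (gaussPoly j).eval ((s * x : ℝ) : ℂ)
  | 0 => by
    rw [gaussMoment_zero hs, gaussPoly]; push_cast; simp; ring
  | 1 => by
    rw [gaussMoment_one hs, gaussMoment_zero hs, gaussPoly]; push_cast; simp; ring
  | (j + 2) => by
    rw [gaussMoment_add_two hs, gaussMoment_eq hs x (j + 1), gaussMoment_eq hs x j, gaussPoly]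
    push_cast; simp; ring

theorem integral_complex_mul (f g : ℝ → ℂ) :
    ∫ w : ℂ, f w.re * g w.im = (∫ u, f u) * ∫ v, g v := by
  rw [← integral_prod_mul, ← Measure.volume_eq_prod]
  exact Complex.volume_preserving_equiv_real_prod.integral_comp
    Complex.measurableEquivRealProd.measurableEmbedding (fun z : ℝ × ℝ => f z.1 * g z.2)

theorem cexp_neg_norm_sq_mul_cexp_inner (b : ℝ) (z w : ℂ) :
    (Real.exp (-b * ‖w‖ ^ 2) : ℂ) * Complex.exp (-(⟪w, z⟫ * Complex.I))
      = Complex.exp (-(b * w.re ^ 2) - Complex.I * z.re * w.re)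
        * Complex.exp (-(b * w.im ^ 2) - Complex.I * z.im * w.im) := by
  have h1 : ‖w‖ ^ 2 = w.re ^ 2 + w.im ^ 2 := by
    rw [← Complex.normSq_eq_norm_sq, Complex.normSq_apply]; ring
  have h2 : ⟪w, z⟫ = w.re * z.re + w.im * z.im := by rw [Complex.inner]; simp; ring
  rw [h1, h2, Complex.ofReal_exp, ← Complex.exp_add, ← Complex.exp_add]
  congr 1
  push_cast; ring

theorem integral_monomial_mul_gaussian {s : ℝ} (hs : 0 < s) (z : ℂ) (j k : ℕ) :
    ∫ w : ℂ, ((w.re : ℂ) ^ j * (w.im : ℂ) ^ k) * (Real.exp (-(1 / (4 * s ^ 2)) * ‖w‖ ^ 2) : ℂ)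
        * Complex.exp (-(⟪w, z⟫ * Complex.I))
      = (4 * Real.pi * Real.exp (-(s ^ 2 * (z.re ^ 2 + z.im ^ 2))) : ℝ) * s ^ (j + k + 2)
        * ((gaussPoly j).eval ((s * z.re : ℝ) : ℂ) * (gaussPoly k).eval ((s * z.im : ℝ) : ℂ)) := by
  have h : ∀ w : ℂ, ((w.re : ℂ) ^ j * (w.im : ℂ) ^ k)
      * (Real.exp (-(1 / (4 * s ^ 2)) * ‖w‖ ^ 2) : ℂ) * Complex.exp (-(⟪w, z⟫ * Complex.I))
      = (fun u : ℝ => (u : ℂ) ^ j * Complex.exp (-((1 / (4 * s ^ 2) : ℝ) * u ^ 2)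
          - Complex.I * z.re * u)) w.re
        * (fun u : ℝ => (u : ℂ) ^ k * Complex.exp (-((1 / (4 * s ^ 2) : ℝ) * u ^ 2)
          - Complex.I * z.im * u)) w.im := by
    intro w
    rw [mul_assoc, cexp_neg_norm_sq_mul_cexp_inner]; ring
  rw [integral_congr_ae (Eventually.of_forall h)]
  refine (integral_complex_mul (fun u : ℝ => (u : ℂ) ^ j
    * Complex.exp (-((1 / (4 * s ^ 2) : ℝ) * u ^ 2) - Complex.I * z.re * u)) (fun u : ℝ => (u : ℂ) ^ k
    * Complex.exp (-((1 / (4 * s ^ 2) : ℝ) * u ^ 2) - Complex.I * z.im * u))).trans ?_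
  change gaussMoment s z.re j * gaussMoment s z.im k = _
  rw [gaussMoment_eq hs, gaussMoment_eq hs]
  have e : Real.exp (-(s ^ 2 * (z.re ^ 2 + z.im ^ 2)))
      = Real.exp (-(s * z.re) ^ 2) * Real.exp (-(s * z.im) ^ 2) := by
    rw [← Real.exp_add]; congr 1; ring
  have hpi : ((√Real.pi : ℝ) : ℂ) ^ 2 = Real.pi := by
    rw [← Complex.ofReal_pow, Real.sq_sqrt Real.pi_pos.le]
  rw [e]
  push_cast
  rw [← hpi]
  ring

/-! ### The Gaussian approximation in closed form -/

/-- Regroups powers of s = ψ^{-1/2}: the monomial x^m y^n takes s^{2(m+n+1)} = ψ^{-(m+n+1)}, and the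
leftover power of s becomes the argument of the polynomial coefficient. -/
theorem pow_mul_eval_gaussPoly_mul_eval_gaussPoly (s x y : ℝ) {q : ℕ × ℕ} (hq : q ∈ triangleFive) :
    (s : ℂ) ^ (q.1 + q.2 + 2)
        * ((gaussPoly q.1).eval ((s * x : ℝ) : ℂ) * (gaussPoly q.2).eval ((s * y : ℝ) : ℂ))
      = ∑ r ∈ triangleFive, ((gaussPoly q.1).coeff r.1 * (gaussPoly q.2).coeff r.2)
        * ((s ^ (q.1 + q.2 - (r.1 + r.2)) * (s ^ 2) ^ (r.1 + r.2 + 1) * x ^ r.1 * y ^ r.2 : ℝ) : ℂ) := by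
  rw [mem_triangleFive] at hq
  have h1 := natDegree_gaussPoly_le q.1
  have h2 := natDegree_gaussPoly_le q.2
  rw [Polynomial.eval_eq_sum_range' (n := 6) (by omega), Polynomial.eval_eq_sum_range' (n := 6) (by omega),
    Finset.sum_mul_sum, ← Finset.sum_product', triangleFive, Finset.sum_filter, Finset.mul_sum]
  refine Finset.sum_congr rfl fun r _ => ?_
  -- The truncated subtraction in the exponent is harmless: if r.1 > q.1 or r.2 > q.2, a coefficient
  -- vanishes by the degree bound.
  rcases lt_or_ge q.1 r.1 with h | h
  · simp [Polynomial.coeff_eq_zero_of_natDegree_lt (h1.trans_lt h)]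
  rcases lt_or_ge q.2 r.2 with h' | h'
  · simp [Polynomial.coeff_eq_zero_of_natDegree_lt (h2.trans_lt h')]
  rw [if_pos (by omega)]
  obtain ⟨a, ha⟩ := Nat.exists_eq_add_of_le h
  obtain ⟨b, hb⟩ := Nat.exists_eq_add_of_le h'
  have e : q.1 + q.2 - (r.1 + r.2) = a + b := by omega
  have e' : q.1 + q.2 + 2 = a + b + (r.1 + r.2) + 2 := by omega
  rw [e, e']
  push_cast
  ring

/-- The polynomials `c_{m,n}` attached to the coefficients `t` of the correction polynomial. -/
noncomputable def densityPoly (t : ℕ × ℕ → ℂ) (m n : ℕ) : Polynomial ℝ :=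
  ∑ q ∈ triangleFive,
    Polynomial.C ((t q * ((gaussPoly q.1).coeff m * (gaussPoly q.2).coeff n)).re / Real.pi)
      * Polynomial.X ^ (q.1 + q.2 - (m + n))

theorem eval_densityPoly_zero {t : ℕ × ℕ → ℂ} (ht : t (0, 0) = 1) :
    (densityPoly t 0 0).eval 0 = 1 / Real.pi := by
  rw [densityPoly, Polynomial.eval_finsetSum, Finset.sum_eq_single ((0, 0) : ℕ × ℕ)]
  · simp [ht, gaussPoly]
  · intro q _ hq
    have : q.1 + q.2 ≠ 0 := fun h => hq (Prod.ext (by simp only; omega) (by simp only; omega))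
    rw [Polynomial.eval_mul, Polynomial.eval_pow, Polynomial.eval_X, add_zero, Nat.sub_zero,
      zero_pow this, mul_zero]
  · intro h
    exact absurd (mem_triangleFive.2 (by simp)) h

/-- The coefficients t are only known to be complex. As the density is real, it is enough to match
real parts, which is why `densityPoly` takes them. -/
theorem re_sum_eval_gaussPoly (t : ℕ × ℕ → ℂ) {ψ : ℝ} (hψ : 0 < ψ) (x y : ℝ) :
    (∑ q ∈ triangleFive, t q * ((((1 / √ψ : ℝ) : ℂ)) ^ (q.1 + q.2 + 2)
        * ((gaussPoly q.1).eval ((1 / √ψ * x : ℝ) : ℂ)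
          * (gaussPoly q.2).eval ((1 / √ψ * y : ℝ) : ℂ)))).re
        * (Real.exp (-((1 / √ψ) ^ 2 * (x ^ 2 + y ^ 2))) / Real.pi)
      = mainTerm (densityPoly t) ψ x y := by
  have hs : (1 / √ψ) ^ 2 = 1 / ψ := by rw [div_pow, Real.sq_sqrt hψ.le, one_pow]
  have he : -((1 / √ψ) ^ 2 * (x ^ 2 + y ^ 2)) = -(x ^ 2 + y ^ 2) / ψ := by rw [hs]; ring
  rw [he, mainTerm, Complex.re_sum]
  rw [Finset.sum_congr rfl fun q hq => by
    rw [pow_mul_eval_gaussPoly_mul_eval_gaussPoly _ x y hq, Finset.mul_sum, Complex.re_sum]]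
  rw [Finset.sum_comm, Finset.sum_mul]
  refine Finset.sum_congr rfl fun r _ => ?_
  rw [densityPoly, Polynomial.eval_finsetSum, Finset.sum_mul, Finset.sum_div, Finset.sum_mul,
    Finset.sum_mul, Finset.sum_mul]
  refine Finset.sum_congr rfl fun q _ => ?_
  rw [← mul_assoc, Complex.re_mul_ofReal, hs]
  simp only [Polynomial.eval_mul, Polynomial.eval_C, Polynomial.eval_pow, Polynomial.eval_X]
  rw [one_div_pow]
  ring

theorem integrable_norm_pow_mul_exp {b : ℝ} (hb : 0 < b) (n : ℕ) :
    Integrable fun w : ℂ => ‖w‖ ^ n * Real.exp (-b * ‖w‖ ^ 2) := by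
  have h1 := integrable_rexp_neg_mul_sq_norm (V := ℂ) hb
  have h2 := (integrable_rexp_neg_mul_sq_norm (V := ℂ) (half_pos hb)).const_mul
    (n.factorial / (b / 2) ^ n)
  refine (h1.add h2).mono' (by fun_prop) (Eventually.of_forall fun w => ?_)
  rw [Real.norm_of_nonneg (by positivity), Pi.add_apply]
  have h3 : ‖w‖ ^ n ≤ 1 + (‖w‖ ^ 2) ^ n := by
    rcases le_total ‖w‖ 1 with h | h
    · linarith [pow_le_one₀ (norm_nonneg w) h (n := n), pow_nonneg (sq_nonneg ‖w‖) n]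
    · rw [← pow_mul]
      linarith [pow_le_pow_right₀ h (show n ≤ 2 * n by omega)]
  have h4 := Real.pow_div_factorial_le_exp (x := b / 2 * ‖w‖ ^ 2) (by positivity) n
  rw [div_le_iff₀ (by positivity), mul_pow] at h4
  have h5 : (‖w‖ ^ 2) ^ n ≤ n.factorial / (b / 2) ^ n * Real.exp (b / 2 * ‖w‖ ^ 2) := by
    rw [div_mul_eq_mul_div, le_div_iff₀ (by positivity)]; linarith
  calc ‖w‖ ^ n * Real.exp (-b * ‖w‖ ^ 2)
      ≤ (1 + n.factorial / (b / 2) ^ n * Real.exp (b / 2 * ‖w‖ ^ 2)) * Real.exp (-b * ‖w‖ ^ 2) := by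
        gcongr; linarith
    _ = Real.exp (-b * ‖w‖ ^ 2) + n.factorial / (b / 2) ^ n
          * (Real.exp (b / 2 * ‖w‖ ^ 2) * Real.exp (-b * ‖w‖ ^ 2)) := by ring
    _ = _ := by rw [← Real.exp_add]; congr 3; ring

/-- The substitution w ↦ (√ψ/2) w gives (ψ/4)^{-3} from |w|^6 and (ψ/4)^{-1} from the area element.
This is where the exponent 4 of the final error comes from. -/
theorem integral_norm_pow_six_mul_exp {ψ : ℝ} (hψ : 0 < ψ) :
    ∫ w : ℂ, ‖w‖ ^ 6 * Real.exp (-(ψ / 4) * ‖w‖ ^ 2)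
      = 256 / ψ ^ 4 * ∫ w : ℂ, ‖w‖ ^ 6 * Real.exp (-1 * ‖w‖ ^ 2) := by
  have h := Measure.integral_comp_smul (volume : Measure ℂ)
    (fun w => ‖w‖ ^ 6 * Real.exp (-1 * ‖w‖ ^ 2)) (√ψ / 2)
  have hR : (√ψ / 2) ^ 2 = ψ / 4 := by rw [div_pow, Real.sq_sqrt hψ.le]; norm_num
  have e : ∀ w : ℂ, ‖(√ψ / 2) • w‖ ^ 6 * Real.exp (-1 * ‖(√ψ / 2) • w‖ ^ 2)
      = (ψ / 4) ^ 3 * (‖w‖ ^ 6 * Real.exp (-(ψ / 4) * ‖w‖ ^ 2)) := by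
    intro w
    rw [norm_smul, Real.norm_of_nonneg (by positivity), mul_pow, mul_pow, hR,
      show (√ψ / 2) ^ 6 = ((√ψ / 2) ^ 2) ^ 3 by ring, hR]
    ring_nf
  simp only [e] at h
  rw [integral_const_mul, Complex.finrank_real_complex, hR, abs_of_nonneg (by positivity),
    smul_eq_mul] at h
  field_simp at h ⊢
  linarith

/-- The correction polynomial with coefficients `t`. -/
noncomputable def trianglePoly (t : ℕ × ℕ → ℂ) (w : ℂ) : ℂ :=
  ∑ q ∈ triangleFive, t q * ((w.re : ℂ) ^ q.1 * (w.im : ℂ) ^ q.2)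

theorem norm_re_pow_mul_im_pow_le (w : ℂ) (a b : ℕ) :
    ‖(w.re : ℂ) ^ a * (w.im : ℂ) ^ b‖ ≤ ‖w‖ ^ (a + b) := by
  rw [norm_mul, norm_pow, norm_pow, Complex.norm_real, Complex.norm_real, pow_add]
  gcongr
  · exact Complex.abs_re_le_norm _
  · exact Complex.abs_im_le_norm _

/-- Outside the unit disc the degree may be raised to six, so the Gaussian term there falls under
the same error as inside. -/
theorem norm_trianglePoly_le (t : ℕ × ℕ → ℂ) {w : ℂ} (hw : 1 ≤ ‖w‖) :
    ‖trianglePoly t w‖ ≤ (∑ q ∈ triangleFive, ‖t q‖) * ‖w‖ ^ 6 := by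
  rw [trianglePoly, Finset.sum_mul]
  refine norm_sum_le_of_le _ fun q hq => ?_
  rw [norm_mul]
  gcongr
  refine (norm_re_pow_mul_im_pow_le w _ _).trans (pow_le_pow_right₀ hw ?_)
  exact (mem_triangleFive.1 hq).trans (by norm_num)

theorem integrable_monomial_mul_gaussian {b : ℝ} (hb : 0 < b) (z : ℂ) (j k : ℕ) :
    Integrable fun w : ℂ => ((w.re : ℂ) ^ j * (w.im : ℂ) ^ k) * (Real.exp (-b * ‖w‖ ^ 2) : ℂ)
        * Complex.exp (-(⟪w, z⟫ * Complex.I)) := by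
  refine (integrable_norm_pow_mul_exp hb (j + k)).mono' ?_ (Eventually.of_forall fun w => ?_)
  · refine Continuous.aestronglyMeasurable ?_
    have : Continuous fun w : ℂ => ⟪w, z⟫ := continuous_id.inner continuous_const
    fun_prop
  · have : ‖Complex.exp (-(⟪w, z⟫ * Complex.I))‖ = 1 := by
      rw [← neg_mul, ← Complex.ofReal_neg, Complex.norm_exp_ofReal_mul_I]
    rw [norm_mul, this, mul_one, norm_mul, Complex.norm_real, Real.norm_of_nonneg (Real.exp_pos _).le]
    gcongr
    exact norm_re_pow_mul_im_pow_le w j k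

theorem trianglePoly_mul_eq_sum (t : ℕ × ℕ → ℂ) (a c w : ℂ) : trianglePoly t w * a * c
    = ∑ q ∈ triangleFive, t q * ((w.re : ℂ) ^ q.1 * (w.im : ℂ) ^ q.2 * a * c) := by
  rw [trianglePoly, Finset.sum_mul, Finset.sum_mul]
  exact Finset.sum_congr rfl fun q _ => by ring

theorem integrable_trianglePoly_mul_gaussian (t : ℕ × ℕ → ℂ) {b : ℝ} (hb : 0 < b) (z : ℂ) :
    Integrable fun w : ℂ => trianglePoly t w * (Real.exp (-b * ‖w‖ ^ 2) : ℂ)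
        * Complex.exp (-(⟪w, z⟫ * Complex.I)) := by
  simp only [trianglePoly_mul_eq_sum]
  exact integrable_finsetSum _ fun q _ => (integrable_monomial_mul_gaussian hb z q.1 q.2).const_mul _

theorem re_integral_trianglePoly_mul_gaussian (t : ℕ × ℕ → ℂ) {ψ : ℝ} (hψ : 0 < ψ) (z : ℂ) :
    ((((2 * Real.pi) ^ 2)⁻¹ : ℝ) * ∫ w : ℂ, trianglePoly t w * (Real.exp (-(ψ / 4) * ‖w‖ ^ 2) : ℂ)
        * Complex.exp (-(⟪w, z⟫ * Complex.I))).re = mainTerm (densityPoly t) ψ z.re z.im := by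
  have hψ4 : ψ / 4 = 1 / (4 * (1 / √ψ) ^ 2) := by
    rw [div_pow, Real.sq_sqrt hψ.le]; field_simp
  simp only [trianglePoly_mul_eq_sum]
  rw [integral_finsetSum _ fun q _ =>
    (integrable_monomial_mul_gaussian (by positivity) z q.1 q.2).const_mul _]
  simp only [integral_const_mul]
  rw [hψ4]
  simp only [integral_monomial_mul_gaussian (show 0 < 1 / √ψ by positivity) z]
  rw [← re_sum_eval_gaussPoly t hψ, ← Complex.re_mul_ofReal]
  congr 1
  rw [Finset.mul_sum, Finset.sum_mul]
  refine Finset.sum_congr rfl fun q _ => ?_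
  have hpi : (Real.pi : ℂ) ≠ 0 := by exact_mod_cast Real.pi_pos.ne'
  push_cast
  field_simp
  ring

/-! ### Comparison of the density with its main term -/

/-- On the unit disc the expansion at the origin is multiplied by the Gaussian, and σ - 1/2 is
traded for ψ^{-4}. Outside, the two terms are bounded separately. Both error terms are integrable
over the plane with integral O(ψ^{-4}). -/
theorem exists_norm_charFun_sub_trianglePoly_le : ∃ (t : ℕ × ℕ → ℂ) (C : ℝ), t (0, 0) = 1 ∧ 0 ≤ C ∧
    ∀ σ : ℝ, 1 / 2 < σ → σ ≤ 3 / 4 → ∀ w : ℂ,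
      ‖charFun (logZetaLaw σ) w - trianglePoly t w * (Real.exp (-(psi σ / 4) * ‖w‖ ^ 2) : ℂ)‖
        ≤ C * (‖w‖ ^ 6 * Real.exp (-(psi σ / 4) * ‖w‖ ^ 2)
          + (psi σ ^ 4)⁻¹ * ((1 + ‖w‖) ^ 3)⁻¹) := by
  obtain ⟨t, ht, htw⟩ := exists_one_add_tsum_eulerCorrection_eq
  obtain ⟨C₁, hC₁, h₁⟩ := exists_norm_charFun_mul_exp_sub_le
  obtain ⟨C₂, hC₂, h₂⟩ := exists_sub_half_le_div_psi_pow
  obtain ⟨C₃, hC₃, h₃⟩ := exists_norm_charFun_logZetaLaw_le_div_psi_pow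
  set K := ∑ q ∈ triangleFive, ‖t q‖ with hK
  have hK0 : 0 ≤ K := Finset.sum_nonneg fun _ _ => norm_nonneg _
  refine ⟨t, C₁ + 8 * C₁ * C₂ + K + C₃, ht, by positivity, fun σ hσ hσ' w => ?_⟩
  have hψ : 0 < psi σ := by linarith [one_fourth_le_psi hσ hσ']
  set E := Real.exp (-(psi σ / 4) * ‖w‖ ^ 2) with hE
  set a := ‖w‖ ^ 6 * E with ha
  set b := (psi σ ^ 4)⁻¹ * ((1 + ‖w‖) ^ 3)⁻¹ with hb
  have hE0 : 0 < E := Real.exp_pos _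
  have ha0 : 0 ≤ a := by positivity
  have hb0 : 0 ≤ b := by positivity
  rcases le_total ‖w‖ 1 with hw | hw
  · have h := h₁ σ hσ w hw
    rw [htw w hw, ← trianglePoly] at h
    have hEE : (Real.exp (psi σ * ‖w‖ ^ 2 / 4) : ℂ) * (E : ℂ) = 1 := by
      rw [← Complex.ofReal_mul, hE, ← Real.exp_add, show psi σ * ‖w‖ ^ 2 / 4 + -(psi σ / 4) * ‖w‖ ^ 2 = 0 by ring]
      simp
    have e : charFun (logZetaLaw σ) w - trianglePoly t w * (E : ℂ)
        = (charFun (logZetaLaw σ) w * (Real.exp (psi σ * ‖w‖ ^ 2 / 4) : ℂ) - trianglePoly t w)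
          * (E : ℂ) := by
      rw [sub_mul, mul_assoc, hEE, mul_one]
    rw [e, norm_mul, Complex.norm_real, Real.norm_of_nonneg hE0.le]
    have hE1 : E ≤ 1 := Real.exp_le_one_iff.2 (by nlinarith [sq_nonneg ‖w‖])
    have h8 : (1 : ℝ) ≤ 8 * ((1 + ‖w‖) ^ 3)⁻¹ := by
      rw [← div_eq_mul_inv, le_div_iff₀ (by positivity), one_mul]
      calc (1 + ‖w‖) ^ 3 ≤ (1 + 1) ^ 3 := by gcongr
        _ = 8 := by norm_num
    have h9 : (σ - 1 / 2) * E ≤ 8 * C₂ * b := by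
      calc (σ - 1 / 2) * E ≤ (C₂ / psi σ ^ 4) * 1 := by
            gcongr
            exact h₂ σ hσ hσ'
        _ ≤ (C₂ / psi σ ^ 4) * (8 * ((1 + ‖w‖) ^ 3)⁻¹) := by gcongr
        _ = _ := by rw [hb]; ring
    calc _ ≤ C₁ * (‖w‖ ^ 6 + (σ - 1 / 2)) * E := by gcongr
      _ = C₁ * a + C₁ * ((σ - 1 / 2) * E) := by rw [ha]; ring
      _ ≤ C₁ * a + C₁ * (8 * C₂ * b) := by gcongr
      _ ≤ _ := by
        have k1 : 0 ≤ (8 * C₁ * C₂ + K + C₃) * a := by positivity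
        have k2 : 0 ≤ (C₁ + K + C₃) * b := by positivity
        linarith
  · refine (norm_sub_le _ _).trans ?_
    rw [norm_mul, Complex.norm_real, Real.norm_of_nonneg hE0.le]
    have h := h₃ σ hσ hσ' w hw
    have h' := mul_le_mul_of_nonneg_right (norm_trianglePoly_le t hw) hE0.le
    rw [← hK] at h'
    calc _ ≤ C₃ / psi σ ^ 4 * ((1 + ‖w‖) ^ 3)⁻¹ + K * ‖w‖ ^ 6 * E := by gcongr
      _ = C₃ * b + K * a := by rw [ha, hb]; ring
      _ ≤ _ := by
        have k1 : 0 ≤ (C₁ + 8 * C₁ * C₂ + C₃) * a := by positivity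
        have k2 : 0 ≤ (C₁ + 8 * C₁ * C₂ + K) * b := by positivity
        linarith

theorem exists_abs_density_sub_mainTerm_le : ∃ (t : ℕ × ℕ → ℂ) (C : ℝ), t (0, 0) = 1 ∧ 0 ≤ C ∧
    ∀ σ : ℝ, 1 / 2 < σ → σ ≤ 3 / 4 → ∀ f : ℂ → ℝ,
      (∀ z, (f z : ℂ) = (((2 * Real.pi) ^ 2)⁻¹ : ℝ)
        * ∫ w, charFun (logZetaLaw σ) w * Complex.exp (-(⟪w, z⟫ * Complex.I))) →
      ∀ z, |f z - mainTerm (densityPoly t) (psi σ) z.re z.im| ≤ C / psi σ ^ 4 := by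
  obtain ⟨t, C, ht, hC, h⟩ := exists_norm_charFun_sub_trianglePoly_le
  set A := ∫ w : ℂ, ‖w‖ ^ 6 * Real.exp (-1 * ‖w‖ ^ 2) with hA
  set B := ∫ w : ℂ, ((1 + ‖w‖) ^ 3)⁻¹ with hB
  have hA0 : 0 ≤ A := integral_nonneg fun w => by positivity
  have hB0 : 0 ≤ B := integral_nonneg fun w => by positivity
  refine ⟨t, ((2 * Real.pi) ^ 2)⁻¹ * (C * (256 * A + B)), ht, by positivity,
    fun σ hσ hσ' f hf z => ?_⟩
  have := isProbabilityMeasure_logZetaLaw hσ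
  have hψ : 0 < psi σ := by linarith [one_fourth_le_psi hσ hσ']
  have hphase : ∀ w : ℂ, ‖Complex.exp (-(⟪w, z⟫ * Complex.I))‖ = 1 := fun w => by
    rw [← neg_mul, ← Complex.ofReal_neg, Complex.norm_exp_ofReal_mul_I]
  have i1 : Integrable fun w => charFun (logZetaLaw σ) w * Complex.exp (-(⟪w, z⟫ * Complex.I)) := by
    refine (integrable_pow_mul_norm_charFun_logZetaLaw hσ hσ' 0).mono' ?_
      (Eventually.of_forall fun w => ?_)
    · have : Continuous fun w : ℂ => ⟪w, z⟫ := continuous_id.inner continuous_const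
      have := continuous_charFun (μ := logZetaLaw σ)
      exact Continuous.aestronglyMeasurable (by fun_prop)
    · rw [norm_mul, hphase, mul_one, pow_zero, one_mul]
  have i2 := integrable_trianglePoly_mul_gaussian t (show 0 < psi σ / 4 by positivity) z
  rw [← re_integral_trianglePoly_mul_gaussian t hψ z]
  have e : f z - ((((2 * Real.pi) ^ 2)⁻¹ : ℝ) * ∫ w : ℂ, trianglePoly t w
        * (Real.exp (-(psi σ / 4) * ‖w‖ ^ 2) : ℂ) * Complex.exp (-(⟪w, z⟫ * Complex.I))).re
      = ((((2 * Real.pi) ^ 2)⁻¹ : ℝ) * ∫ w : ℂ, (charFun (logZetaLaw σ) w - trianglePoly t w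
        * (Real.exp (-(psi σ / 4) * ‖w‖ ^ 2) : ℂ)) * Complex.exp (-(⟪w, z⟫ * Complex.I))).re := by
    simp only [sub_mul]
    rw [integral_sub i1 i2, mul_sub, ← hf z, Complex.sub_re, Complex.ofReal_re]
  rw [e]
  refine (Complex.abs_re_le_norm _).trans ?_
  rw [norm_mul, Complex.norm_real, Real.norm_of_nonneg (by positivity), mul_div_assoc]
  gcongr
  have j1 := integrable_norm_pow_mul_exp (show 0 < psi σ / 4 by positivity) 6
  have j2 := integrable_inv_one_add_norm_pow_three.const_mul (psi σ ^ 4)⁻¹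
  refine (norm_integral_le_of_norm_le ((j1.add j2).const_mul C)
    (Eventually.of_forall fun w => ?_)).trans_eq ?_
  · rw [norm_mul, hphase, mul_one]
    exact h σ hσ hσ' w
  · rw [integral_const_mul]
    simp only [Pi.add_apply]
    rw [integral_add j1 j2, integral_const_mul, integral_norm_pow_six_mul_exp hψ]
    ring

theorem mainTheorem6 :
    ∃ (c : ℕ → ℕ → Polynomial ℝ) (C : ℝ),
      (c 0 0).eval 0 = 1 / Real.pi ∧
      ∀ σ : ℝ, 1 / 2 < σ → σ ≤ 3 / 4 →
        Summable (psiTerm σ) ∧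
        |psi σ - Real.log (1 / (σ - 1 / 2))| ≤ C ∧
        ∃ F : ℝ × ℝ → ℝ,
          ContDiff ℝ ∞ F ∧ (∀ z, 0 ≤ F z) ∧ Integrable F ∧
          (∀ (Ω : Type*) [MeasurableSpace Ω] (P : Measure Ω) [IsProbabilityMeasure P]
            (X : Nat.Primes → Ω → ℂ),
            (∀ p, Measurable (X p)) → (∀ p, P.map (X p) = circleUniform) → iIndepFun X P →
            (∀ᵐ w ∂P,
              Tendsto (logEulerPartial σ (fun p => X p w)) atTop
                (𝓝 (logEulerZeta σ (fun p => X p w))) ∧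
              Tendsto (eulerPartial σ (fun p => X p w)) atTop
                (𝓝 (eulerZeta σ (fun p => X p w))) ∧
              Complex.exp (logEulerZeta σ (fun p => X p w)) =
                eulerZeta σ (fun p => X p w)) ∧
            ∀ B : Set (ℝ × ℝ), MeasurableSet B →
              P.real {w | ((logEulerZeta σ (fun p => X p w)).re,
                  (logEulerZeta σ (fun p => X p w)).im) ∈ B} = ∫ z in B, F z) ∧
          ∀ x y : ℝ, |F (x, y) - mainTerm c (psi σ) x y| ≤ C / psi σ ^ 4 := by
  obtain ⟨C₁, h₁⟩ := exists_abs_psi_sub_log_le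
  obtain ⟨t, C₂, ht, hC₂, h₂⟩ := exists_abs_density_sub_mainTerm_le
  refine ⟨densityPoly t, max C₁ C₂, eval_densityPoly_zero ht, fun σ hσ hσ' =>
    ⟨summable_psiTerm hσ, (h₁ σ hσ hσ').trans (le_max_left _ _), ?_⟩⟩
  have := isProbabilityMeasure_logZetaLaw hσ
  have hψ : 0 < psi σ := by linarith [one_fourth_le_psi hσ hσ']
  obtain ⟨f, hf, hf0, hfi, hfB, hff⟩ := exists_contDiff_density
    (integrable_pow_mul_norm_charFun_logZetaLaw hσ hσ')
  -- The density is built on the inner product space ℂ and carried to ℝ × ℝ by the volume-preserving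
  -- identification.
  have hmp := Complex.volume_preserving_equiv_real_prod.symm
  refine ⟨fun z => f (Complex.equivRealProdCLM.symm z), hf.comp Complex.equivRealProdCLM.symm.contDiff,
    fun z => hf0 _, ?_, fun Ω _ P _ X hX hlaw hind => ⟨ae_tendsto_eulerPartial hX hlaw hind hσ, ?_⟩, ?_⟩
  · exact (hmp.integrable_comp_emb (MeasurableEquiv.measurableEmbedding _)).2 hfi
  · intro B hB
    set D := Complex.measurableEquivRealProd ⁻¹' B with hD
    have hDm : MeasurableSet D := Complex.measurableEquivRealProd.measurable hB
    have e1 : P.real {w | ((logEulerZeta σ (fun p => X p w)).re,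
        (logEulerZeta σ (fun p => X p w)).im) ∈ B} = (logZetaLaw σ).real D := by
      rw [← map_logEulerZeta_eq_logZetaLaw hX hlaw hind hσ,
        map_measureReal_apply_of_aemeasurable (aemeasurable_logEulerZeta hX hlaw hind hσ) hDm]
      rfl
    rw [e1, hfB D hDm, ← hmp.setIntegral_preimage_emb (MeasurableEquiv.measurableEmbedding _)]
    rw [hD, ← Set.preimage_comp, MeasurableEquiv.self_comp_symm, Set.preimage_id]
    rfl
  · intro x y
    refine (h₂ σ hσ hσ' f ?_ ⟨x, y⟩).trans (by gcongr; exact le_max_right _ _)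
    intro z
    rw [hff z, Complex.finrank_real_complex]
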